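/- **Theorem (Kummer–Pearson VII relation).** For a partition $\tau=(t_1\ge t_2\ge\dots\ge t_m\ge 0)$ of $t$ into at most $m$ parts and $\beta\in\mathbb C$ put $(\beta)_t=\beta(\beta+1)\cdots(\beta+t-1)$, $(\beta)_0=1$, and $(\beta)_\tau=\prod_{i=1}^m\bigl(\beta-\tfrac12(i-1)\bigr)_{t_i}$. For a real symmetric $m\times m$ matrix $X$ let $C_\tau(X)$ be the zonal polynomial of $X$: the $C_\tau$, $\tau$ running over the partitions of $t$ into at most $m$ parts, are the symmetric homogeneous polynomials of degree $t$ in the eigenvalues $y_1,\dots,y_m$ of $X$ such that $C_\tau$ is a multiple of $y_1^{t_1}\cdots y_m^{t_m}$ plus (up to permutation of the variables) monomials whose exponents are partitions smaller than $\tau$ in the dominance order, $C_\tau$ is an eigenfunction of $\sum_i y_i^2\partial_i^2+\sum_i\sum_{j\ne i}\frac{y_i^2}{y_i-y_j}\partial_i$ with eigenvalue $\sum_i t_i(t_i-i)+t(m-1)$, and $\sum_\tau C_\tau(X)=(\operatorname{tr}X)^t$. For $f:\mathbb N\to\mathbb C$ define $${}_1P_1\bigl(f(t):a;c;X\bigr)=\sum_{t=0}^\infty\frac{f(t)}{t!}\sum_{\tau}\frac{(a)_\tau}{(c)_\tau}\,C_\tau(X),$$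 the inner sum being over the partitions $\tau$ of $t$ into at most $m$ parts. Let $X$ be a real symmetric positive definite $m\times m$ matrix and let $a,c\in\mathbb C$ satisfy $\operatorname{Re}(a)>\frac12(m-1)$, $\operatorname{Re}(c)>\frac12(m-1)$ and $\operatorname{Re}(c-a)>\frac12(m-1)$. Let $b,d$ be real numbers such that either $|d|>\operatorname{tr}X$ and $|d-\operatorname{tr}X|>\operatorname{tr}X$ (that is, $d>2\operatorname{tr}X$ or $d<-\operatorname{tr}X$), or $b\in\{0,-1,-2,\dots\}$ and $d\neq\operatorname{tr}X$. Then the two series below (as series in $t$) converge absolutely and $${}_1P_1\bigl((b)_t\,d^{-b-t}:a;c;X\bigr)=(d-\operatorname{tr}X)^{-b}\;{}_1P_1\bigl((b)_t\,(d-\operatorname{tr}X)^{-t}:c-a;c;-X\bigr),$$ where powers of negative reals are taken with the principal branch and $0^0=1$. -/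

import Mathlib

noncomputable section

namespace KummerPearson

/-- The partitions `τ = (t₁ ≥ t₂ ≥ ⋯ ≥ t_m ≥ 0)` of `t` into at most `m` parts
(indices are shifted: `τ i` is the part `t_{i+1}`). -/
def partitions (m t : ℕ) : Finset (Fin m → ℕ) :=
  open Classical in
  (Finset.piAntidiag (Finset.univ : Finset (Fin m)) t).filter fun τ => Antitone τ

/-- Dominance order of partitions: every initial sum of `μ` is at most that of `κ`. -/
def Dominated {m : ℕ} (μ κ : Fin m → ℕ) : Prop :=
  ∀ r : Fin m, ∑ i ∈ Finset.Iic r, μ i ≤ ∑ i ∈ Finset.Iic r, κ i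

/-- The Laplace–Beltrami type operator
`Δ = ∑ᵢ yᵢ² ∂ᵢ² + ∑ᵢ ∑_{j ≠ i} yᵢ² / (yᵢ - yⱼ) ∂ᵢ`
applied to the polynomial `P` and evaluated at `y` (meant for pairwise distinct `yᵢ`). -/
def laplaceBeltrami {m : ℕ} (P : MvPolynomial (Fin m) ℝ) (y : Fin m → ℝ) : ℝ :=
  ∑ i, y i ^ 2 * MvPolynomial.eval y (MvPolynomial.pderiv i (MvPolynomial.pderiv i P)) +
    ∑ i, ∑ j ∈ Finset.univ.erase i,
      y i ^ 2 / (y i - y j) * MvPolynomial.eval y (MvPolynomial.pderiv i P)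

/-- The eigenvalue `∑ᵢ kᵢ (kᵢ - i) + k (m - 1)` of `Δ` that belongs to the partition `κ`
of `k`, where `i` runs from `1` to `m`. -/
def zonalEigenvalue {m : ℕ} (κ : Fin m → ℕ) : ℝ :=
  ∑ i, (κ i : ℝ) * ((κ i : ℝ) - ((i : ℕ) + 1)) + (∑ i, (κ i : ℝ)) * ((m : ℝ) - 1)

/-- `C` is the family of zonal polynomials of degree `t` in `m` variables: for each partition
`κ` of `t`, `C κ` is a symmetric homogeneous polynomial of degree `t` whose highest term is a
multiple of `y^κ`, all other partitions occurring in it being dominated by `κ`; it is an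
eigenfunction of `Δ`; and the `C κ` sum to `(y₁ + ⋯ + y_m)^t`. -/
structure IsZonalFamily (m t : ℕ) (C : (Fin m → ℕ) → MvPolynomial (Fin m) ℝ) : Prop where
  symmetric : ∀ κ ∈ partitions m t, (C κ).IsSymmetric
  homogeneous : ∀ κ ∈ partitions m t, (C κ).IsHomogeneous t
  triangular : ∀ κ ∈ partitions m t, ∀ μ ∈ partitions m t,
    (C κ).coeff (Finsupp.equivFunOnFinite.symm μ) ≠ 0 → Dominated μ κ
  eigenfunction : ∀ κ ∈ partitions m t, ∀ y : Fin m → ℝ, Function.Injective y →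
    laplaceBeltrami (C κ) y = zonalEigenvalue κ * MvPolynomial.eval y (C κ)
  sum_eq : ∑ κ ∈ partitions m t, C κ = (∑ i, MvPolynomial.X i) ^ t

/-- The zonal polynomial of the partition `κ` in the latent roots `y₁, …, y_m`. The conditions
in `IsZonalFamily` determine it uniquely: `Δ` is triangular for the dominance order on the
monomial symmetric polynomials, with eigenvalues that differ for comparable partitions. -/
def zonalPoly {m : ℕ} (κ : Fin m → ℕ) : MvPolynomial (Fin m) ℝ :=
  Classical.epsilon (IsZonalFamily m (∑ i, κ i)) κ

/-- The zonal polynomial `C_κ(X)` of a real symmetric matrix `X`. -/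
def zonal {m : ℕ} (κ : Fin m → ℕ) (X : Matrix (Fin m) (Fin m) ℝ) (hX : X.IsHermitian) : ℝ :=
  MvPolynomial.eval hX.eigenvalues (zonalPoly κ)

/-- The rising factorial `(β)_t = β (β + 1) ⋯ (β + t - 1)`. -/
def poch (β : ℂ) (t : ℕ) : ℂ := ∏ j ∈ Finset.range t, (β + j)

/-- The generalized rising factorial `(β)_τ = ∏ᵢ (β - (i - 1)/2)_{tᵢ}`, `i` from `1` to `m`. -/
def pochPartition {m : ℕ} (β : ℂ) (τ : Fin m → ℕ) : ℂ :=
  ∏ i : Fin m, poch (β - ((i : ℕ) : ℂ) / 2) (τ i)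

/-- The term of index `t` of the series `₁P₁(f(t) : a; c; X)`. -/
def onePoneTerm {m : ℕ} (f : ℕ → ℂ) (a c : ℂ) (X : Matrix (Fin m) (Fin m) ℝ)
    (hX : X.IsHermitian) (t : ℕ) : ℂ :=
  f t / (t.factorial : ℂ) *
    ∑ τ ∈ partitions m t, pochPartition a τ / pochPartition c τ * (zonal τ X hX : ℂ)

/-- `₁P₁(f(t) : a; c; X) = ∑_t f(t)/t! ∑_τ (a)_τ / (c)_τ C_τ(X)`. -/
def onePone {m : ℕ} (f : ℕ → ℂ) (a c : ℂ) (X : Matrix (Fin m) (Fin m) ℝ)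
    (hX : X.IsHermitian) : ℂ :=
  ∑' t, onePoneTerm f a c X hX t

end KummerPearson

end

/-! ### Leading minors, power functions and lower triangular conjugation. -/

noncomputable section

namespace KummerPearson

open Matrix Finset

variable {R : Type*} [CommRing R] {m : ℕ}

/-! Put T = tr X and let F_t, G_t be the inner sums ∑ (a)_κ/(c)_κ C_κ(X) and ∑ (c-a)_κ/(c)_κ C_κ(X).
The core is an identity in each degree, F_t = ∑_k binom(t,k) T^(t-k) (-1)^k G_k
(`pochSum_zonal_kummer`).

For a = p/2 and c = (p+q)/2 this is a statement about a uniformly random projection P of rank p in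
dimension p+q. If X = g gᵀ, then tr(g P gᵀ) = T - tr(g (1-P) gᵀ); expanding the t-th power and
averaging gives the identity (`sum_wishartMoment_eq`), because the t-th moment of tr(g P gᵀ) is F_t.
After multiplication by (c)_(t,…,t) both sides are polynomials in a and c-a, so agreement at all
large half integers is enough (`pochSum_eq_of_half_integers`).

To compute that moment, the zonal polynomials are identified with multiples of orbit means of power
functions, i.e. products of powers of leading minors (`sphericalPoly`). A power function is
multiplied by a character under S ↦ T S Tᵀ with T lower triangular, and every g is a lower
triangular matrix times orthonormal rows; this gives the product formula `integral_powerFn_conj`.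
The same property, applied to diag(y) + ε v vᵀ and averaged over v as if v were normally
distributed, gives the differential equation (`laplaceBeltrami_sphericalPoly`). Triangularity for
the dominance order and strict growth of the eigenvalue then leave only scalar multiples
(`IsZonalFamily.exists_smul`). The mean of the power function over random projections is a quotient
of two Gaussian moments, found one matrix row at a time (`lintegral_minorPower`,
`orbitMean_projection`).

For convergence, C_κ(X) ≥ 0, since the kernel ∫ tr(A Q B Qᵀ)^t dQ is positive semidefinite
(`coeff_trace_pow_nonneg`). These values sum to T^t and the quotients (a)_κ/(c)_κ are bounded, so
F_t and G_t are O(T^t). Inserting the finite identity into the series and summing one index by the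
binomial series gives the relation when 2T|x| < 1 (`tsum_poch_binomial_transform`). The choice x =
1/d handles d > 2T; for d < -T the roles of a and c-a are exchanged and x = -1/(d-T). For b = -n
only finite sums occur. -/

/-- The leading principal minor of size `i + 1`. -/
def leadMinor (S : Matrix (Fin m) (Fin m) R) (i : Fin m) : R :=
  (S.submatrix (Fin.castLE i.isLt) (Fin.castLE i.isLt)).det

/-- The sequence `κ` continued by zero. -/
def extendZero (κ : Fin m → ℕ) (j : ℕ) : ℕ := if h : j < m then κ ⟨j, h⟩ else 0

/-- The difference `κᵢ - κᵢ₊₁` of consecutive parts. -/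
def partStep (κ : Fin m → ℕ) (i : Fin m) : ℕ := extendZero κ i - extendZero κ (i + 1)

/-- The power function `∏ᵢ Δᵢ(S) ^ (κᵢ - κᵢ₊₁)`, a product of powers of leading minors. -/
def powerFn (κ : Fin m → ℕ) (S : Matrix (Fin m) (Fin m) R) : R :=
  ∏ i, leadMinor S i ^ partStep κ i

lemma extendZero_val (κ : Fin m → ℕ) (i : Fin m) : extendZero κ i = κ i := by
  simp [extendZero]

lemma extendZero_antitone {κ : Fin m → ℕ} (hκ : Antitone κ) : Antitone (extendZero κ) := by
  intro a b hab
  unfold extendZero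
  split_ifs with hb ha
  · exact hκ (by simpa using hab)
  · omega
  · exact Nat.zero_le _
  · exact le_rfl

/-- Subtraction is truncated here, so the telescoping relies on `e` being antitone. -/
lemma sum_Ico_sub_succ {e : ℕ → ℕ} (he : Antitone e) {a b : ℕ} (hab : a ≤ b) :
    ∑ i ∈ Ico a b, (e i - e (i + 1)) = e a - e b := by
  induction b, hab using Nat.le_induction with
  | base => simp
  | succ n hn ih =>
    rw [Finset.sum_Ico_succ_top hn, ih]
    have h1 := he hn
    have h2 := he (Nat.le_succ n)
    simp only [Nat.succ_eq_add_one] at h2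
    omega

lemma sum_Ici_partStep {κ : Fin m → ℕ} (hκ : Antitone κ) (j : Fin m) :
    ∑ i ∈ Ici j, partStep κ i = κ j := by
  have h := sum_Ico_sub_succ (extendZero_antitone hκ) j.isLt.le
  have h0 : extendZero κ m = 0 := by simp [extendZero]
  rw [h0, extendZero_val, Nat.sub_zero] at h
  rw [← h, ← Fin.map_valEmbedding_Ici, Finset.sum_map]
  rfl

/-- Summation by parts for the steps of a partition. -/
lemma sum_partStep_mul {κ : Fin m → ℕ} (hκ : Antitone κ) (x : Fin m → R) :
    ∑ i, (partStep κ i : R) * ∑ j ∈ Iic i, x j = ∑ j, (κ j : R) * x j := by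
  simp_rw [Finset.mul_sum]
  rw [Finset.sum_comm' (t' := univ) (s' := fun j => Ici j) (by simp)]
  refine Finset.sum_congr rfl fun j _ => ?_
  rw [← Finset.sum_mul, ← Nat.cast_sum, sum_Ici_partStep hκ]

lemma sum_partStep_mul_nat {κ : Fin m → ℕ} (hκ : Antitone κ) (x : Fin m → ℕ) :
    ∑ i, partStep κ i * ∑ j ∈ Iic i, x j = ∑ j, κ j * x j := by
  have := sum_partStep_mul (R := ℤ) hκ (fun j => (x j : ℤ))
  exact_mod_cast this

lemma map_leadMinor {R' : Type*} [CommRing R'] (φ : R →+* R') (S : Matrix (Fin m) (Fin m) R)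
    (i : Fin m) : φ (leadMinor S i) = leadMinor (S.map φ) i := by
  simp only [leadMinor, RingHom.map_det]
  rfl

lemma map_powerFn {R' : Type*} [CommRing R'] (φ : R →+* R') (κ : Fin m → ℕ)
    (S : Matrix (Fin m) (Fin m) R) : φ (powerFn κ S) = powerFn κ (S.map φ) := by
  simp [powerFn, map_prod, map_pow, map_leadMinor]

/-- Sums over `Fin m` of terms vanishing beyond `i` are sums over the initial segment. -/
lemma sum_eq_sum_castLE {i : Fin m} {f : Fin m → R} (hf : ∀ j, i < j → f j = 0) :
    ∑ j, f j = ∑ a : Fin (i + 1), f (Fin.castLE i.isLt a) := by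
  rw [← Finset.sum_subset (s₁ := univ.map (Fin.castLEEmb i.isLt)) (subset_univ _)]
  · rw [Finset.sum_map]; rfl
  · intro j _ hj
    apply hf
    by_contra hij
    apply hj
    simp only [Finset.mem_map, Finset.mem_univ, true_and]
    exact ⟨⟨j, by have := not_lt.mp hij; rw [Fin.le_def] at this; omega⟩, by ext; simp⟩

lemma sum_castLE_eq_sum_Iic (i : Fin m) (f : Fin m → R) :
    ∑ a : Fin (i + 1), f (Fin.castLE i.isLt a) = ∑ j ∈ Iic i, f j := by
  have := sum_eq_sum_castLE (i := i) (f := fun j => if j ≤ i then f j else 0)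
    (fun j hj => by simp [hj])
  rw [← Finset.sum_filter, show univ.filter (· ≤ i) = Iic i by ext; simp] at this
  rw [this]
  refine Finset.sum_congr rfl fun a _ => ?_
  rw [if_pos]
  rw [Fin.le_def, Fin.val_castLE]
  omega

/-- Lower triangular matrices act on the power function by a character. -/
lemma leadMinor_lowerTriangular_conj {T : Matrix (Fin m) (Fin m) R}
    (hT : ∀ i j, i < j → T i j = 0) (S : Matrix (Fin m) (Fin m) R) (i : Fin m) :
    leadMinor (T * S * Tᵀ) i = leadMinor (T * Tᵀ) i * leadMinor S i := by
  set c := Fin.castLE i.isLt with hc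
  -- The first `i + 1` rows of `T` vanish beyond column `i`, so passing to the leading block
  -- commutes with the triple product.
  have hci : ∀ a : Fin (i + 1), ∀ j, i < j → T (c a) j = 0 := fun a j hj =>
    hT _ _ (lt_of_le_of_lt (by rw [Fin.le_def, hc, Fin.val_castLE]; omega) hj)
  have h1 : (T * S * Tᵀ).submatrix c c =
      T.submatrix c c * S.submatrix c c * (T.submatrix c c)ᵀ := by
    ext a b
    simp only [submatrix_apply, mul_apply, transpose_apply]
    rw [sum_eq_sum_castLE (i := i)]
    · refine Finset.sum_congr rfl fun x _ => ?_
      rw [sum_eq_sum_castLE (i := i)]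
      intro j hj
      rw [hci a j hj, zero_mul]
    · intro j hj
      rw [hci b j hj, mul_zero]
  have h2 : (T * Tᵀ).submatrix c c = T.submatrix c c * (T.submatrix c c)ᵀ := by
    ext a b
    simp only [submatrix_apply, mul_apply, transpose_apply]
    rw [sum_eq_sum_castLE (i := i)]
    intro j hj
    rw [hci b j hj, mul_zero]
  rw [leadMinor, leadMinor, leadMinor, ← hc, h1, h2, det_mul, det_mul, det_mul]
  ring

/-- This character property is the only fact about power functions behind both the product formula
and the differential equation of their orbit means. -/
lemma powerFn_lowerTriangular_conj {T : Matrix (Fin m) (Fin m) R}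
    (hT : ∀ i j, i < j → T i j = 0) (κ : Fin m → ℕ) (S : Matrix (Fin m) (Fin m) R) :
    powerFn κ (T * S * Tᵀ) = powerFn κ (T * Tᵀ) * powerFn κ S := by
  simp only [powerFn, leadMinor_lowerTriangular_conj hT, mul_pow, Finset.prod_mul_distrib]

/-- A leading block of a rank one perturbation of 1 is again of this form, so the matrix determinant
lemma applies. -/
lemma leadMinor_one_add_vecMulVec (v w : Fin m → R) (i : Fin m) :
    leadMinor (1 + vecMulVec v w) i = 1 + ∑ j ∈ Iic i, w j * v j := by
  have h : (1 + vecMulVec v w).submatrix (Fin.castLE i.isLt) (Fin.castLE i.isLt) =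
      1 + replicateCol Unit (v ∘ Fin.castLE i.isLt) *
        replicateRow Unit (w ∘ Fin.castLE i.isLt) := by
    ext a b
    simp [vecMulVec_apply, mul_apply, Matrix.one_apply, Fin.ext_iff]
  rw [leadMinor, h, det_one_add_replicateCol_mul_replicateRow,
    ← sum_castLE_eq_sum_Iic i (fun j => w j * v j)]
  rfl

lemma leadMinor_smul (c : R) (S : Matrix (Fin m) (Fin m) R) (i : Fin m) :
    leadMinor (c • S) i = c ^ ((i : ℕ) + 1) * leadMinor S i := by
  rw [leadMinor, show (c • S).submatrix (Fin.castLE i.isLt) (Fin.castLE i.isLt) =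
    c • S.submatrix (Fin.castLE i.isLt) (Fin.castLE i.isLt) from rfl, det_smul, Fintype.card_fin,
    leadMinor]

lemma sum_partStep_mul_succ {κ : Fin m → ℕ} (hκ : Antitone κ) :
    ∑ i : Fin m, ((i : ℕ) + 1) * partStep κ i = ∑ i, κ i := by
  have := sum_partStep_mul_nat hκ (fun _ => 1)
  simp only [sum_const, Fin.card_Iic, smul_eq_mul, mul_one] at this
  simpa [mul_comm] using this

lemma powerFn_smul {κ : Fin m → ℕ} (hκ : Antitone κ) (c : R) (S : Matrix (Fin m) (Fin m) R) :
    powerFn κ (c • S) = c ^ (∑ i, κ i) * powerFn κ S := by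
  simp only [powerFn, leadMinor_smul, mul_pow, Finset.prod_mul_distrib, ← pow_mul]
  rw [Finset.prod_pow_eq_pow_sum, sum_partStep_mul_succ hκ]

lemma powerFn_nonneg (κ : Fin m → ℕ) {S : Matrix (Fin m) (Fin m) ℝ} (hS : S.PosSemidef) :
    0 ≤ powerFn κ S :=
  Finset.prod_nonneg fun _ _ => pow_nonneg (hS.submatrix _).det_nonneg _

end KummerPearson

end

/-! ### Dominance order and the highest monomial of a power function on an orthogonal orbit. -/

noncomputable section

namespace KummerPearson

open Matrix Finset

section Dominance

variable {R : Type*} [CommRing R] {m : ℕ}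

lemma sum_Iic_injective {M : Type*} [AddCommGroup M] {f g : Fin m → M}
    (h : ∀ r, ∑ i ∈ Iic r, f i = ∑ i ∈ Iic r, g i) : f = g := by
  funext i
  induction i using WellFoundedLT.induction with
  | ind i ih =>
    have h1 := h i
    rw [← Iio_insert, Finset.sum_insert (by simp), Finset.sum_insert (by simp),
      Finset.sum_congr rfl (fun j hj => ih j (by simpa using hj))] at h1
    exact add_right_cancel h1

lemma Dominated.antisymm {s a : Fin m → ℕ} (h1 : Dominated s a) (h2 : Dominated a s) : s = a := by
  have := sum_Iic_injective (f := fun i => (s i : ℤ)) (g := fun i => (a i : ℤ)) fun r => by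
    exact_mod_cast le_antisymm (h1 r) (h2 r)
  funext i
  exact_mod_cast congrFun this i

lemma Dominated.refl (s : Fin m → ℕ) : Dominated s s := fun _ => le_rfl

lemma Dominated.add {s s' a a' : Fin m → ℕ} (h1 : Dominated s a) (h2 : Dominated s' a') :
    Dominated (s + s') (a + a') := fun r => by
  simp only [Pi.add_apply, Finset.sum_add_distrib]
  exact add_le_add (h1 r) (h2 r)

/-- All exponents of `P` are dominated by `a`. -/
def DomBounded (P : MvPolynomial (Fin m) R) (a : Fin m →₀ ℕ) : Prop :=
  ∀ s, P.coeff s ≠ 0 → Dominated s a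

lemma DomBounded.mul {P Q : MvPolynomial (Fin m) R} {a b : Fin m →₀ ℕ} (hP : DomBounded P a)
    (hQ : DomBounded Q b) : DomBounded (P * Q) (a + b) := by
  classical
  intro s hs
  rw [MvPolynomial.coeff_mul] at hs
  obtain ⟨x, hx, hne⟩ := Finset.exists_ne_zero_of_sum_ne_zero hs
  rw [HasAntidiagonal.mem_antidiagonal] at hx
  rw [← hx, Finsupp.coe_add, Finsupp.coe_add]
  exact (hP _ (left_ne_zero_of_mul hne)).add (hQ _ (right_ne_zero_of_mul hne))

/-- Highest terms multiply: if x ≤ a and y ≤ b in dominance and x + y = a + b, all partial sums must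
agree, so the pair (a, b) alone contributes. -/
lemma DomBounded.coeff_mul {P Q : MvPolynomial (Fin m) R} {a b : Fin m →₀ ℕ}
    (hP : DomBounded P a) (hQ : DomBounded Q b) :
    (P * Q).coeff (a + b) = P.coeff a * Q.coeff b := by
  classical
  rw [MvPolynomial.coeff_mul, Finset.sum_eq_single (a, b)]
  · rintro ⟨x, y⟩ hxy hne
    rw [HasAntidiagonal.mem_antidiagonal] at hxy
    simp only at hxy
    by_contra h
    have h1 : Dominated x a := hP _ (left_ne_zero_of_mul h)
    have h2 : Dominated y b := hQ _ (right_ne_zero_of_mul h)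
    have h3 : ∀ r, ∑ i ∈ Iic r, x i + ∑ i ∈ Iic r, y i =
        ∑ i ∈ Iic r, a i + ∑ i ∈ Iic r, b i := fun r => by
      rw [← Finset.sum_add_distrib, ← Finset.sum_add_distrib]
      exact Finset.sum_congr rfl fun i _ => DFunLike.congr_fun hxy i
    apply hne
    rw [Prod.mk.injEq]
    exact ⟨DFunLike.coe_injective (h1.antisymm fun r => by have := h2 r; have := h3 r; omega),
      DFunLike.coe_injective (h2.antisymm fun r => by have := h1 r; have := h3 r; omega)⟩
  · intro h
    exact absurd (by simp) h

lemma domBounded_one : DomBounded (1 : MvPolynomial (Fin m) R) 0 := by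
  classical
  intro s hs
  rw [MvPolynomial.coeff_one] at hs
  split_ifs at hs with h
  · rw [← h]; exact Dominated.refl _
  · exact absurd rfl hs

lemma DomBounded.pow {P : MvPolynomial (Fin m) R} {a : Fin m →₀ ℕ} (hP : DomBounded P a) (n : ℕ) :
    DomBounded (P ^ n) (n • a) ∧ (P ^ n).coeff (n • a) = P.coeff a ^ n := by
  induction n with
  | zero => simpa using domBounded_one
  | succ n ih =>
    rw [pow_succ, succ_nsmul, pow_succ]
    exact ⟨ih.1.mul hP, by rw [ih.1.coeff_mul hP, ih.2]⟩

lemma DomBounded.prod {ι : Type*} (s : Finset ι) {P : ι → MvPolynomial (Fin m) R}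
    {a : ι → Fin m →₀ ℕ} (hP : ∀ i, DomBounded (P i) (a i)) :
    DomBounded (∏ i ∈ s, P i) (∑ i ∈ s, a i) ∧
      (∏ i ∈ s, P i).coeff (∑ i ∈ s, a i) = ∏ i ∈ s, (P i).coeff (a i) := by
  classical
  induction s using Finset.induction_on with
  | empty => simpa using domBounded_one
  | insert i s hi ih =>
    rw [Finset.prod_insert hi, Finset.sum_insert hi, Finset.prod_insert hi]
    exact ⟨(hP i).mul ih.1, by rw [(hP i).coeff_mul ih.1, ih.2]⟩

end Dominance

variable {m : ℕ}

/-- The matrix `H diag(X₁, …, X_m) Hᵀ` of linear forms. -/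
def conjDiag (H : Matrix (Fin m) (Fin m) ℝ) : Matrix (Fin m) (Fin m) (MvPolynomial (Fin m) ℝ) :=
  H.map MvPolynomial.C * diagonal MvPolynomial.X * (H.map MvPolynomial.C)ᵀ

/-- The indicator of the initial segment up to `i`, as an exponent. -/
def initialSegment (i : Fin m) : Fin m →₀ ℕ :=
  Finsupp.equivFunOnFinite.symm fun j => if j ≤ i then 1 else 0

lemma conjDiag_map_eval (H : Matrix (Fin m) (Fin m) ℝ) (y : Fin m → ℝ) :
    (conjDiag H).map (MvPolynomial.eval y) = H * diagonal y * Hᵀ := by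
  have h : ∀ A : Matrix (Fin m) (Fin m) ℝ, (A.map MvPolynomial.C).map (MvPolynomial.eval y) = A :=
    fun A => by ext; simp
  rw [conjDiag, Matrix.map_mul, Matrix.map_mul, h, ← transpose_map, h]
  congr 2
  rw [diagonal_map (map_zero _)]
  congr 1
  ext i
  simp

/-- Each row of the block is a sum over the variables; multilinearity of the determinant in its rows
expands the minor, with `f` recording the variable picked in each row. This is Cauchy–Binet before
grouping terms. -/
lemma leadMinor_conjDiag (H : Matrix (Fin m) (Fin m) ℝ) (i : Fin m) :
    leadMinor (conjDiag H) i = ∑ f : Fin (i + 1) → Fin m,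
      MvPolynomial.monomial (∑ a, Finsupp.single (f a) 1)
        ((∏ a, H (Fin.castLE i.isLt a) (f a)) *
          (of fun a b => H (Fin.castLE i.isLt b) (f a)).det) := by
  set c := Fin.castLE i.isLt
  have h1 : (conjDiag H).submatrix c c = fun a => ∑ j : Fin m,
      (fun b => MvPolynomial.C (H (c a) j) * MvPolynomial.X j * MvPolynomial.C (H (c b) j)) := by
    funext a b
    simp [conjDiag, mul_apply, diagonal_apply]
  rw [leadMinor, h1]
  change detRowAlternating.toMultilinearMap _ = _
  rw [MultilinearMap.map_sum]
  refine Finset.sum_congr rfl fun f _ => ?_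
  change Matrix.det (of fun a b => (MvPolynomial.C (H (c a) (f a)) * MvPolynomial.X (f a)) *
    (of fun a b => MvPolynomial.C (H (c b) (f a))) a b) = _
  rw [det_mul_column]
  have h2 : (of fun a b => (MvPolynomial.C (H (c b) (f a)) : MvPolynomial (Fin m) ℝ)).det =
      MvPolynomial.C ((of fun a b => H (c b) (f a)).det) := by
    rw [RingHom.map_det]; rfl
  rw [h2, Finset.prod_mul_distrib, ← map_prod, mul_right_comm, ← map_mul]
  rw [MvPolynomial.monomial_eq]
  congr 1
  rw [Finsupp.prod_fintype _ _ (by simp)]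
  simp only [Finsupp.finsetSum_apply, ← Finset.prod_pow_eq_pow_sum]
  rw [Finset.prod_comm]
  refine Finset.prod_congr rfl fun a _ => ?_
  rw [Finset.prod_eq_single (f a)]
  · simp
  · intro b _ hb
    simp [hb.symm]
  · simp

lemma det_eq_zero_of_not_injective (H : Matrix (Fin m) (Fin m) ℝ) {i : Fin m}
    {f : Fin (i + 1) → Fin m} (hf : ¬ Function.Injective f) :
    (of fun a b => H (Fin.castLE i.isLt b) (f a)).det = 0 := by
  simp only [Function.Injective, not_forall] at hf
  obtain ⟨a, b, hab, hne⟩ := hf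
  refine det_zero_of_row_eq hne ?_
  ext x
  simp [hab]

lemma sum_single_apply {n : ℕ} (f : Fin n → Fin m) (j : Fin m) :
    (∑ a, Finsupp.single (f a) 1 : Fin m →₀ ℕ) j = #{a | f a = j} := by
  simp [Finsupp.finsetSum_apply, Finsupp.single_apply]

lemma sum_Iic_sum_single {n : ℕ} (f : Fin n → Fin m) (r : Fin m) :
    ∑ j ∈ Iic r, (∑ a, Finsupp.single (f a) 1 : Fin m →₀ ℕ) j = #{a | f a ≤ r} := by
  simp only [sum_single_apply]
  rw [Finset.card_eq_sum_card_fiberwise (f := f) (t := Iic r) (by intro; simp)]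
  refine Finset.sum_congr rfl fun j hj => ?_
  congr 1
  ext a
  simp only [mem_filter, mem_univ, true_and]
  rw [mem_Iic] at hj
  exact ⟨fun h => ⟨h ▸ hj, h⟩, fun h => h.2⟩

lemma sum_Iic_initialSegment (i r : Fin m) :
    ∑ j ∈ Iic r, initialSegment i j = min ((i : ℕ) + 1) ((r : ℕ) + 1) := by
  simp only [initialSegment, Finsupp.equivFunOnFinite_symm_apply_apply]
  rw [← Finset.card_filter]
  rw [show (Iic r).filter (· ≤ i) = Iic (min i r) by ext; simp [and_comm], Fin.card_Iic]
  rcases le_total i r with h | h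
  · rw [min_eq_left h, min_eq_left]; rw [Fin.le_def] at h; omega
  · rw [min_eq_right h, min_eq_right]; rw [Fin.le_def] at h; omega

/-- Only injective choices `f` survive, and an injective `f` takes at most min(i+1, r+1) values in
the initial segment up to `r`. -/
lemma domBounded_leadMinor (H : Matrix (Fin m) (Fin m) ℝ) (i : Fin m) :
    DomBounded (leadMinor (conjDiag H) i) (initialSegment i) := by
  classical
  intro s hs
  rw [leadMinor_conjDiag, MvPolynomial.coeff_sum] at hs
  obtain ⟨f, -, hf⟩ := Finset.exists_ne_zero_of_sum_ne_zero hs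
  rw [MvPolynomial.coeff_monomial] at hf
  split_ifs at hf with h
  · have hinj : Function.Injective f := by
      by_contra hn
      rw [det_eq_zero_of_not_injective H hn, mul_zero] at hf
      exact hf rfl
    intro r
    rw [← h, sum_Iic_sum_single, sum_Iic_initialSegment]
    refine le_min ?_ ?_
    · exact (Finset.card_le_univ _).trans (by simp)
    · rw [← Fin.card_Iic r, ← Finset.card_image_of_injective _ hinj]
      refine Finset.card_le_card ?_
      intro j hj
      simp only [mem_image, mem_filter, mem_univ, true_and] at hj
      obtain ⟨a, ha, rfl⟩ := hj
      exact mem_Iic.2 ha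
  · exact absurd rfl hf

/-- The monomial comes exactly from the permutations of the first `i + 1` indices; their signs
reassemble one factor of the minor, the determinants in the coefficients supply the other. Being a
square, the coefficient cannot cancel in the Haar mean. -/
lemma coeff_leadMinor_conjDiag (H : Matrix (Fin m) (Fin m) ℝ) (i : Fin m) :
    (leadMinor (conjDiag H) i).coeff (initialSegment i) = leadMinor H i ^ 2 := by
  classical
  set c := Fin.castLE i.isLt
  have hc : ∀ a : Fin (i + 1), c a ≤ i := fun a => by
    rw [Fin.le_def]; change (a : ℕ) ≤ i; omega
  have hcinj : Function.Injective c := Fin.castLE_injective _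
  rw [leadMinor_conjDiag, MvPolynomial.coeff_sum]
  simp only [MvPolynomial.coeff_monomial]
  have key : leadMinor H i ^ 2 = ∑ σ : Equiv.Perm (Fin (i + 1)),
      (∏ a, H (c a) (c (σ a))) * (of fun a b => H (c b) (c (σ a))).det := by
    have h1 : ∀ σ : Equiv.Perm (Fin (i + 1)), (of fun a b => H (c b) (c (σ a))).det =
        (Equiv.Perm.sign σ : ℤ) * leadMinor H i := fun σ => by
      have := det_permute σ (H.submatrix c c)ᵀ
      rw [det_transpose] at this
      exact this
    simp only [h1]
    have h2 : leadMinor H i = ∑ σ : Equiv.Perm (Fin (i + 1)),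
        (Equiv.Perm.sign σ : ℤ) * ∏ a, H (c a) (c (σ a)) := by
      rw [leadMinor, ← det_transpose, det_apply']
      rfl
    rw [sq]
    nth_rewrite 1 [h2]
    rw [Finset.sum_mul]
    refine Finset.sum_congr rfl fun σ _ => by ring
  rw [key]
  symm
  -- Permutations are embedded among all choices `f`; a choice outside the image either repeats a
  -- row or has the wrong exponent.
  refine Finset.sum_of_injOn (fun σ a => c (σ a)) ?_ (by simp) ?_ ?_
  · intro σ _ τ _ h
    ext a
    exact congrArg Fin.val (hcinj (congrFun h a))
  · intro f _ hf
    split_ifs with h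
    · by_cases hinj : Function.Injective f
      · exfalso
        apply hf
        have hle : ∀ a, f a ≤ i := fun a => by
          by_contra hn
          have h1 := DFunLike.congr_fun h (f a)
          rw [sum_single_apply] at h1
          simp only [initialSegment, Finsupp.equivFunOnFinite_symm_apply_apply, if_neg hn] at h1
          rw [Finset.card_eq_zero, Finset.filter_eq_empty_iff] at h1
          exact h1 (mem_univ a) rfl
        have hb : Function.Bijective (fun a => (⟨f a, by
            have := hle a; rw [Fin.le_def] at this; omega⟩ : Fin (i + 1))) := by
          rw [Fintype.bijective_iff_injective_and_card]
          refine ⟨fun a b hab => hinj ?_, rfl⟩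
          ext
          simpa using hab
        exact ⟨Equiv.ofBijective _ hb, by simp, by ext; simp [c]⟩
      · rw [det_eq_zero_of_not_injective H hinj, mul_zero]
    · rfl
  · intro σ _
    rw [if_pos]
    ext j
    rw [sum_single_apply]
    simp only [initialSegment, Finsupp.equivFunOnFinite_symm_apply_apply]
    split_ifs with hj
    · rw [Finset.card_eq_one]
      refine ⟨σ.symm ⟨j, by rw [Fin.le_def] at hj; omega⟩, ?_⟩
      ext a
      simp only [mem_filter, mem_univ, true_and, mem_singleton, Equiv.eq_symm_apply]
      rw [Fin.ext_iff, Fin.ext_iff]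
      rfl
    · rw [Finset.card_eq_zero, Finset.filter_eq_empty_iff]
      rintro a - rfl
      exact hj (hc _)

lemma sum_partStep_initialSegment {κ : Fin m → ℕ} (hκ : Antitone κ) :
    ∑ i, partStep κ i • initialSegment i = Finsupp.equivFunOnFinite.symm κ := by
  ext j
  simp only [Finsupp.finsetSum_apply, Finsupp.smul_apply, initialSegment,
    Finsupp.equivFunOnFinite_symm_apply_apply, smul_eq_mul, mul_ite, mul_one, mul_zero]
  rw [← Finset.sum_filter, show univ.filter (j ≤ ·) = Ici j by ext; simp]
  exact sum_Ici_partStep hκ j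

lemma powerFn_conjDiag_domBounded {κ : Fin m → ℕ} (hκ : Antitone κ)
    (H : Matrix (Fin m) (Fin m) ℝ) :
    DomBounded (powerFn κ (conjDiag H)) (Finsupp.equivFunOnFinite.symm κ) ∧
      (powerFn κ (conjDiag H)).coeff (Finsupp.equivFunOnFinite.symm κ) =
        ∏ i, (leadMinor H i ^ 2) ^ partStep κ i := by
  have h := DomBounded.prod univ fun i => ((domBounded_leadMinor H i).pow (partStep κ i)).1
  rw [sum_partStep_initialSegment hκ] at h
  refine ⟨h.1, h.2.trans ?_⟩
  refine Finset.prod_congr rfl fun i _ => ?_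
  rw [((domBounded_leadMinor H i).pow (partStep κ i)).2, coeff_leadMinor_conjDiag]

lemma powerFn_conjDiag_isHomogeneous {κ : Fin m → ℕ} (hκ : Antitone κ)
    (H : Matrix (Fin m) (Fin m) ℝ) : (powerFn κ (conjDiag H)).IsHomogeneous (∑ i, κ i) := by
  rw [← sum_partStep_mul_succ hκ]
  refine MvPolynomial.IsHomogeneous.prod _ _ _ fun i _ => MvPolynomial.IsHomogeneous.pow ?_ _
  rw [leadMinor_conjDiag]
  refine MvPolynomial.IsHomogeneous.sum _ _ _ fun f _ => ?_
  refine MvPolynomial.isHomogeneous_monomial _ ?_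
  rw [map_sum]
  simp

end KummerPearson

end

/-! ### Haar measure on the orthogonal group and the product formula. -/

noncomputable section

namespace KummerPearson

open Matrix Finset MeasureTheory

variable {m n : ℕ}

section Haar

instance : MeasurableSpace (orthogonalGroup (Fin n) ℝ) := borel _

instance : BorelSpace (orthogonalGroup (Fin n) ℝ) := ⟨rfl⟩

instance : CompactSpace (orthogonalGroup (Fin n) ℝ) := by
  refine (isCompact_iff_compactSpace
    (s := (orthogonalGroup (Fin n) ℝ : Set (Matrix (Fin n) (Fin n) ℝ)))).1 ?_
  have hc : IsCompact (Set.univ.pi fun _ : Fin n => Set.univ.pi fun _ : Fin n =>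
      Set.Icc (-1 : ℝ) 1) :=
    isCompact_univ_pi fun _ => isCompact_univ_pi fun _ => isCompact_Icc
  refine hc.of_isClosed_subset ?_ ?_
  · have : (orthogonalGroup (Fin n) ℝ : Set (Matrix (Fin n) (Fin n) ℝ)) = {A | A * Aᵀ = 1} := by
      ext A
      exact mem_orthogonalGroup_iff _ _
    rw [this]
    exact isClosed_eq (continuous_id.matrix_mul continuous_id.matrix_transpose) continuous_const
  · intro A hA i _ j _
    have := entry_norm_bound_of_unitary hA i j
    rw [Real.norm_eq_abs, abs_le] at this
    exact this

/-- The invariant probability measure on the orthogonal group. -/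
def haarO (n : ℕ) : Measure (orthogonalGroup (Fin n) ℝ) := Measure.haarMeasure ⊤

instance : IsProbabilityMeasure (haarO n) := ⟨Measure.haarMeasure_self (K₀ := ⊤)⟩

instance : (haarO n).IsHaarMeasure := inferInstanceAs (Measure.haarMeasure _).IsHaarMeasure

lemma integrable_haarO {f : orthogonalGroup (Fin n) ℝ → ℝ} (hf : Continuous f) :
    Integrable f (haarO n) :=
  hf.integrable_of_hasCompactSupport (HasCompactSupport.of_compactSpace f)

/-- Unimodularity of a compact group: a right translate of the Haar measure is again a Haar
probability measure, hence the same one. -/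
instance : (haarO n).IsMulRightInvariant := by
  refine ⟨fun g => ?_⟩
  have : IsProbabilityMeasure ((haarO n).map (· * g)) :=
    Measure.isProbabilityMeasure_map (measurable_mul_const g).aemeasurable
  exact Measure.isHaarMeasure_eq_of_isProbabilityMeasure _ _

lemma coe_mul_transpose (Q : orthogonalGroup (Fin n) ℝ) :
    (Q : Matrix (Fin n) (Fin n) ℝ) * (Q : Matrix (Fin n) (Fin n) ℝ)ᵀ = 1 :=
  (mem_orthogonalGroup_iff _ _).1 Q.2

lemma coe_transpose_mul (Q : orthogonalGroup (Fin n) ℝ) :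
    (Q : Matrix (Fin n) (Fin n) ℝ)ᵀ * (Q : Matrix (Fin n) (Fin n) ℝ) = 1 :=
  (mem_orthogonalGroup_iff' _ _).1 Q.2

end Haar

lemma continuous_leadMinor {α : Type*} [TopologicalSpace α] {S : α → Matrix (Fin m) (Fin m) ℝ}
    (hS : Continuous S) (i : Fin m) : Continuous fun x => leadMinor (S x) i :=
  (hS.matrix_submatrix _ _).matrix_det

lemma continuous_powerFn (κ : Fin m → ℕ) {α : Type*} [TopologicalSpace α]
    {S : α → Matrix (Fin m) (Fin m) ℝ} (hS : Continuous S) :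
    Continuous fun x => powerFn κ (S x) :=
  continuous_finsetProd _ fun i _ => (continuous_leadMinor hS i).pow _

/-- The first `m` rows of a square matrix of size `n ≥ m`. -/
def topRows (h : m ≤ n) (Q : Matrix (Fin n) (Fin n) ℝ) : Matrix (Fin m) (Fin n) ℝ :=
  Q.submatrix (Fin.castLE h) id

lemma topRows_mul (h : m ≤ n) (K Q : Matrix (Fin n) (Fin n) ℝ) :
    topRows h (K * Q) = topRows h K * Q := rfl

lemma topRows_refl (Q : Matrix (Fin n) (Fin n) ℝ) : topRows le_rfl Q = Q := rfl

lemma topRows_mul_transpose (h : m ≤ n) (K : orthogonalGroup (Fin n) ℝ) :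
    topRows h K * (topRows h K)ᵀ = 1 := by
  have h1 : topRows h K * (topRows h K)ᵀ = ((K : Matrix (Fin n) (Fin n) ℝ) *
    (K : Matrix (Fin n) (Fin n) ℝ)ᵀ).submatrix (Fin.castLE h) (Fin.castLE h) := rfl
  rw [h1, coe_mul_transpose, submatrix_one _ (Fin.castLE_injective h)]

/-- Every rectangular matrix is a lower triangular matrix times orthonormal rows. -/
lemma exists_lowerTriangular_mul_topRows (h : m ≤ n) (g : Matrix (Fin m) (Fin n) ℝ) :
    ∃ T : Matrix (Fin m) (Fin m) ℝ, (∀ i j, i < j → T i j = 0) ∧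
      ∃ K : orthogonalGroup (Fin n) ℝ, g = T * topRows h K := by
  classical
  -- The rows of `g` are padded by zero vectors. The Gram–Schmidt basis is completed when vectors
  -- are dependent, so no rank condition on `g` is needed.
  let f : Fin n → EuclideanSpace ℝ (Fin n) := fun i =>
    if hi : (i : ℕ) < m then WithLp.toLp 2 (g ⟨i, hi⟩) else 0
  have hcard : Module.finrank ℝ (EuclideanSpace ℝ (Fin n)) = Fintype.card (Fin n) := by simp
  let b := InnerProductSpace.gramSchmidtOrthonormalBasis hcard f
  have hb : ∀ {i j}, i < j → inner ℝ (b j) (f i) = 0 := fun hij =>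
    InnerProductSpace.gramSchmidtOrthonormalBasis_inv_triangular hcard f hij
  have hK : (of fun i j => b i j) ∈ orthogonalGroup (Fin n) ℝ := by
    rw [mem_orthogonalGroup_iff]
    ext i j
    have := b.inner_eq_ite j i
    rw [PiLp.inner_apply] at this
    simp only [mul_apply, of_apply, transpose_apply, Matrix.one_apply]
    simp only [RCLike.inner_apply, conj_trivial] at this
    rw [this]
    simp [eq_comm]
  refine ⟨of fun i j => inner ℝ (b (Fin.castLE h j)) (f (Fin.castLE h i)), ?_, ⟨_, hK⟩, ?_⟩
  · intro i j hij
    exact hb hij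
  · ext i c
    have h1 := congrArg (fun v : EuclideanSpace ℝ (Fin n) => v c) (b.sum_repr' (f (Fin.castLE h i)))
    simp only [WithLp.ofLp_sum, Finset.sum_apply, PiLp.smul_apply, smul_eq_mul] at h1
    have h2 : f (Fin.castLE h i) c = g i c := by
      simp [f]
    rw [h2] at h1
    rw [← h1, mul_apply]
    rw [← Finset.sum_subset (s₁ := univ.map (Fin.castLEEmb h)) (subset_univ _)]
    · rw [Finset.sum_map]
      rfl
    · intro j _ hj
      rw [hb, zero_mul]
      rw [Fin.lt_def, Fin.val_castLE]
      by_contra hn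
      apply hj
      simp only [Finset.mem_map, Finset.mem_univ, true_and]
      exact ⟨⟨j, by omega⟩, by ext; simp⟩

/-- The mean of the power function over the orbit of `Λ`, cut down to size `m`. -/
def orbitMean (h : m ≤ n) (κ : Fin m → ℕ) (Λ : Matrix (Fin n) (Fin n) ℝ) : ℝ :=
  ∫ Q : orthogonalGroup (Fin n) ℝ, powerFn κ (topRows h Q * Λ * (topRows h Q)ᵀ) ∂haarO n

/-- The product formula for means of the power function. -/
lemma integral_powerFn_conj (h : m ≤ n) (κ : Fin m → ℕ) (g : Matrix (Fin m) (Fin n) ℝ)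
    (Λ : Matrix (Fin n) (Fin n) ℝ) :
    ∫ Q : orthogonalGroup (Fin n) ℝ,
      powerFn κ (g * ((Q : Matrix (Fin n) (Fin n) ℝ) * Λ * (Q : Matrix (Fin n) (Fin n) ℝ)ᵀ) * gᵀ)
        ∂haarO n = powerFn κ (g * gᵀ) * orbitMean h κ Λ := by
  -- `T` leaves the integral through the character, and `K` is absorbed by left invariance.
  obtain ⟨T, hT, K, hg⟩ := exists_lowerTriangular_mul_topRows h g
  have h1 : g * gᵀ = T * Tᵀ := by
    rw [hg, transpose_mul, Matrix.mul_assoc, ← Matrix.mul_assoc (topRows h K),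
      topRows_mul_transpose, Matrix.one_mul]
  have h2 : ∀ Q : orthogonalGroup (Fin n) ℝ,
      g * ((Q : Matrix (Fin n) (Fin n) ℝ) * Λ * (Q : Matrix (Fin n) (Fin n) ℝ)ᵀ) * gᵀ =
        T * (topRows h (K * Q : orthogonalGroup (Fin n) ℝ) * Λ *
          (topRows h (K * Q : orthogonalGroup (Fin n) ℝ))ᵀ) * Tᵀ := fun Q => by
    rw [hg, Submonoid.coe_mul, topRows_mul]
    simp only [transpose_mul, Matrix.mul_assoc]
  simp_rw [h2, powerFn_lowerTriangular_conj hT]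
  rw [integral_const_mul, h1, orbitMean,
    integral_mul_left_eq_self (μ := haarO n)
      (fun Q => powerFn κ (topRows h Q * Λ * (topRows h Q)ᵀ)) K]

end KummerPearson

end

/-! ### Spherical polynomials. -/

noncomputable section

namespace KummerPearson

open Matrix Finset MeasureTheory

variable {m n : ℕ}

section CoeffContinuous

variable {α : Type*} [TopologicalSpace α]

/-- Every coefficient of `P x` depends continuously on `x`. -/
def CoeffContinuous (P : α → MvPolynomial (Fin m) ℝ) : Prop :=
  ∀ s, Continuous fun x => (P x).coeff s

lemma CoeffContinuous.mul {P Q : α → MvPolynomial (Fin m) ℝ} (hP : CoeffContinuous P)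
    (hQ : CoeffContinuous Q) : CoeffContinuous fun x => P x * Q x := fun s => by
  classical
  simp only [MvPolynomial.coeff_mul]
  exact continuous_finsetSum _ fun x _ => (hP _).mul (hQ _)

lemma coeffContinuous_const (P : MvPolynomial (Fin m) ℝ) :
    CoeffContinuous fun _ : α => P := fun _ => continuous_const

lemma CoeffContinuous.pow {P : α → MvPolynomial (Fin m) ℝ} (hP : CoeffContinuous P) (k : ℕ) :
    CoeffContinuous fun x => P x ^ k := by
  induction k with
  | zero => simpa using coeffContinuous_const 1
  | succ k ih => simpa only [pow_succ] using ih.mul hP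

lemma CoeffContinuous.prod {ι : Type*} (s : Finset ι) {P : ι → α → MvPolynomial (Fin m) ℝ}
    (hP : ∀ i, CoeffContinuous (P i)) : CoeffContinuous fun x => ∏ i ∈ s, P i x := by
  classical
  induction s using Finset.induction_on with
  | empty => simpa using coeffContinuous_const 1
  | insert i s hi ih => simpa only [Finset.prod_insert hi] using (hP i).mul ih

lemma coeffContinuous_powerFn_conjDiag (κ : Fin m → ℕ) :
    CoeffContinuous fun H : orthogonalGroup (Fin m) ℝ =>
      powerFn κ (conjDiag (H : Matrix (Fin m) (Fin m) ℝ)) := by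
  have hH : ∀ i j, Continuous fun H : orthogonalGroup (Fin m) ℝ =>
      (H : Matrix (Fin m) (Fin m) ℝ) i j := fun i j => continuous_subtype_val.matrix_elem i j
  refine CoeffContinuous.prod _ fun i => CoeffContinuous.pow ?_ _
  intro s
  simp only [leadMinor_conjDiag, MvPolynomial.coeff_sum, MvPolynomial.coeff_monomial]
  refine continuous_finsetSum _ fun f _ => ?_
  split_ifs
  · refine (continuous_finsetProd _ fun a _ => hH _ _).mul (Continuous.matrix_det ?_)
    exact continuous_matrix fun a b => hH _ _
  · exact continuous_const

end CoeffContinuous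

/-- The spherical polynomial: the mean of the power function over the orthogonal orbit of a
diagonal matrix, as a polynomial in the diagonal entries. -/
def sphericalPoly (κ : Fin m → ℕ) : MvPolynomial (Fin m) ℝ :=
  ∑ s ∈ Finset.finsuppAntidiag univ (∑ i, κ i), MvPolynomial.monomial s
    (∫ H : orthogonalGroup (Fin m) ℝ,
      (powerFn κ (conjDiag (H : Matrix (Fin m) (Fin m) ℝ))).coeff s ∂haarO m)

lemma mem_finsuppAntidiag_univ {t : ℕ} {s : Fin m →₀ ℕ} :
    s ∈ Finset.finsuppAntidiag univ t ↔ s.degree = t := by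
  rw [Finset.mem_finsuppAntidiag, Finsupp.degree_eq_sum]
  simp

lemma coeff_sphericalPoly {κ : Fin m → ℕ} (hκ : Antitone κ) (s : Fin m →₀ ℕ) :
    (sphericalPoly κ).coeff s = ∫ H : orthogonalGroup (Fin m) ℝ,
      (powerFn κ (conjDiag (H : Matrix (Fin m) (Fin m) ℝ))).coeff s ∂haarO m := by
  classical
  simp only [sphericalPoly, MvPolynomial.coeff_sum, MvPolynomial.coeff_monomial]
  rw [Finset.sum_ite_eq']
  split_ifs with h
  · rfl
  · rw [mem_finsuppAntidiag_univ] at h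
    have : ∀ H : orthogonalGroup (Fin m) ℝ,
        (powerFn κ (conjDiag (H : Matrix (Fin m) (Fin m) ℝ))).coeff s = 0 := fun H =>
      (powerFn_conjDiag_isHomogeneous hκ _).coeff_eq_zero h
    simp [this]

lemma sphericalPoly_isHomogeneous (κ : Fin m → ℕ) :
    (sphericalPoly κ).IsHomogeneous (∑ i, κ i) :=
  MvPolynomial.IsHomogeneous.sum _ _ _ fun _ hs =>
    MvPolynomial.isHomogeneous_monomial _ (mem_finsuppAntidiag_univ.1 hs)

lemma eval_sphericalPoly {κ : Fin m → ℕ} (hκ : Antitone κ) (y : Fin m → ℝ) :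
    MvPolynomial.eval y (sphericalPoly κ) = ∫ H : orthogonalGroup (Fin m) ℝ,
      powerFn κ ((H : Matrix (Fin m) (Fin m) ℝ) * diagonal y *
        (H : Matrix (Fin m) (Fin m) ℝ)ᵀ) ∂haarO m := by
  have h1 : ∀ H : orthogonalGroup (Fin m) ℝ,
      powerFn κ ((H : Matrix (Fin m) (Fin m) ℝ) * diagonal y *
        (H : Matrix (Fin m) (Fin m) ℝ)ᵀ) =
      ∑ s ∈ Finset.finsuppAntidiag univ (∑ i, κ i),
        (powerFn κ (conjDiag (H : Matrix (Fin m) (Fin m) ℝ))).coeff s * ∏ i, y i ^ s i := by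
    intro H
    rw [← conjDiag_map_eval, ← map_powerFn, MvPolynomial.eval_eq']
    refine Finset.sum_subset ?_ ?_
    · intro s hs
      rw [mem_finsuppAntidiag_univ]
      by_contra hne
      exact MvPolynomial.mem_support_iff.1 hs
        ((powerFn_conjDiag_isHomogeneous hκ _).coeff_eq_zero hne)
    · intro s _ hs
      rw [MvPolynomial.notMem_support_iff.1 hs, zero_mul]
  simp_rw [h1]
  rw [integral_finsetSum]
  · rw [sphericalPoly, map_sum]
    refine Finset.sum_congr rfl fun s _ => ?_
    rw [MvPolynomial.eval_monomial, integral_mul_const, Finsupp.prod_fintype _ _ (by simp)]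
  · intro s _
    exact (integrable_haarO (coeffContinuous_powerFn_conjDiag κ s)).mul_const _

/-- Right invariance absorbs `U`, so the orbit mean depends on a symmetric matrix only through its
eigenvalues. -/
lemma integral_powerFn_conj_diagonal {κ : Fin m → ℕ} (hκ : Antitone κ)
    (U : orthogonalGroup (Fin m) ℝ) (y : Fin m → ℝ) :
    ∫ H : orthogonalGroup (Fin m) ℝ,
      powerFn κ ((H : Matrix (Fin m) (Fin m) ℝ) *
        ((U : Matrix (Fin m) (Fin m) ℝ) * diagonal y * (U : Matrix (Fin m) (Fin m) ℝ)ᵀ) *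
        (H : Matrix (Fin m) (Fin m) ℝ)ᵀ) ∂haarO m = MvPolynomial.eval y (sphericalPoly κ) := by
  rw [eval_sphericalPoly hκ, ← integral_mul_right_eq_self (μ := haarO m)
    (fun H => powerFn κ ((H : Matrix (Fin m) (Fin m) ℝ) * diagonal y *
        (H : Matrix (Fin m) (Fin m) ℝ)ᵀ)) U]
  simp only [Submonoid.coe_mul, transpose_mul, Matrix.mul_assoc]

lemma exists_orthogonal_diagonalization {S : Matrix (Fin m) (Fin m) ℝ} (hS : S.IsHermitian) :
    ∃ U : orthogonalGroup (Fin m) ℝ, S = (U : Matrix (Fin m) (Fin m) ℝ) *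
      diagonal hS.eigenvalues * (U : Matrix (Fin m) (Fin m) ℝ)ᵀ :=
  ⟨hS.eigenvectorUnitary, hS.spectral_theorem⟩

lemma integral_powerFn_conj_hermitian {κ : Fin m → ℕ} (hκ : Antitone κ)
    {S : Matrix (Fin m) (Fin m) ℝ} (hS : S.IsHermitian) :
    ∫ H : orthogonalGroup (Fin m) ℝ, powerFn κ ((H : Matrix (Fin m) (Fin m) ℝ) * S *
        (H : Matrix (Fin m) (Fin m) ℝ)ᵀ) ∂haarO m =
      MvPolynomial.eval hS.eigenvalues (sphericalPoly κ) := by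
  obtain ⟨U, hU⟩ := exists_orthogonal_diagonalization hS
  conv_lhs => rw [hU]
  exact integral_powerFn_conj_diagonal hκ U _

/-- Permutation matrices are orthogonal, and conjugation by them permutes the diagonal. -/
lemma sphericalPoly_isSymmetric {κ : Fin m → ℕ} (hκ : Antitone κ) :
    (sphericalPoly κ).IsSymmetric := by
  intro σ
  refine MvPolynomial.funext fun y => ?_
  have hU : (1 : Matrix (Fin m) (Fin m) ℝ).submatrix id σ ∈ orthogonalGroup (Fin m) ℝ := by
    rw [mem_orthogonalGroup_iff, transpose_submatrix, transpose_one, submatrix_mul_equiv,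
      Matrix.one_mul, submatrix_id_id]
  have hD : (1 : Matrix (Fin m) (Fin m) ℝ).submatrix id σ * diagonal (y ∘ σ) *
      ((1 : Matrix (Fin m) (Fin m) ℝ).submatrix id σ)ᵀ = diagonal y := by
    rw [← submatrix_diagonal_equiv, transpose_submatrix, transpose_one, submatrix_mul_equiv,
      submatrix_mul_equiv, Matrix.one_mul, Matrix.mul_one, submatrix_id_id]
  rw [MvPolynomial.eval_rename, ← integral_powerFn_conj_diagonal hκ ⟨_, hU⟩,
    eval_sphericalPoly hκ]
  simp only [hD]

lemma sphericalPoly_domBounded {κ : Fin m → ℕ} (hκ : Antitone κ) :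
    DomBounded (sphericalPoly κ) (Finsupp.equivFunOnFinite.symm κ) := by
  intro s hs
  by_contra hn
  apply hs
  rw [coeff_sphericalPoly hκ]
  have : ∀ H : orthogonalGroup (Fin m) ℝ,
      (powerFn κ (conjDiag (H : Matrix (Fin m) (Fin m) ℝ))).coeff s = 0 := fun H => by
    by_contra hne
    exact hn ((powerFn_conjDiag_domBounded hκ _).1 s hne)
  simp [this]

/-- The integrand is continuous, a product of even powers, and equal to 1 at the identity. -/
lemma coeff_sphericalPoly_self_pos {κ : Fin m → ℕ} (hκ : Antitone κ) :
    0 < (sphericalPoly κ).coeff (Finsupp.equivFunOnFinite.symm κ) := by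
  rw [coeff_sphericalPoly hκ]
  refine (coeffContinuous_powerFn_conjDiag κ _).integral_pos_of_hasCompactSupport_nonneg_nonzero
    (HasCompactSupport.of_compactSpace _) ?_ (x := 1) ?_
  · intro H
    simp only [(powerFn_conjDiag_domBounded hκ _).2]
    exact Finset.prod_nonneg fun i _ => pow_nonneg (sq_nonneg _) _
  · simp only [(powerFn_conjDiag_domBounded hκ _).2]
    have h1 : ∏ i, (leadMinor (1 : Matrix (Fin m) (Fin m) ℝ) i ^ 2) ^ partStep κ i = 1 := by
      have : ∀ i, leadMinor (1 : Matrix (Fin m) (Fin m) ℝ) i = 1 := fun i => by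
        simpa using leadMinor_one_add_vecMulVec (0 : Fin m → ℝ) 0 i
      simp [this]
    rw [OneMemClass.coe_one, h1]
    exact one_ne_zero

lemma eval_sphericalPoly_nonneg {κ : Fin m → ℕ} (hκ : Antitone κ) {y : Fin m → ℝ}
    (hy : ∀ i, 0 ≤ y i) : 0 ≤ MvPolynomial.eval y (sphericalPoly κ) := by
  rw [eval_sphericalPoly hκ]
  refine integral_nonneg fun H => powerFn_nonneg κ ?_
  have := (PosSemidef.diagonal hy).mul_mul_conjTranspose_same (H : Matrix (Fin m) (Fin m) ℝ)
  rwa [conjTranspose_eq_transpose_of_trivial] at this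

end KummerPearson

end

/-! ### Second order expansions and rank one perturbations. -/

noncomputable section

namespace KummerPearson

open Matrix Finset

variable {m : ℕ}

section Taylor

variable {A : Type*} [CommRing A] [Algebra ℝ A]

/-- Second order Taylor expansion at an increment whose triple products vanish. -/
lemma two_mul_aeval_add {z δ : Fin m → A} (hδ : ∀ i j k, δ i * δ j * δ k = 0)
    (F : MvPolynomial (Fin m) ℝ) :
    2 * MvPolynomial.aeval (z + δ) F = 2 * MvPolynomial.aeval z F +
      2 * ∑ i, MvPolynomial.aeval z (MvPolynomial.pderiv i F) * δ i +
      ∑ i, ∑ j, MvPolynomial.aeval z (MvPolynomial.pderiv i (MvPolynomial.pderiv j F)) *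
        (δ i * δ j) := by
  classical
  induction F using MvPolynomial.induction_on with
  | C a => simp
  | add p q hp hq =>
    simp only [map_add, add_mul, Finset.sum_add_distrib]
    linear_combination hp + hq
  | mul_X p k hp =>
    have hX : ∀ j, MvPolynomial.pderiv j (MvPolynomial.X k : MvPolynomial (Fin m) ℝ) =
        if j = k then 1 else 0 := fun j => by
      split_ifs with h
      · rw [h, MvPolynomial.pderiv_X_self]
      · rw [MvPolynomial.pderiv_X_of_ne (Ne.symm h)]
    have h1 : ∀ i, MvPolynomial.aeval z (MvPolynomial.pderiv i (p * MvPolynomial.X k)) =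
        MvPolynomial.aeval z (MvPolynomial.pderiv i p) * z k +
          MvPolynomial.aeval z p * (if i = k then 1 else 0) := fun i => by
      rw [MvPolynomial.pderiv_mul, hX, map_add, map_mul, map_mul, MvPolynomial.aeval_X]
      split_ifs <;> simp
    have h2 : ∀ i j, MvPolynomial.aeval z (MvPolynomial.pderiv i (MvPolynomial.pderiv j
        (p * MvPolynomial.X k))) =
        MvPolynomial.aeval z (MvPolynomial.pderiv i (MvPolynomial.pderiv j p)) * z k +
          MvPolynomial.aeval z (MvPolynomial.pderiv j p) * (if i = k then 1 else 0) +
          MvPolynomial.aeval z (MvPolynomial.pderiv i p) * (if j = k then 1 else 0) := fun i j => by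
      rw [MvPolynomial.pderiv_mul, hX, map_add, MvPolynomial.pderiv_mul, hX, map_add, map_add,
        map_mul, map_mul, MvPolynomial.aeval_X]
      congr 1
      · split_ifs <;> simp
      · split_ifs <;> simp
    have h3 : ∑ i, MvPolynomial.aeval z (MvPolynomial.pderiv i (p * MvPolynomial.X k)) * δ i =
        z k * ∑ i, MvPolynomial.aeval z (MvPolynomial.pderiv i p) * δ i +
          MvPolynomial.aeval z p * δ k := by
      simp only [h1, add_mul, Finset.sum_add_distrib, Finset.mul_sum]
      congr 1
      · exact Finset.sum_congr rfl fun i _ => by ring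
      · simp
    have h4 : ∑ i, ∑ j, MvPolynomial.aeval z (MvPolynomial.pderiv i (MvPolynomial.pderiv j
        (p * MvPolynomial.X k))) * (δ i * δ j) =
        z k * ∑ i, ∑ j, MvPolynomial.aeval z (MvPolynomial.pderiv i (MvPolynomial.pderiv j p)) *
          (δ i * δ j) +
        2 * (δ k * ∑ i, MvPolynomial.aeval z (MvPolynomial.pderiv i p) * δ i) := by
      simp only [h2, add_mul, Finset.sum_add_distrib]
      have e1 : ∑ i, ∑ j, MvPolynomial.aeval z (MvPolynomial.pderiv j p) *
          (if i = k then 1 else 0) * (δ i * δ j) =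
          ∑ i, δ k * (MvPolynomial.aeval z (MvPolynomial.pderiv i p) * δ i) := by
        rw [Finset.sum_comm]
        refine Finset.sum_congr rfl fun j _ => ?_
        simp only [mul_ite, mul_one, mul_zero, ite_mul, zero_mul, Finset.sum_ite_eq',
          Finset.mem_univ, if_true]
        ring
      have e2 : ∑ i, ∑ j, MvPolynomial.aeval z (MvPolynomial.pderiv i p) *
          (if j = k then 1 else 0) * (δ i * δ j) =
          ∑ i, δ k * (MvPolynomial.aeval z (MvPolynomial.pderiv i p) * δ i) := by
        refine Finset.sum_congr rfl fun j _ => ?_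
        simp only [mul_ite, mul_one, mul_zero, ite_mul, zero_mul, Finset.sum_ite_eq',
          Finset.mem_univ, if_true]
        ring
      rw [e1, e2, add_assoc, ← two_mul, ← Finset.mul_sum]
      congr 1
      simp only [Finset.mul_sum]
      refine Finset.sum_congr rfl fun i _ => Finset.sum_congr rfl fun j _ => by ring
    -- Multiplying by `z k + δ k` creates exactly one third order term, and it vanishes by
    -- hypothesis.
    have h5 : (∑ i, ∑ j, MvPolynomial.aeval z (MvPolynomial.pderiv i (MvPolynomial.pderiv j p)) *
        (δ i * δ j)) * δ k = 0 := by
      rw [Finset.sum_mul]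
      refine Finset.sum_eq_zero fun i _ => ?_
      rw [Finset.sum_mul]
      refine Finset.sum_eq_zero fun j _ => ?_
      rw [mul_assoc, hδ, mul_zero]
    rw [h3, h4, map_mul, map_mul, MvPolynomial.aeval_X, MvPolynomial.aeval_X, Pi.add_apply]
    linear_combination (z k + δ k) * hp + h5

lemma pderiv_prod_X (s : Finset (Fin m)) (i : Fin m) :
    MvPolynomial.pderiv i (∏ k ∈ s, MvPolynomial.X k : MvPolynomial (Fin m) ℝ) =
      if i ∈ s then ∏ k ∈ s.erase i, MvPolynomial.X k else 0 := by
  classical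
  induction s using Finset.induction_on with
  | empty => simp
  | insert a s ha ih =>
    rw [Finset.prod_insert ha, MvPolynomial.pderiv_mul, ih, MvPolynomial.pderiv_X,
      Pi.single_apply]
    by_cases hia : i = a
    · subst hia
      simp [ha]
    · rw [if_neg (Ne.symm hia), zero_mul, zero_add]
      by_cases his : i ∈ s
      · rw [if_pos his, if_pos (Finset.mem_insert_of_mem his),
          Finset.erase_insert_of_ne (Ne.symm hia), Finset.prod_insert
          (fun h => ha (Finset.mem_of_mem_erase h))]
      · rw [if_neg his, mul_zero, if_neg]
        simp [hia, his]

/-- The characteristic polynomial of a rank one perturbation, to second order. -/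
lemma prod_add_eq_of_triple_zero {z : Fin m → A} {e : A} (he : e * e * e = 0)
    {y w : Fin m → ℝ} (hy : Function.Injective y)
    (hz : ∀ i j, z i - z j = algebraMap ℝ A (y j - y i)) :
    ∏ i, (z i - (e * algebraMap ℝ A (w i) +
        e ^ 2 * algebraMap ℝ A (∑ j, w i * w j / (y i - y j)))) =
      ∏ i, z i - e * ∑ i, algebraMap ℝ A (w i) * ∏ k ∈ univ.erase i, z k := by
  classical
  -- The eigenvalue shifts of second order perturbation theory. The summand `j = i` is a division by
  -- zero, hence 0, as the formula requires.
  set δ : Fin m → A := fun i => -(e * algebraMap ℝ A (w i) +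
    e ^ 2 * algebraMap ℝ A (∑ j, w i * w j / (y i - y j))) with hδdef
  have hδ : ∀ i j k, δ i * δ j * δ k = 0 := fun i j k => by
    have : ∀ i, δ i = e * -(algebraMap ℝ A (w i) +
      e * algebraMap ℝ A (∑ j, w i * w j / (y i - y j))) := fun i => by rw [hδdef]; ring
    rw [this, this, this]
    generalize -(algebraMap ℝ A (w i) + _) = a
    generalize -(algebraMap ℝ A (w j) + _) = b
    generalize -(algebraMap ℝ A (w k) + _) = c
    linear_combination a * b * c * he
  have h := two_mul_aeval_add (z := z) hδ (∏ k, MvPolynomial.X k)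
  have hP : ∀ s : Finset (Fin m), MvPolynomial.aeval z (∏ k ∈ s, MvPolynomial.X k :
      MvPolynomial (Fin m) ℝ) = ∏ k ∈ s, z k := fun s => by simp [map_prod]
  have hP' : MvPolynomial.aeval (z + δ) (∏ k, MvPolynomial.X k :
      MvPolynomial (Fin m) ℝ) = ∏ k, (z k + δ k) := by simp [map_prod]
  have hδδ : ∀ i j, δ i * δ j = e ^ 2 * algebraMap ℝ A (w i * w j) := fun i j => by
    simp only [hδdef, map_mul]
    linear_combination (algebraMap ℝ A (w i) * algebraMap ℝ A (∑ k, w j * w k / (y j - y k)) +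
      algebraMap ℝ A (w j) * algebraMap ℝ A (∑ k, w i * w k / (y i - y k)) +
      e * algebraMap ℝ A (∑ k, w i * w k / (y i - y k)) *
        algebraMap ℝ A (∑ k, w j * w k / (y j - y k))) * he
  have hfirst : ∀ j, MvPolynomial.pderiv j (∏ k, MvPolynomial.X k : MvPolynomial (Fin m) ℝ) =
      ∏ k ∈ univ.erase j, MvPolynomial.X k := fun j => by rw [pderiv_prod_X, if_pos (mem_univ j)]
  simp only [hP', hfirst, hP] at h
  -- Two products with one factor missing differ by `y i - y j` times the product with both missing;
  -- dividing produces the partial fractions of the second order shifts.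
  have hsecond : ∀ i j, MvPolynomial.aeval z (MvPolynomial.pderiv i
      (∏ k ∈ univ.erase j, MvPolynomial.X k : MvPolynomial (Fin m) ℝ)) * algebraMap ℝ A (w i * w j)
      = algebraMap ℝ A (w i * w j / (y i - y j)) *
        (∏ k ∈ univ.erase i, z k - ∏ k ∈ univ.erase j, z k) := fun i j => by
    rw [pderiv_prod_X]
    by_cases hij : i = j
    · subst hij; simp
    · rw [if_pos (by simp [hij]), hP]
      have e1 : ∏ k ∈ univ.erase j, z k = z i * ∏ k ∈ (univ.erase j).erase i, z k :=
        (Finset.mul_prod_erase _ _ (by simp [hij])).symm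
      have e2 : ∏ k ∈ univ.erase i, z k = z j * ∏ k ∈ (univ.erase j).erase i, z k := by
        rw [Finset.erase_right_comm]
        exact (Finset.mul_prod_erase _ _ (by simp [Ne.symm hij])).symm
      rw [e1, e2, ← sub_mul, hz]
      have hne : y i - y j ≠ 0 := sub_ne_zero.2 fun h => hij (hy h)
      rw [← mul_assoc, ← map_mul, div_mul_cancel₀ _ hne]
      ring
  have h2 : ∑ i, ∑ j, MvPolynomial.aeval z (MvPolynomial.pderiv i
      (∏ k ∈ univ.erase j, MvPolynomial.X k : MvPolynomial (Fin m) ℝ)) * (δ i * δ j) =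
      e ^ 2 * (2 * ∑ i, algebraMap ℝ A (∑ j, w i * w j / (y i - y j)) *
        ∏ k ∈ univ.erase i, z k) := by
    -- Antisymmetry of `1 / (y i - y j)` turns the difference into two equal sums, which cancel the
    -- `e ^ 2` terms coming from the first derivative.
    have : ∀ i j, MvPolynomial.aeval z (MvPolynomial.pderiv i
        (∏ k ∈ univ.erase j, MvPolynomial.X k : MvPolynomial (Fin m) ℝ)) * (δ i * δ j) =
        e ^ 2 * (algebraMap ℝ A (w i * w j / (y i - y j)) * ∏ k ∈ univ.erase i, z k) +
        e ^ 2 * (algebraMap ℝ A (w j * w i / (y j - y i)) * ∏ k ∈ univ.erase j, z k) :=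
      fun i j => by
        have hs : w j * w i / (y j - y i) = -(w i * w j / (y i - y j)) := by
          rw [← neg_sub (y i), div_neg, mul_comm]
        rw [hδδ, hs, map_neg]
        linear_combination e ^ 2 * hsecond i j
    simp only [this, Finset.sum_add_distrib]
    rw [Finset.sum_comm (f := fun i j => e ^ 2 * (algebraMap ℝ A (w j * w i / (y j - y i)) *
      ∏ k ∈ univ.erase j, z k)), ← two_mul]
    simp only [map_sum, Finset.sum_mul, Finset.mul_sum]
    refine Finset.sum_congr rfl fun i _ => Finset.sum_congr rfl fun j _ => by ring
  rw [h2] at h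
  have h3 : ∑ i, (∏ k ∈ univ.erase i, z k) * δ i =
      - (e * ∑ i, algebraMap ℝ A (w i) * ∏ k ∈ univ.erase i, z k) -
      e ^ 2 * ∑ i, algebraMap ℝ A (∑ j, w i * w j / (y i - y j)) * ∏ k ∈ univ.erase i, z k := by
    rw [Finset.mul_sum, Finset.mul_sum, ← Finset.sum_neg_distrib, ← Finset.sum_sub_distrib]
    refine Finset.sum_congr rfl fun i _ => ?_
    rw [hδdef]
    ring
  rw [h3] at h
  have h4 : 2 * ∏ i, (z i + δ i) =
      2 * (∏ i, z i - e * ∑ i, algebraMap ℝ A (w i) * ∏ k ∈ univ.erase i, z k) := by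
    rw [h]; ring
  have h5 : algebraMap ℝ A (1 / 2) * 2 = 1 := by
    rw [← map_ofNat (algebraMap ℝ A) 2, ← map_mul]; norm_num
  have h6 := congrArg (algebraMap ℝ A (1 / 2) * ·) h4
  simp only [← mul_assoc, h5, one_mul] at h6
  rw [← h6]
  exact Finset.prod_congr rfl fun i _ => by rw [hδdef]; ring

end Taylor

lemma det_diagonal_add_vecMulVec {K : Type*} [Field K] {z u w : Fin m → K} (hz : ∀ i, z i ≠ 0) :
    (diagonal z + vecMulVec u w).det = ∏ i, z i + ∑ i, u i * w i * ∏ k ∈ univ.erase i, z k := by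
  have h : diagonal z + vecMulVec u w = diagonal z * (1 + replicateCol Unit (fun i => u i / z i) *
      replicateRow Unit w) := by
    ext i j
    rw [Matrix.mul_add, Matrix.mul_one, Matrix.add_apply, Matrix.add_apply, diagonal_mul]
    simp only [vecMulVec_apply, mul_apply, replicateCol_apply, replicateRow_apply,
      Finset.univ_unique, Finset.sum_const, Finset.card_singleton, one_smul]
    rw [← mul_assoc, mul_div_cancel₀ _ (hz i)]
  rw [h, det_mul, det_diagonal, det_one_add_replicateCol_mul_replicateRow, mul_add, mul_one,
    dotProduct, Finset.mul_sum]
  congr 1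
  refine Finset.sum_congr rfl fun i _ => ?_
  rw [← Finset.mul_prod_erase univ z (mem_univ i)]
  field_simp [hz i]

/-- The identity needs no division once stated, so it descends from the fraction field. It is needed
over polynomials, where the `z i` are not units. -/
lemma det_diagonal_add_vecMulVec_of_isDomain {B : Type*} [CommRing B] [IsDomain B]
    {z u w : Fin m → B} (hz : ∀ i, z i ≠ 0) :
    (diagonal z + vecMulVec u w).det = ∏ i, z i + ∑ i, u i * w i * ∏ k ∈ univ.erase i, z k := by
  apply IsFractionRing.injective B (FractionRing B)
  rw [RingHom.map_det]
  have := det_diagonal_add_vecMulVec (K := FractionRing B) (z := fun i => algebraMap B _ (z i))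
    (u := fun i => algebraMap B _ (u i)) (w := fun i => algebraMap B _ (w i))
    (fun i => by simpa using hz i)
  refine Eq.trans ?_ (this.trans (by simp only [map_add, map_sum, map_mul, map_prod]))
  congr 1
  ext i j
  by_cases hij : i = j <;> simp [vecMulVec_apply, hij]

/-- A symmetric polynomial of the roots is a polynomial in the coefficients. -/
lemma exists_aeval_coeff_eq {F : MvPolynomial (Fin m) ℝ} (hF : F.IsSymmetric) :
    ∃ G : MvPolynomial (Fin m) ℝ, ∀ (B : Type) [CommRing B] [Algebra ℝ B] (l : Fin m → B),
      MvPolynomial.aeval (fun k : Fin m => (-1) ^ ((k : ℕ) + 1) *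
        (∏ i, (Polynomial.X - Polynomial.C (l i))).coeff (m - (k + 1))) G =
      MvPolynomial.aeval l F := by
  -- The fundamental theorem of symmetric polynomials. One `G` serves all algebras `B`, so that true
  -- eigenvalues over ℝ and formal roots over jets can be compared.
  obtain ⟨G, hG⟩ := MvPolynomial.esymmAlgHom_surjective (σ := Fin m) ℝ (n := m) (by simp)
    ⟨F, hF⟩
  refine ⟨G, fun B _ _ l => ?_⟩
  have h1 := congrArg Subtype.val hG
  rw [MvPolynomial.esymmAlgHom_apply] at h1
  simp only at h1
  rw [← h1, ← AlgHom.comp_apply, MvPolynomial.comp_aeval]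
  congr 2
  funext k
  have h2 := Multiset.prod_X_sub_C_coeff (univ.val.map l) (k := m - (k + 1)) (by simp)
  simp only [Multiset.map_map, Multiset.card_map, Finset.card_val, Finset.card_univ,
    Fintype.card_fin] at h2
  have hk : m - (m - ((k : ℕ) + 1)) = k + 1 := by have := k.isLt; omega
  rw [hk] at h2
  rw [MvPolynomial.aeval_esymm_eq_multiset_esymm]
  change _ * Polynomial.coeff (Multiset.map ((fun t => Polynomial.X - Polynomial.C t) ∘ l)
    univ.val).prod _ = _
  rw [h2, ← mul_assoc, ← mul_pow]
  simp

end KummerPearson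

end

/-! ### Eigenvalues of `diag(y) + ε v vᵀ` modulo `ε ^ 3`. -/

noncomputable section

namespace KummerPearson

open Matrix Finset

variable {m : ℕ}

section RankOne

open Polynomial

/-- Polynomials in one variable modulo the cube of the variable. -/
abbrev Jet : Type := ℝ[X] ⧸ Ideal.span {(X : ℝ[X]) ^ 3}

/-- Reduction of polynomials modulo the cube of the variable. -/
def toJet : ℝ[X] →ₐ[ℝ] Jet := Ideal.Quotient.mkₐ ℝ _

lemma coeff_two_eq_of_toJet_eq {p q : ℝ[X]} (h : toJet p = toJet q) : p.coeff 2 = q.coeff 2 := by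
  have h1 : (X : ℝ[X]) ^ 3 ∣ p - q := Ideal.mem_span_singleton.1 (Ideal.Quotient.eq.1 h)
  have h2 := X_pow_dvd_iff.1 h1 2 (by norm_num)
  rwa [coeff_sub, sub_eq_zero] at h2

lemma toJet_X_cube : toJet X * toJet X * toJet X = 0 := by
  rw [← map_mul, ← map_mul, ← pow_two, ← pow_succ]
  exact Ideal.Quotient.eq_zero_iff_mem.2 (Ideal.mem_span_singleton_self _)

/-- The matrix `diag(y) + ε v vᵀ` over polynomials in `ε`. -/
def rankOneMatrix (y v : Fin m → ℝ) : Matrix (Fin m) (Fin m) ℝ[X] :=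
  diagonal (fun i => C (y i)) + vecMulVec (fun i => X * C (v i)) fun i => C (v i)

/-- The eigenvalues of `diag(y) + ε v vᵀ` up to second order in `ε`, where `wᵢ = vᵢ²`. -/
def rankOneRoot (y w : Fin m → ℝ) (i : Fin m) : ℝ[X] :=
  C (y i) + (X * C (w i) + X ^ 2 * C (∑ j, w i * w j / (y i - y j)))

lemma charpoly_rankOneMatrix (y v : Fin m → ℝ) :
    (rankOneMatrix y v).charpoly = ∏ i, (X - C (C (y i))) -
      C X * ∑ i, C (C (v i ^ 2)) * ∏ k ∈ univ.erase i, (X - C (C (y k))) := by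
  have h : charmatrix (rankOneMatrix y v) = diagonal (fun i => (X - C (C (y i)) : ℝ[X][X])) +
      vecMulVec (fun i => -(C (X * C (v i)))) fun i => C (C (v i)) := by
    ext1 i j
    by_cases hij : i = j
    · subst hij
      simp [charmatrix_apply_eq, rankOneMatrix, vecMulVec_apply]
      ring
    · simp [rankOneMatrix, vecMulVec_apply, hij]
      ring
  rw [charpoly, h, det_diagonal_add_vecMulVec_of_isDomain fun i => X_sub_C_ne_zero _,
    sub_eq_add_neg, Finset.mul_sum, ← Finset.sum_neg_distrib]
  congr 1
  refine Finset.sum_congr rfl fun i _ => ?_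
  simp only [map_mul, map_pow]
  ring

/-- The eigenvalues need not be polynomial in ε, but modulo ε³ the characteristic polynomial splits
with the roots of perturbation theory. -/
lemma charpoly_rankOneMatrix_map_toJet {y : Fin m → ℝ} (hy : Function.Injective y)
    (v : Fin m → ℝ) : (rankOneMatrix y v).charpoly.map (toJet : ℝ[X] →+* Jet) =
      ∏ i, (X - C (toJet (rankOneRoot y (fun i => v i ^ 2) i))) := by
  have halg : ∀ a : ℝ, (toJet (C a)) = algebraMap ℝ Jet a := fun a => toJet.commutes a
  have h := prod_add_eq_of_triple_zero (A := Jet[X]) (e := C (toJet X))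
    (z := fun i => X - C (algebraMap ℝ Jet (y i)))
    (by rw [← map_mul, ← map_mul, toJet_X_cube, map_zero]) (w := fun i => v i ^ 2) hy
    (fun i j => by rw [Polynomial.algebraMap_apply]; simp)
  have e1 : (rankOneMatrix y v).charpoly.map (toJet : ℝ[X] →+* Jet) =
      ∏ i, (X - C (algebraMap ℝ Jet (y i))) - C (toJet X) *
        ∑ i, algebraMap ℝ Jet[X] (v i ^ 2) *
          ∏ k ∈ univ.erase i, (X - C (algebraMap ℝ Jet (y k))) := by
    rw [charpoly_rankOneMatrix]
    simp only [Polynomial.map_sub, Polynomial.map_mul, Polynomial.map_prod, Polynomial.map_sum,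
      Polynomial.map_X, Polynomial.map_C, RingHom.coe_coe, halg, Polynomial.algebraMap_apply]
  rw [e1, ← h]
  refine Finset.prod_congr rfl fun i _ => ?_
  simp only [rankOneRoot, map_add, map_mul, map_pow, halg, Polynomial.algebraMap_apply]
  ring

lemma coeff_two_linear_mul (a b c d : ℝ) :
    ((X * C a + X ^ 2 * C b) * (X * C c + X ^ 2 * C d) : ℝ[X]).coeff 2 = a * c := by
  have : ((X * C a + X ^ 2 * C b) * (X * C c + X ^ 2 * C d) : ℝ[X]) =
      C (a * c) * X ^ 2 + X ^ 3 * (C a * C d + C b * C c + X * (C b * C d)) := by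
    rw [C_mul]; ring
  rw [this, coeff_add, coeff_C_mul_X_pow, coeff_X_pow_mul']
  simp

/-- A symmetric polynomial of the eigenvalues of `diag(y) + ε v vᵀ` is a polynomial in `ε` with
an explicit second coefficient. -/
lemma exists_poly_eval_eigenvalues_rankOne {F : MvPolynomial (Fin m) ℝ} (hF : F.IsSymmetric)
    {y : Fin m → ℝ} (hy : Function.Injective y) (v : Fin m → ℝ) :
    ∃ q : ℝ[X], (∀ (ε : ℝ) (hS : (diagonal y + ε • vecMulVec v v).IsHermitian),
        q.eval ε = MvPolynomial.eval hS.eigenvalues F) ∧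
      2 * q.coeff 2 = 2 * ∑ i, MvPolynomial.eval y (MvPolynomial.pderiv i F) *
          ∑ j, v i ^ 2 * v j ^ 2 / (y i - y j) +
        ∑ i, ∑ j, MvPolynomial.eval y (MvPolynomial.pderiv i (MvPolynomial.pderiv j F)) *
          (v i ^ 2 * v j ^ 2) := by
  obtain ⟨G, hG⟩ := exists_aeval_coeff_eq hF
  -- Evaluating the characteristic coefficients keeps `q` polynomial in ε. Specializing ε gives the
  -- value at the eigenvalues, reducing modulo ε³ gives the second coefficient.
  set q : ℝ[X] := MvPolynomial.aeval (fun k : Fin m => (-1) ^ ((k : ℕ) + 1) *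
        (rankOneMatrix y v).charpoly.coeff (m - (k + 1))) G with hq
  have hmap : ∀ {B : Type} [CommRing B] [Algebra ℝ B] (φ : ℝ[X] →ₐ[ℝ] B),
      φ q = MvPolynomial.aeval (fun k : Fin m => (-1) ^ ((k : ℕ) + 1) *
        ((rankOneMatrix y v).charpoly.map (φ : ℝ[X] →+* B)).coeff (m - (k + 1))) G := by
    intro B _ _ φ
    rw [hq, ← AlgHom.comp_apply, MvPolynomial.comp_aeval]
    simp [coeff_map]
  refine ⟨q, fun ε hS => ?_, ?_⟩
  · have h1 := hmap (Polynomial.aeval ε : ℝ[X] →ₐ[ℝ] ℝ)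
    rw [← charpoly_map] at h1
    have h2 : (rankOneMatrix y v).map ((Polynomial.aeval ε : ℝ[X] →ₐ[ℝ] ℝ) : ℝ[X] →+* ℝ) =
        diagonal y + ε • vecMulVec v v := by
      ext i j
      by_cases hij : i = j
      · subst hij; simp [rankOneMatrix, vecMulVec_apply]; ring
      · simp [rankOneMatrix, vecMulVec_apply, hij]; ring
    rw [h2, hS.charpoly_eq] at h1
    have h3 := hG ℝ hS.eigenvalues
    rw [← Polynomial.coe_aeval_eq_eval, h1]
    exact h3
  · have h1 := hmap toJet
    rw [charpoly_rankOneMatrix_map_toJet hy, hG] at h1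
    set L : Fin m → ℝ[X] := fun i => X * C (v i ^ 2) +
      X ^ 2 * C (∑ j, v i ^ 2 * v j ^ 2 / (y i - y j)) with hL
    have halg : ∀ a : ℝ, (toJet (C a)) = algebraMap ℝ Jet a := fun a => toJet.commutes a
    have hsplit : (fun i => toJet (rankOneRoot y (fun i => v i ^ 2) i)) =
        (fun i => algebraMap ℝ Jet (y i)) + fun i => toJet (L i) := by
      funext i
      rw [rankOneRoot, map_add, halg]
      rfl
    have hLL : ∀ i j k, toJet (L i) * toJet (L j) * toJet (L k) = 0 := fun i j k => by
      have : ∀ i, toJet (L i) = toJet X * (toJet (C (v i ^ 2) +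
          X * C (∑ j, v i ^ 2 * v j ^ 2 / (y i - y j)))) := fun i => by
        rw [← map_mul, hL]; congr 1; ring
      rw [this, this, this]
      generalize toJet (C (v i ^ 2) + _) = a
      generalize toJet (C (v j ^ 2) + _) = b
      generalize toJet (C (v k ^ 2) + _) = c
      linear_combination a * b * c * toJet_X_cube
    have h2 := two_mul_aeval_add (z := fun i => algebraMap ℝ Jet (y i)) hLL F
    rw [← hsplit, ← h1] at h2
    have hev : ∀ P : MvPolynomial (Fin m) ℝ,
        MvPolynomial.aeval (fun i => algebraMap ℝ Jet (y i)) P =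
          toJet (C (MvPolynomial.eval y P)) := fun P => by
      rw [halg, MvPolynomial.aeval_def, MvPolynomial.eval, MvPolynomial.coe_eval₂Hom,
        MvPolynomial.eval₂_comp_left, RingHom.comp_id]
      rfl
    simp only [hev] at h2
    have h3 : toJet (2 * q) = toJet (2 * C (MvPolynomial.eval y F) +
        2 * ∑ i, C (MvPolynomial.eval y (MvPolynomial.pderiv i F)) * L i +
        ∑ i, ∑ j, C (MvPolynomial.eval y (MvPolynomial.pderiv i (MvPolynomial.pderiv j F))) *
          (L i * L j)) := by
      simp only [map_add, map_mul, map_sum, map_ofNat]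
      exact h2
    have h4 := coeff_two_eq_of_toJet_eq h3
    have hc1 : ∀ i, (L i).coeff 2 = ∑ j, v i ^ 2 * v j ^ 2 / (y i - y j) := fun i => by
      rw [hL]
      simp only [coeff_add, coeff_X_mul, coeff_X_pow_mul', coeff_C]
      simp
    have hc2 : ∀ i j, (L i * L j).coeff 2 = v i ^ 2 * v j ^ 2 := fun i j =>
      coeff_two_linear_mul _ _ _ _
    have h2C : (2 : ℝ[X]) = C 2 := rfl
    rw [h2C] at h4
    simp only [coeff_add, coeff_C_mul, finsetSum_coeff, hc1, hc2] at h4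
    rw [h4]
    simp

end RankOne

end KummerPearson

end

/-! ### Second coefficients of power functions and averaging over quartic forms. -/

noncomputable section

namespace KummerPearson

open Matrix Finset MeasureTheory

variable {m : ℕ}

/-- Coefficients of polynomials of bounded degree are combinations of values. -/
lemma exists_coeff_eq_sum_eval (N k : ℕ) : ∃ (s : Finset ℕ) (β : ℕ → ℝ),
    ∀ p : Polynomial ℝ, p.natDegree ≤ N → p.coeff k = ∑ x ∈ s, p.eval (x : ℝ) * β x := by
  refine ⟨range (N + 1), fun x => (Lagrange.basis (range (N + 1)) (fun n : ℕ => (n : ℝ)) x).coeff k,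
    fun p hp => ?_⟩
  have h := Lagrange.eq_interpolate (s := range (N + 1)) (v := fun n : ℕ => (n : ℝ)) (f := p)
    (fun a _ b _ hab => by simpa using hab) (by
      rw [Finset.card_range]
      exact lt_of_le_of_lt Polynomial.degree_le_natDegree (by exact_mod_cast Nat.lt_succ_of_le hp))
  conv_lhs => rw [h]
  simp [Lagrange.interpolate_apply, Polynomial.finsetSum_coeff]

/-- The power function of `1 + ε u uᵀ` as a polynomial in `ε`. -/
def growthPoly (κ : Fin m → ℕ) (u : Fin m → ℝ) : Polynomial ℝ :=
  ∏ i, (1 + Polynomial.C (∑ j ∈ Iic i, u j ^ 2) * Polynomial.X) ^ partStep κ i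

lemma natDegree_growthPoly_le (κ : Fin m → ℕ) (u : Fin m → ℝ) :
    (growthPoly κ u).natDegree ≤ ∑ i, partStep κ i := by
  refine (Polynomial.natDegree_prod_le _ _).trans (Finset.sum_le_sum fun i _ => ?_)
  refine Polynomial.natDegree_pow_le.trans ?_
  have : (1 + Polynomial.C (∑ j ∈ Iic i, u j ^ 2) * Polynomial.X).natDegree ≤ 1 := by
    compute_degree
  nlinarith

section SecondCoefficient

variable (p q : Polynomial ℝ)

/-- `p = exp(a ε - b ε² / 2 + ⋯)` to second order. -/
def HasLogJet (p : Polynomial ℝ) (a b : ℝ) : Prop :=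
  p.coeff 0 = 1 ∧ p.coeff 1 = a ∧ 2 * p.coeff 2 = a ^ 2 - b

variable {p q}

/-- The parameters are coefficients of the logarithm, so they add. -/
lemma HasLogJet.mul {a b a' b' : ℝ} (hp : HasLogJet p a b) (hq : HasLogJet q a' b') :
    HasLogJet (p * q) (a + a') (b + b') := by
  obtain ⟨h0, h1, h2⟩ := hp
  obtain ⟨k0, k1, k2⟩ := hq
  refine ⟨by rw [Polynomial.mul_coeff_zero, h0, k0, one_mul], ?_, ?_⟩
  · rw [Polynomial.mul_coeff_one, h0, h1, k0, k1]; ring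
  · rw [Polynomial.coeff_mul, Finset.Nat.sum_antidiagonal_eq_sum_range_succ_mk]
    simp only [Finset.sum_range_succ, Finset.sum_range_zero]
    rw [h0, h1, k0]
    simp only [Nat.sub_zero, Nat.reduceSub, k1]
    linear_combination h2 + k2

lemma hasLogJet_one : HasLogJet 1 0 0 := by
  simp [HasLogJet, Polynomial.coeff_one]

lemma HasLogJet.pow {a b : ℝ} (hp : HasLogJet p a b) (n : ℕ) :
    HasLogJet (p ^ n) (n * a) (n * b) := by
  induction n with
  | zero => simpa using hasLogJet_one
  | succ n ih =>
    rw [pow_succ]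
    convert ih.mul hp using 1 <;> push_cast <;> ring

lemma HasLogJet.prod {ι : Type*} (s : Finset ι) {p : ι → Polynomial ℝ} {a b : ι → ℝ}
    (hp : ∀ i, HasLogJet (p i) (a i) (b i)) :
    HasLogJet (∏ i ∈ s, p i) (∑ i ∈ s, a i) (∑ i ∈ s, b i) := by
  classical
  induction s using Finset.induction_on with
  | empty => simpa using hasLogJet_one
  | insert i s hi ih =>
    rw [Finset.prod_insert hi, Finset.sum_insert hi, Finset.sum_insert hi]
    exact (hp i).mul ih

end SecondCoefficient

lemma two_mul_coeff_two_growthPoly {κ : Fin m → ℕ} (hκ : Antitone κ) (u : Fin m → ℝ) :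
    2 * (growthPoly κ u).coeff 2 = ∑ a, ∑ b, (κ a * κ b : ℝ) * (u a ^ 2 * u b ^ 2) -
      ∑ i, (partStep κ i : ℝ) * ∑ a ∈ Iic i, ∑ b ∈ Iic i, u a ^ 2 * u b ^ 2 := by
  have h1 : ∀ c : ℝ, HasLogJet (1 + Polynomial.C c * Polynomial.X) c (c ^ 2) := fun c => by
    refine ⟨?_, ?_, ?_⟩ <;> simp [Polynomial.coeff_one, Polynomial.coeff_X]
  have h2 := (HasLogJet.prod univ fun i => (h1 (∑ j ∈ Iic i, u j ^ 2)).pow (partStep κ i)).2.2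
  rw [growthPoly, h2, sum_partStep_mul hκ, sq, Finset.sum_mul_sum]
  congr 1
  · refine Finset.sum_congr rfl fun a _ => Finset.sum_congr rfl fun b _ => by ring
  · refine Finset.sum_congr rfl fun i _ => ?_
    rw [sq, Finset.sum_mul_sum]

/-- Factor H √diag(y) = T K with T lower triangular. With v = √y h the perturbed matrix becomes T (1
+ ε u uᵀ) Tᵀ, u = K h, and the character splits off T. It matters that `K` depends neither on `h`
nor on ε. -/
lemma powerFn_rankOne (κ : Fin m → ℕ) {y : Fin m → ℝ} (hy : ∀ i, 0 < y i)
    (H : Matrix (Fin m) (Fin m) ℝ) : ∃ K : orthogonalGroup (Fin m) ℝ, ∀ (h : Fin m → ℝ) (ε : ℝ),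
      powerFn κ (H * (diagonal y + ε • vecMulVec (fun i => √(y i) * h i) fun i => √(y i) * h i) *
        Hᵀ) = powerFn κ (H * diagonal y * Hᵀ) *
          (growthPoly κ ((K : Matrix (Fin m) (Fin m) ℝ) *ᵥ h)).eval ε := by
  set D : Matrix (Fin m) (Fin m) ℝ := diagonal fun i => √(y i) with hD
  obtain ⟨T, hT, K, hg⟩ := exists_lowerTriangular_mul_topRows le_rfl (H * D)
  rw [topRows_refl] at hg
  have hDD : diagonal y = D * Dᵀ := by
    rw [hD, diagonal_transpose, diagonal_mul_diagonal]
    congr 1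
    funext i
    exact (Real.mul_self_sqrt (hy i).le).symm
  have hTT : H * diagonal y * Hᵀ = T * Tᵀ := by
    rw [hDD, ← Matrix.mul_assoc, Matrix.mul_assoc, ← transpose_mul, hg, transpose_mul,
      Matrix.mul_assoc, ← Matrix.mul_assoc (K : Matrix (Fin m) (Fin m) ℝ), coe_mul_transpose,
      Matrix.one_mul]
  refine ⟨K, fun h ε => ?_⟩
  set u := (K : Matrix (Fin m) (Fin m) ℝ) *ᵥ h with hu
  have h1 : diagonal y + ε • vecMulVec (fun i => √(y i) * h i) (fun i => √(y i) * h i) =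
      D * (1 + ε • vecMulVec h h) * Dᵀ := by
    rw [Matrix.mul_add, Matrix.add_mul, Matrix.mul_one, ← hDD, Matrix.mul_smul, Matrix.smul_mul,
      mul_vecMulVec, vecMulVec_mul, hD, diagonal_transpose]
    congr 3
    · funext i; rw [mulVec_diagonal]
    · funext i; rw [vecMul_diagonal, mul_comm]
  have h2 : H * (D * (1 + ε • vecMulVec h h) * Dᵀ) * Hᵀ =
      T * (1 + vecMulVec (ε • u) u) * Tᵀ := by
    have : H * (D * (1 + ε • vecMulVec h h) * Dᵀ) * Hᵀ =
        (H * D) * (1 + ε • vecMulVec h h) * (H * D)ᵀ := by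
      simp only [transpose_mul, Matrix.mul_assoc]
    rw [this, hg]
    have h3 : (K : Matrix (Fin m) (Fin m) ℝ) * (1 + ε • vecMulVec h h) *
        (K : Matrix (Fin m) (Fin m) ℝ)ᵀ = 1 + vecMulVec (ε • u) u := by
      rw [Matrix.mul_add, Matrix.add_mul, Matrix.mul_one, coe_mul_transpose, Matrix.mul_smul,
        Matrix.smul_mul, mul_vecMulVec, vecMulVec_mul, vecMul_transpose, ← smul_vecMulVec]
    rw [← h3]
    simp only [transpose_mul, Matrix.mul_assoc]
  rw [h1, h2, powerFn_lowerTriangular_conj hT, hTT]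
  congr 1
  rw [powerFn, growthPoly, Polynomial.eval_prod]
  refine Finset.prod_congr rfl fun i _ => ?_
  rw [leadMinor_one_add_vecMulVec, Polynomial.eval_pow]
  congr 1
  simp only [Polynomial.eval_add, Polynomial.eval_one, Polynomial.eval_mul, Polynomial.eval_C,
    Polynomial.eval_X, Finset.sum_mul]
  congr 1
  refine Finset.sum_congr rfl fun j _ => ?_
  rw [Pi.smul_apply, smul_eq_mul]
  ring

/-- A finite functional that integrates quartic forms like the standard normal distribution. -/
def quarticMean (Q : (Fin m → ℝ) → ℝ) : ℝ :=
  (∑ i, ∑ j, (Q (Pi.single i 1 + Pi.single j 1) + Q (Pi.single i 1 - Pi.single j 1))) / 4 -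
    m * ∑ i, Q (Pi.single i 1)

/-- Wick's formula for Gaussian fourth moments. The polarized sum overcounts the diagonal terms u_i²
w_i² by a factor that the subtraction in `quarticMean` removes. -/
lemma quarticMean_sq_mul_sq (u w : Fin m → ℝ) :
    quarticMean (fun h => (u ⬝ᵥ h) ^ 2 * (w ⬝ᵥ h) ^ 2) =
      (u ⬝ᵥ u) * (w ⬝ᵥ w) + 2 * (u ⬝ᵥ w) ^ 2 := by
  -- An opaque name for the diagonal terms, which then cancel linearly.
  obtain ⟨P, hP⟩ : ∃ P : Fin m → ℝ, ∀ i, u i ^ 2 * w i ^ 2 = P i := ⟨_, fun _ => rfl⟩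
  simp only [quarticMean, dotProduct_add, dotProduct_sub, dotProduct_single_one, hP]
  have h1 : ∀ i j, (u i + u j) ^ 2 * (w i + w j) ^ 2 + (u i - u j) ^ 2 * (w i - w j) ^ 2 =
      2 * P i + 2 * P j + 2 * ((u i * u i) * (w j * w j)) +
      2 * ((w i * w i) * (u j * u j)) + 8 * ((u i * w i) * (u j * w j)) := fun i j => by
    rw [← hP, ← hP]; ring
  simp only [h1, Finset.sum_add_distrib, ← Finset.mul_sum, ← Finset.sum_mul, Finset.sum_const,
    Finset.card_univ, Fintype.card_fin, nsmul_eq_mul]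
  simp only [dotProduct]
  ring

lemma quarticMean_add (Q Q' : (Fin m → ℝ) → ℝ) :
    quarticMean (fun h => Q h + Q' h) = quarticMean Q + quarticMean Q' := by
  simp only [quarticMean, Finset.sum_add_distrib]; ring

lemma quarticMean_const_mul (c : ℝ) (Q : (Fin m → ℝ) → ℝ) :
    quarticMean (fun h => c * Q h) = c * quarticMean Q := by
  simp only [quarticMean, ← Finset.mul_sum, ← mul_add]; ring

lemma quarticMean_sum {ι : Type*} (s : Finset ι) (Q : ι → (Fin m → ℝ) → ℝ) :
    quarticMean (fun h => ∑ i ∈ s, Q i h) = ∑ i ∈ s, quarticMean (Q i) := by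
  classical
  induction s using Finset.induction_on with
  | empty => simp [quarticMean]
  | insert i s hi ih => simp only [Finset.sum_insert hi, quarticMean_add, ih]

lemma quarticMean_integral {α : Type*} [MeasurableSpace α] {μ : Measure α}
    {Q : (Fin m → ℝ) → α → ℝ} (hQ : ∀ h, Integrable (Q h) μ) :
    quarticMean (fun h => ∫ x, Q h x ∂μ) = ∫ x, quarticMean (fun h => Q h x) ∂μ := by
  simp only [quarticMean]
  have h1 : Integrable (fun x => ∑ i : Fin m, Q (Pi.single i 1) x) μ :=
    integrable_finsetSum _ fun i _ => hQ _
  have h2 : ∀ i : Fin m, Integrable (fun x => ∑ j : Fin m, (Q (Pi.single i 1 + Pi.single j 1) x +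
      Q (Pi.single i 1 - Pi.single j 1) x)) μ := fun i =>
    integrable_finsetSum _ fun j _ => (hQ _).add (hQ _)
  rw [integral_sub ((integrable_finsetSum _ fun i _ => h2 i).div_const _) (h1.const_mul _),
    integral_const_mul, integral_finsetSum _ (fun i _ => hQ _), integral_div,
    integral_finsetSum _ (fun i _ => h2 i)]
  have h3 : ∀ i : Fin m, ∫ x, ∑ j : Fin m, (Q (Pi.single i 1 + Pi.single j 1) x +
      Q (Pi.single i 1 - Pi.single j 1) x) ∂μ = ∑ j : Fin m,
        (∫ x, Q (Pi.single i 1 + Pi.single j 1) x ∂μ +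
          ∫ x, Q (Pi.single i 1 - Pi.single j 1) x ∂μ) := fun i => by
    refine (integral_finsetSum _ fun j _ => (hQ _).add (hQ _)).trans ?_
    exact Finset.sum_congr rfl fun j _ => integral_add (hQ _) (hQ _)
  simp only [h3]

/-- The rows of `K` are orthonormal, so the rotation chosen in `powerFn_rankOne` disappears from the
mean. -/
lemma quarticMean_orthogonal (K : orthogonalGroup (Fin m) ℝ) (a b : Fin m) :
    quarticMean (fun h => ((K : Matrix (Fin m) (Fin m) ℝ) *ᵥ h) a ^ 2 *
      ((K : Matrix (Fin m) (Fin m) ℝ) *ᵥ h) b ^ 2) = 1 + if a = b then 2 else 0 := by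
  have h := quarticMean_sq_mul_sq ((K : Matrix (Fin m) (Fin m) ℝ) a)
    ((K : Matrix (Fin m) (Fin m) ℝ) b)
  have hd : ∀ a b, (K : Matrix (Fin m) (Fin m) ℝ) a ⬝ᵥ (K : Matrix (Fin m) (Fin m) ℝ) b =
      if a = b then 1 else 0 := fun a b => by
    have := congrFun (congrFun (coe_mul_transpose K) a) b
    rw [Matrix.one_apply] at this
    exact this
  rw [hd, hd, hd] at h
  refine h.trans ?_
  by_cases hab : a = b <;> simp [hab]

lemma quarticMean_sq (a b : Fin m) :
    quarticMean (fun h => h a ^ 2 * h b ^ 2) = 1 + if a = b then 2 else 0 := by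
  simpa using quarticMean_orthogonal (1 : orthogonalGroup (Fin m) ℝ) a b

lemma quarticMean_growthPoly {κ : Fin m → ℕ} (hκ : Antitone κ) (K : orthogonalGroup (Fin m) ℝ) :
    2 * quarticMean (fun h => (growthPoly κ ((K : Matrix (Fin m) (Fin m) ℝ) *ᵥ h)).coeff 2) =
      (∑ i, (κ i : ℝ)) ^ 2 + 2 * ∑ i, (κ i : ℝ) ^ 2 - ∑ i, (κ i : ℝ) * (2 * (i : ℕ) + 3) := by
  rw [← quarticMean_const_mul]
  simp only [two_mul_coeff_two_growthPoly hκ, sub_eq_add_neg]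
  rw [quarticMean_add]
  have h1 : quarticMean (fun h : Fin m → ℝ => ∑ a, ∑ b, (κ a * κ b : ℝ) *
      (((K : Matrix (Fin m) (Fin m) ℝ) *ᵥ h) a ^ 2 * ((K : Matrix (Fin m) (Fin m) ℝ) *ᵥ h) b ^ 2)) =
      (∑ i, (κ i : ℝ)) ^ 2 + 2 * ∑ i, (κ i : ℝ) ^ 2 := by
    simp only [quarticMean_sum, quarticMean_const_mul, quarticMean_orthogonal, mul_add, mul_one,
      mul_ite, mul_zero, Finset.sum_add_distrib, Finset.sum_ite_eq, Finset.mem_univ, if_true]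
    rw [sq, Finset.sum_mul_sum, Finset.mul_sum]
    congr 1
    exact Finset.sum_congr rfl fun i _ => by ring
  have h2 : quarticMean (fun h : Fin m → ℝ => -∑ i, (partStep κ i : ℝ) * ∑ a ∈ Iic i, ∑ b ∈ Iic i,
      ((K : Matrix (Fin m) (Fin m) ℝ) *ᵥ h) a ^ 2 * ((K : Matrix (Fin m) (Fin m) ℝ) *ᵥ h) b ^ 2) =
      -∑ i, (κ i : ℝ) * (2 * (i : ℕ) + 3) := by
    simp only [neg_eq_neg_one_mul (∑ i, _), quarticMean_const_mul, quarticMean_sum,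
      quarticMean_orthogonal]
    congr 1
    rw [← sum_partStep_mul hκ]
    refine Finset.sum_congr rfl fun i _ => ?_
    congr 1
    have e1 : ∑ a ∈ Iic i, ∑ b ∈ Iic i, ((1 : ℝ) + if a = b then 2 else 0) =
        ((i : ℕ) + 1) ^ 2 + 2 * ((i : ℕ) + 1) := by
      simp only [Finset.sum_add_distrib, Finset.sum_const, Fin.card_Iic, nsmul_eq_mul, mul_one,
        Finset.sum_ite_eq]
      rw [Finset.sum_ite_mem, Finset.inter_self, Finset.sum_const, Fin.card_Iic, nsmul_eq_mul]
      push_cast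
      ring
    -- Since (i+1)² + 2(i+1) is the sum of 2j+3 over j ≤ i, summation by parts applies to the steps
    -- of `κ`.
    rw [e1, ← sum_castLE_eq_sum_Iic i (fun j => 2 * ((j : ℕ) : ℝ) + 3)]
    simp only [Fin.val_castLE]
    rw [Fin.sum_univ_eq_sum_range (fun n : ℕ => 2 * (n : ℝ) + 3)]
    generalize (i : ℕ) = n
    induction n with
    | zero => norm_num
    | succ n ih => rw [Finset.sum_range_succ, ← ih]; push_cast; ring
  rw [h1, h2]

end KummerPearson

end

/-! ### The differential equation of the spherical polynomials. -/

noncomputable section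

namespace KummerPearson

open Matrix Finset MeasureTheory

variable {m : ℕ}

lemma coeff_two_eq_integral {κ : Fin m → ℕ} (hκ : Antitone κ) {y : Fin m → ℝ}
    {K : orthogonalGroup (Fin m) ℝ → orthogonalGroup (Fin m) ℝ}
    (hK : ∀ (H : orthogonalGroup (Fin m) ℝ) (h : Fin m → ℝ) (ε : ℝ),
      powerFn κ ((H : Matrix (Fin m) (Fin m) ℝ) *
        (diagonal y + ε • vecMulVec (fun i => √(y i) * h i) fun i => √(y i) * h i) *
        (H : Matrix (Fin m) (Fin m) ℝ)ᵀ) =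
      powerFn κ ((H : Matrix (Fin m) (Fin m) ℝ) * diagonal y * (H : Matrix (Fin m) (Fin m) ℝ)ᵀ) *
          (growthPoly κ ((K H : Matrix (Fin m) (Fin m) ℝ) *ᵥ h)).eval ε)
    (h : Fin m → ℝ) {q : Polynomial ℝ}
    (hq : ∀ (ε : ℝ) (hS : (diagonal y + ε • vecMulVec (fun i => √(y i) * h i)
      fun i => √(y i) * h i).IsHermitian),
        q.eval ε = MvPolynomial.eval hS.eigenvalues (sphericalPoly κ)) :
    Integrable (fun H : orthogonalGroup (Fin m) ℝ =>
      powerFn κ ((H : Matrix (Fin m) (Fin m) ℝ) * diagonal y * (H : Matrix (Fin m) (Fin m) ℝ)ᵀ) *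
        (growthPoly κ ((K H : Matrix (Fin m) (Fin m) ℝ) *ᵥ h)).coeff 2) (haarO m) ∧
    q.coeff 2 = ∫ H : orthogonalGroup (Fin m) ℝ,
      powerFn κ ((H : Matrix (Fin m) (Fin m) ℝ) * diagonal y * (H : Matrix (Fin m) (Fin m) ℝ)ᵀ) *
        (growthPoly κ ((K H : Matrix (Fin m) (Fin m) ℝ) *ᵥ h)).coeff 2 ∂haarO m := by
  -- `K` is chosen pointwise and may fail to be measurable. Interpolation expresses the coefficient
  -- through values at fixed ε, where the integrand is continuous in `H`.
  obtain ⟨s, β, hβ⟩ := exists_coeff_eq_sum_eval (max q.natDegree (∑ i, partStep κ i)) 2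
  set S : ℝ → Matrix (Fin m) (Fin m) ℝ := fun ε => diagonal y +
    ε • vecMulVec (fun i => √(y i) * h i) fun i => √(y i) * h i with hSdef
  have hS : ∀ ε, (S ε).IsHermitian := fun ε => by
    ext i j
    by_cases hij : i = j
    · subst hij; simp [hSdef, vecMulVec_apply]
    · simp [hSdef, vecMulVec_apply, hij, Ne.symm hij, mul_comm]
  have h1 : (fun H : orthogonalGroup (Fin m) ℝ =>
      powerFn κ ((H : Matrix (Fin m) (Fin m) ℝ) * diagonal y * (H : Matrix (Fin m) (Fin m) ℝ)ᵀ) *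
        (growthPoly κ ((K H : Matrix (Fin m) (Fin m) ℝ) *ᵥ h)).coeff 2) =
      fun H : orthogonalGroup (Fin m) ℝ => ∑ x ∈ s, powerFn κ ((H : Matrix (Fin m) (Fin m) ℝ) *
        S x * (H : Matrix (Fin m) (Fin m) ℝ)ᵀ) * β x := by
    funext H
    rw [hβ _ ((natDegree_growthPoly_le _ _).trans (le_max_right _ _)), Finset.mul_sum]
    refine Finset.sum_congr rfl fun x _ => ?_
    rw [hK H h x]
    ring
  have hInt : ∀ x : ℕ, Integrable (fun H : orthogonalGroup (Fin m) ℝ =>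
      powerFn κ ((H : Matrix (Fin m) (Fin m) ℝ) * S x * (H : Matrix (Fin m) (Fin m) ℝ)ᵀ) * β x)
      (haarO m) := fun x => (integrable_haarO (continuous_powerFn κ
        ((continuous_subtype_val.matrix_mul continuous_const).matrix_mul
          continuous_subtype_val.matrix_transpose))).mul_const _
  rw [h1]
  refine ⟨integrable_finsetSum _ fun x _ => hInt x, ?_⟩
  rw [integral_finsetSum _ fun x _ => hInt x, hβ q (le_max_left _ _)]
  refine Finset.sum_congr rfl fun x _ => ?_
  rw [integral_mul_const, integral_powerFn_conj_hermitian hκ (hS x), hq x (hS x)]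

lemma sum_mul_eval_pderiv {F : MvPolynomial (Fin m) ℝ} {k : ℕ} (hF : F.IsHomogeneous k)
    (y : Fin m → ℝ) : ∑ i, y i * MvPolynomial.eval y (MvPolynomial.pderiv i F) =
      k * MvPolynomial.eval y F := by
  have h := congrArg (MvPolynomial.eval y) hF.sum_X_mul_pderiv
  simpa using h

lemma sum_mul_eval_pderiv_pderiv {F : MvPolynomial (Fin m) ℝ} {k : ℕ} (hF : F.IsHomogeneous k)
    (y : Fin m → ℝ) : ∑ i, ∑ j, y i * y j *
        MvPolynomial.eval y (MvPolynomial.pderiv i (MvPolynomial.pderiv j F)) =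
      ((k : ℝ) ^ 2 - k) * MvPolynomial.eval y F := by
  classical
  have h : ∀ i, ∑ j, y j * MvPolynomial.eval y (MvPolynomial.pderiv i (MvPolynomial.pderiv j F)) =
      (k - 1) * MvPolynomial.eval y (MvPolynomial.pderiv i F) := fun i => by
    have h1 := congrArg (fun P => MvPolynomial.eval y (MvPolynomial.pderiv i P))
      hF.sum_X_mul_pderiv
    simp only [map_sum, MvPolynomial.pderiv_mul, map_add, map_mul, MvPolynomial.eval_X,
      Finset.sum_add_distrib, nsmul_eq_mul, Derivation.map_natCast, zero_mul,
      zero_add, map_natCast] at h1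
    have h2 : ∑ j, MvPolynomial.eval y (MvPolynomial.pderiv i (MvPolynomial.X j)) *
        MvPolynomial.eval y (MvPolynomial.pderiv j F) =
        MvPolynomial.eval y (MvPolynomial.pderiv i F) := by
      rw [Finset.sum_eq_single i]
      · simp
      · intro j _ hj
        rw [MvPolynomial.pderiv_X_of_ne hj, map_zero, zero_mul]
      · simp
    rw [h2] at h1
    linear_combination h1
  have h3 := sum_mul_eval_pderiv hF y
  simp only [mul_assoc, ← Finset.mul_sum, h]
  rw [show ∑ i, y i * (((k : ℝ) - 1) * MvPolynomial.eval y (MvPolynomial.pderiv i F)) =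
    ((k : ℝ) - 1) * ∑ i, y i * MvPolynomial.eval y (MvPolynomial.pderiv i F) by
      rw [Finset.mul_sum]; exact Finset.sum_congr rfl fun i _ => by ring, h3]
  ring

/-- The averaged second coefficient along diag(y) + ε v vᵀ, v = √y h, is computed twice:
perturbation theory gives the operator in `y`, and the orbit integral gives a constant times the
polynomial, because the averaged growth of the power function is the same at every `H`. -/
lemma laplaceBeltrami_sphericalPoly_of_pos {κ : Fin m → ℕ} (hκ : Antitone κ) {y : Fin m → ℝ}
    (hy : Function.Injective y) (hpos : ∀ i, 0 < y i) :
    laplaceBeltrami (sphericalPoly κ) y =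
      zonalEigenvalue κ * MvPolynomial.eval y (sphericalPoly κ) := by
  classical
  set F := sphericalPoly κ with hF
  choose K hK using fun H : orthogonalGroup (Fin m) ℝ =>
    powerFn_rankOne κ hpos (H : Matrix (Fin m) (Fin m) ℝ)
  choose q hq hq2 using fun h : Fin m → ℝ => exists_poly_eval_eigenvalues_rankOne
    (sphericalPoly_isSymmetric hκ) hy (fun i => √(y i) * h i)
  have hcoef := fun h => coeff_two_eq_integral hκ hK h (hq h)
  set N : Fin m → Fin m → ℝ := fun a b =>
    (2 * MvPolynomial.eval y (MvPolynomial.pderiv a F) / (y a - y b) +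
      MvPolynomial.eval y (MvPolynomial.pderiv a (MvPolynomial.pderiv b F))) * (y a * y b) with hN
  have hleft : (fun h => 2 * (q h).coeff 2) =
      fun h => ∑ a, ∑ b, N a b * (h a ^ 2 * h b ^ 2) := by
    funext h
    rw [hq2 h, Finset.mul_sum, ← Finset.sum_add_distrib]
    refine Finset.sum_congr rfl fun a _ => ?_
    rw [Finset.mul_sum, Finset.mul_sum, ← Finset.sum_add_distrib]
    refine Finset.sum_congr rfl fun b _ => ?_
    simp only [mul_pow, Real.sq_sqrt (hpos _).le, hN]
    ring
  have h1 : quarticMean (fun h => 2 * (q h).coeff 2) = ∑ a, ∑ b, N a b + 2 * ∑ a, N a a := by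
    rw [hleft]
    simp only [quarticMean_sum, quarticMean_const_mul, quarticMean_sq, mul_add, mul_one, mul_ite,
      mul_zero, Finset.sum_add_distrib, Finset.sum_ite_eq, Finset.mem_univ, if_true]
    rw [Finset.mul_sum]
    congr 1
    exact Finset.sum_congr rfl fun i _ => by ring
  have h2 : quarticMean (fun h => 2 * (q h).coeff 2) = ((∑ i, (κ i : ℝ)) ^ 2 +
      2 * ∑ i, (κ i : ℝ) ^ 2 - ∑ i, (κ i : ℝ) * (2 * (i : ℕ) + 3)) * MvPolynomial.eval y F := by
    rw [quarticMean_const_mul]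
    simp only [(hcoef _).2]
    rw [quarticMean_integral fun h => (hcoef h).1, ← integral_const_mul]
    simp only [quarticMean_const_mul, mul_left_comm (2 : ℝ), quarticMean_growthPoly hκ]
    rw [integral_mul_const, hF, eval_sphericalPoly hκ, mul_comm]
  rw [h1] at h2
  have hhom := sphericalPoly_isHomogeneous κ
  rw [← hF] at hhom
  have e1 := sum_mul_eval_pderiv hhom y
  have e2 := sum_mul_eval_pderiv_pderiv hhom y
  push_cast at e1 e2
  have hNaa : ∀ a, N a a =
      y a ^ 2 * MvPolynomial.eval y (MvPolynomial.pderiv a (MvPolynomial.pderiv a F)) := fun a => by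
    simp only [hN, sub_self, div_zero, zero_add]; ring
  have hsum : ∑ a, ∑ b, N a b = 2 * (∑ a, ∑ b ∈ univ.erase a, y a ^ 2 / (y a - y b) *
      MvPolynomial.eval y (MvPolynomial.pderiv a F)) -
      2 * ((m : ℝ) - 1) * ∑ a, y a * MvPolynomial.eval y (MvPolynomial.pderiv a F) +
      ∑ a, ∑ b, y a * y b *
        MvPolynomial.eval y (MvPolynomial.pderiv a (MvPolynomial.pderiv b F)) := by
    rw [Finset.mul_sum, Finset.mul_sum, ← Finset.sum_sub_distrib, ← Finset.sum_add_distrib]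
    refine Finset.sum_congr rfl fun a _ => ?_
    have : ∑ b, N a b = ∑ b, 2 * MvPolynomial.eval y (MvPolynomial.pderiv a F) / (y a - y b) *
        (y a * y b) + ∑ b, y a * y b *
        MvPolynomial.eval y (MvPolynomial.pderiv a (MvPolynomial.pderiv b F)) := by
      rw [← Finset.sum_add_distrib]
      exact Finset.sum_congr rfl fun b _ => by simp only [hN]; ring
    rw [this]
    congr 1
    rw [← Finset.add_sum_erase _ _ (mem_univ a), sub_self, div_zero, zero_mul, zero_add]
    -- The splitting y_a y_b / (y_a - y_b) = y_a² / (y_a - y_b) - y_a; the m - 1 copies of the last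
    -- term are evaluated by Euler's identity.
    have h3 : ∀ b ∈ univ.erase a, 2 * MvPolynomial.eval y (MvPolynomial.pderiv a F) /
        (y a - y b) * (y a * y b) = 2 * (y a ^ 2 / (y a - y b) *
        MvPolynomial.eval y (MvPolynomial.pderiv a F)) -
        2 * (y a * MvPolynomial.eval y (MvPolynomial.pderiv a F)) := fun b hb => by
      have hne : y a - y b ≠ 0 := sub_ne_zero.2 fun h => (Finset.ne_of_mem_erase hb) (hy h).symm
      field_simp
      ring
    rw [Finset.sum_congr rfl h3, Finset.sum_sub_distrib, ← Finset.mul_sum, Finset.sum_const,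
      Finset.card_erase_of_mem (mem_univ a), Finset.card_univ, Fintype.card_fin, nsmul_eq_mul,
      Nat.cast_sub (by have := a.isLt; omega)]
    push_cast
    ring
  rw [hsum, Finset.sum_congr rfl fun a _ => hNaa a, e1, e2] at h2
  rw [laplaceBeltrami, zonalEigenvalue]
  have hz : ∑ i : Fin m, (κ i : ℝ) * ((κ i : ℝ) - ((i : ℕ) + 1)) = ∑ i, (κ i : ℝ) ^ 2 -
      (∑ i, (κ i : ℝ) * (2 * (i : ℕ) + 3) - ∑ i, (κ i : ℝ)) / 2 := by
    rw [← Finset.sum_sub_distrib, Finset.sum_div, ← Finset.sum_sub_distrib]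
    exact Finset.sum_congr rfl fun i _ => by ring
  rw [hz]
  linear_combination h2 / 2

/-- The product of all differences of distinct variables. -/
def diffProd (m : ℕ) : MvPolynomial (Fin m) ℝ :=
  ∏ p ∈ (univ : Finset (Fin m)).offDiag, (MvPolynomial.X p.1 - MvPolynomial.X p.2)

lemma eval_diffProd_ne_zero {y : Fin m → ℝ} :
    MvPolynomial.eval y (diffProd m) ≠ 0 ↔ Function.Injective y := by
  rw [diffProd, map_prod, Finset.prod_ne_zero_iff]
  constructor
  · intro h i j hij
    by_contra hne
    apply h (i, j) (by simp [hne])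
    simp [hij]
  · rintro h ⟨i, j⟩ hp
    simp only [mem_offDiag, mem_univ, true_and] at hp
    simpa [sub_eq_zero] using h.ne hp

/-- The Laplace–Beltrami operator with denominators cleared. -/
lemma exists_poly_laplaceBeltrami (P : MvPolynomial (Fin m) ℝ) : ∃ Q : MvPolynomial (Fin m) ℝ,
    ∀ y, Function.Injective y →
      MvPolynomial.eval y Q = MvPolynomial.eval y (diffProd m) * laplaceBeltrami P y := by
  classical
  refine ⟨diffProd m * ∑ i, MvPolynomial.X i ^ 2 * MvPolynomial.pderiv i (MvPolynomial.pderiv i P) +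
    ∑ i, ∑ j ∈ univ.erase i, MvPolynomial.X i ^ 2 *
      (∏ p ∈ (univ : Finset (Fin m)).offDiag.erase (i, j),
        (MvPolynomial.X p.1 - MvPolynomial.X p.2)) * MvPolynomial.pderiv i P, fun y hy => ?_⟩
  rw [laplaceBeltrami, mul_add, map_add, map_mul, map_sum, map_sum]
  congr 1
  · simp
  · rw [Finset.mul_sum]
    refine Finset.sum_congr rfl fun i _ => ?_
    rw [map_sum, Finset.mul_sum]
    refine Finset.sum_congr rfl fun j hj => ?_
    have hij : i ≠ j := (Finset.ne_of_mem_erase hj).symm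
    rw [diffProd, ← Finset.mul_prod_erase _ _ (show (i, j) ∈ univ.offDiag by simp [hij])]
    have hne : y i - y j ≠ 0 := sub_ne_zero.2 (hy.ne hij)
    simp only [map_mul, map_sub, map_pow, MvPolynomial.eval_X]
    field_simp

/-- The spherical polynomials are eigenfunctions of the Laplace–Beltrami operator. -/
lemma laplaceBeltrami_sphericalPoly {κ : Fin m → ℕ} (hκ : Antitone κ) {y : Fin m → ℝ}
    (hy : Function.Injective y) : laplaceBeltrami (sphericalPoly κ) y =
      zonalEigenvalue κ * MvPolynomial.eval y (sphericalPoly κ) := by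
  obtain ⟨Q, hQ⟩ := exists_poly_laplaceBeltrami (sphericalPoly κ)
  -- A polynomial identity may be checked on the positive orthant. The extra factor `diffProd m`
  -- makes it trivial where coordinates coincide and nothing is known about `Q`.
  have h : diffProd m * Q = diffProd m *
      (diffProd m * (MvPolynomial.C (zonalEigenvalue κ) * sphericalPoly κ)) := by
    refine MvPolynomial.funext_set (fun _ => Set.Ioi (0 : ℝ)) (fun _ => Set.Ioi_infinite 0)
      fun x hx => ?_
    rw [map_mul, map_mul (MvPolynomial.eval x)]
    by_cases h0 : MvPolynomial.eval x (diffProd m) = 0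
    · simp [h0]
    · have hinj := eval_diffProd_ne_zero.1 h0
      rw [hQ x hinj, laplaceBeltrami_sphericalPoly_of_pos hκ hinj fun i => hx i (Set.mem_univ i)]
      simp
  have h0 := eval_diffProd_ne_zero.2 hy
  have h1 := congrArg (MvPolynomial.eval y) h
  rw [map_mul, map_mul (MvPolynomial.eval y), hQ y hy] at h1
  have h2 := mul_left_cancel₀ h0 h1
  rw [map_mul] at h2
  simpa using mul_left_cancel₀ h0 h2

end KummerPearson

end

/-! ### Zonal polynomials are multiples of spherical polynomials. -/

noncomputable section

namespace KummerPearson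

open Matrix Finset MeasureTheory

variable {m t : ℕ}

lemma mem_partitions {κ : Fin m → ℕ} : κ ∈ partitions m t ↔ ∑ i, κ i = t ∧ Antitone κ := by
  simp [partitions]

lemma eq_of_dominated_of_sum_le {μ ν : Fin m → ℕ} (h : Dominated μ ν)
    (hle : ∑ r, ∑ i ∈ Iic r, ν i ≤ ∑ r, ∑ i ∈ Iic r, μ i) : μ = ν := by
  refine h.antisymm fun r => ?_
  have h1 := Finset.sum_le_sum fun r (_ : r ∈ univ) => h r
  have h2 := (Finset.sum_eq_sum_iff_of_le fun r (_ : r ∈ univ) => h r).1 (le_antisymm h1 hle)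
  exact (h2 r (mem_univ r)).ge

/-- The total of all partial sums is strictly monotone for dominance. A maximizer μ on `S` is
dominated by no other member, so y^μ occurs in only one summand. -/
lemma exists_coeff_sum_sphericalPoly_ne_zero {S : Finset (Fin m → ℕ)} (hS : S.Nonempty)
    (hanti : ∀ κ ∈ S, Antitone κ) {c : (Fin m → ℕ) → ℝ} (hc : ∀ κ ∈ S, c κ ≠ 0) :
    ∃ μ ∈ S, (∑ ν ∈ S, c ν • sphericalPoly ν).coeff (Finsupp.equivFunOnFinite.symm μ) ≠ 0 := by
  obtain ⟨μ, hμ, hmax⟩ := Finset.exists_max_image S (fun ν => ∑ r, ∑ i ∈ Iic r, ν i) hS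
  refine ⟨μ, hμ, ?_⟩
  rw [MvPolynomial.coeff_sum, Finset.sum_eq_single_of_mem μ hμ]
  · rw [MvPolynomial.coeff_smul, smul_eq_mul]
    exact mul_ne_zero (hc μ hμ) (coeff_sphericalPoly_self_pos (hanti μ hμ)).ne'
  · intro ν hν hne
    rw [MvPolynomial.coeff_smul, smul_eq_mul]
    by_contra h
    exact hne (eq_of_dominated_of_sum_le
      (sphericalPoly_domBounded (hanti ν hν) _ (right_ne_zero_of_mul h)) (hmax ν hν)).symm

lemma sphericalPoly_coeff_independent {c : (Fin m → ℕ) → ℝ}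
    (h : ∀ μ ∈ partitions m t, (∑ ν ∈ partitions m t, c ν • sphericalPoly ν).coeff
      (Finsupp.equivFunOnFinite.symm μ) = 0) : ∀ κ ∈ partitions m t, c κ = 0 := by
  classical
  by_contra! hne
  obtain ⟨κ, hκ, hcκ⟩ := hne
  obtain ⟨μ, hμ, hne⟩ := exists_coeff_sum_sphericalPoly_ne_zero
    (S := (partitions m t).filter fun ν => c ν ≠ 0) ⟨κ, by simp [hκ, hcκ]⟩
    (fun ν hν => (mem_partitions.1 (Finset.mem_of_mem_filter _ hν)).2)
    (fun ν hν => (Finset.mem_filter.1 hν).2)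
  apply hne
  rw [Finset.sum_filter_of_ne]
  · exact h μ (Finset.mem_of_mem_filter _ hμ)
  · intro ν _ h0 hc
    rw [hc, zero_smul] at h0
    exact h0 rfl

lemma exists_perm_antitone (s : Fin m → ℕ) : ∃ σ : Equiv.Perm (Fin m), Antitone (s ∘ σ) := by
  refine ⟨Fin.revPerm.trans (Tuple.sort s), ?_⟩
  have h := Tuple.monotone_sort s
  intro i j hij
  exact h (Fin.rev_le_rev.2 hij)

lemma eq_zero_of_coeff_partitions {f : MvPolynomial (Fin m) ℝ} (hsym : f.IsSymmetric)
    (hhom : f.IsHomogeneous t)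
    (h : ∀ μ ∈ partitions m t, f.coeff (Finsupp.equivFunOnFinite.symm μ) = 0) : f = 0 := by
  ext s
  rw [MvPolynomial.coeff_zero]
  by_contra hne
  have hdeg : s.degree = t := by
    by_contra hd
    exact hne (hhom.coeff_eq_zero hd)
  obtain ⟨σ, hσ⟩ := exists_perm_antitone s
  have h1 : f.coeff (s.mapDomain σ.symm) = f.coeff s := by
    conv_lhs => rw [← hsym σ.symm]
    exact MvPolynomial.coeff_rename_mapDomain _ σ.symm.injective _ _
  have h2 : s.mapDomain σ.symm = Finsupp.equivFunOnFinite.symm (s ∘ σ) := by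
    ext i
    simp
  rw [h2] at h1
  refine hne (h1 ▸ h _ (mem_partitions.2 ⟨?_, hσ⟩))
  rw [← hdeg, Finsupp.degree_eq_sum]
  exact Equiv.sum_comp σ s

lemma isSymmetric_sum_sphericalPoly (c : (Fin m → ℕ) → ℝ) :
    (∑ ν ∈ partitions m t, c ν • sphericalPoly ν).IsSymmetric := by
  refine (MvPolynomial.symmetricSubalgebra (Fin m) ℝ).sum_mem fun ν hν => ?_
  exact (MvPolynomial.symmetricSubalgebra (Fin m) ℝ).smul_mem
    (sphericalPoly_isSymmetric (mem_partitions.1 hν).2) _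

lemma sphericalPoly_isHomogeneous_of_mem {κ : Fin m → ℕ} (hκ : κ ∈ partitions m t) :
    (sphericalPoly κ).IsHomogeneous t := by
  have := sphericalPoly_isHomogeneous κ
  rwa [(mem_partitions.1 hκ).1] at this

lemma isHomogeneous_smul {f : MvPolynomial (Fin m) ℝ} (hf : f.IsHomogeneous t) (c : ℝ) :
    (c • f).IsHomogeneous t := by
  rw [MvPolynomial.smul_eq_C_mul]
  simpa using (MvPolynomial.isHomogeneous_C _ c).mul hf

lemma isHomogeneous_sum_sphericalPoly (c : (Fin m → ℕ) → ℝ) :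
    (∑ ν ∈ partitions m t, c ν • sphericalPoly ν).IsHomogeneous t :=
  MvPolynomial.IsHomogeneous.sum _ _ _ fun _ hν =>
    isHomogeneous_smul (sphericalPoly_isHomogeneous_of_mem hν) _

/-- The spherical polynomials span the symmetric homogeneous polynomials. -/
lemma exists_eq_sum_sphericalPoly {f : MvPolynomial (Fin m) ℝ} (hsym : f.IsSymmetric)
    (hhom : f.IsHomogeneous t) : ∃ c : (Fin m → ℕ) → ℝ,
      f = ∑ κ ∈ partitions m t, c κ • sphericalPoly κ := by
  classical
  -- The coefficient matrix at partitions is square, so linear independence already gives spanning.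
  let Φ : (partitions m t → ℝ) →ₗ[ℝ] (partitions m t → ℝ) :=
    { toFun := fun c μ => ∑ ν, c ν *
        (sphericalPoly ν.1).coeff (Finsupp.equivFunOnFinite.symm μ.1)
      map_add' := fun c d => by
        funext μ; simp [add_mul, Finset.sum_add_distrib]
      map_smul' := fun r c => by
        funext μ; simp [Finset.mul_sum, mul_assoc] }
  let ext : (partitions m t → ℝ) → (Fin m → ℕ) → ℝ := fun c ν =>
    if h : ν ∈ partitions m t then c ⟨ν, h⟩ else 0
  have hext : ∀ c μ, (∑ ν ∈ partitions m t, ext c ν • sphericalPoly ν).coeff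
      (Finsupp.equivFunOnFinite.symm μ) = ∑ ν, c ν *
        (sphericalPoly ν.1).coeff (Finsupp.equivFunOnFinite.symm μ) := fun c μ => by
    rw [MvPolynomial.coeff_sum, ← Finset.sum_coe_sort]
    refine Finset.sum_congr rfl fun ν _ => ?_
    simp [ext]
  have hinj : Function.Injective Φ := by
    rw [injective_iff_map_eq_zero]
    intro c hc
    have h0 := sphericalPoly_coeff_independent (t := t) (c := ext c) fun μ hμ => by
      rw [hext]
      exact congrFun hc ⟨μ, hμ⟩
    funext ν
    have := h0 ν.1 ν.2
    simpa [ext] using this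
  obtain ⟨c, hc⟩ := LinearMap.injective_iff_surjective.1 hinj
    fun μ => f.coeff (Finsupp.equivFunOnFinite.symm μ.1)
  refine ⟨ext c, ?_⟩
  rw [← sub_eq_zero]
  refine eq_zero_of_coeff_partitions (t := t) ?_ ?_ fun μ hμ => ?_
  · exact (MvPolynomial.symmetricSubalgebra (Fin m) ℝ).sub_mem hsym
      (isSymmetric_sum_sphericalPoly _)
  · exact hhom.sub (isHomogeneous_sum_sphericalPoly _)
  · rw [MvPolynomial.coeff_sub, hext, sub_eq_zero]
    exact (congrFun hc ⟨μ, hμ⟩).symm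

/-- The eigenvalue is strictly increasing for the dominance order. -/
lemma eq_of_dominated_of_zonalEigenvalue_eq {μ κ : Fin m → ℕ} (hμ : μ ∈ partitions m t)
    (hκ : κ ∈ partitions m t) (hdom : Dominated μ κ)
    (hev : zonalEigenvalue μ = zonalEigenvalue κ) : μ = κ := by
  rw [mem_partitions] at hμ hκ
  set d : Fin m → ℝ := fun i => (κ i : ℝ) - μ i with hd
  have hD : ∀ r, 0 ≤ ∑ i ∈ Iic r, d i := fun r => by
    rw [hd, Finset.sum_sub_distrib, sub_nonneg]
    exact_mod_cast hdom r
  have hsum : (∑ i, (κ i : ℝ)) = ∑ i, (μ i : ℝ) := by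
    exact_mod_cast hκ.1.trans hμ.1.symm
  -- As ∑ d_i = 0, the difference of the eigenvalues is ∑ (κ_i + μ_i) d_i + ∑ (m - i) d_i. Summation
  -- by parts makes both sums nonnegative; the second is the sum of all partial sums of `d`, so
  -- equality forces each of them to vanish.
  have h1 : 0 ≤ ∑ i, ((κ i : ℝ) + μ i) * d i := by
    have := sum_partStep_mul (κ := fun i => κ i + μ i) (fun i j hij => add_le_add (hκ.2 hij)
      (hμ.2 hij)) d
    push_cast at this
    rw [← this]
    exact Finset.sum_nonneg fun i _ => mul_nonneg (Nat.cast_nonneg _) (hD i)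
  have h2 : ∑ i : Fin m, ((m : ℝ) - (i : ℕ)) * d i = ∑ i, ∑ j ∈ Iic i, d j := by
    have := sum_partStep_mul (κ := fun i : Fin m => m - (i : ℕ)) (fun i j hij => by
      have : (i : ℕ) ≤ j := hij
      simp only; omega) d
    have h3 : ∀ i : Fin m, partStep (fun i : Fin m => m - (i : ℕ)) i = 1 := fun i => by
      simp only [partStep, extendZero]
      have := i.isLt
      split_ifs <;> omega
    simp only [h3, Nat.cast_one, one_mul] at this
    rw [this]
    refine Finset.sum_congr rfl fun i _ => ?_
    rw [Nat.cast_sub i.isLt.le]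
  have h4 : ∑ i, ((κ i : ℝ) + μ i) * d i + ∑ i : Fin m, ((m : ℝ) - (i : ℕ)) * d i = 0 := by
    have h5 : zonalEigenvalue κ - zonalEigenvalue μ = 0 := sub_eq_zero.2 hev.symm
    have h6 : ∑ i, d i = 0 := by rw [hd, Finset.sum_sub_distrib, hsum, sub_self]
    rw [zonalEigenvalue, zonalEigenvalue, hsum, add_sub_add_right_eq_sub,
      ← Finset.sum_sub_distrib] at h5
    have h7 : ∑ i, ((κ i : ℝ) + μ i) * d i + ∑ i : Fin m, ((m : ℝ) - (i : ℕ)) * d i =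
        ∑ i : Fin m, ((κ i : ℝ) * ((κ i : ℝ) - ((i : ℕ) + 1)) -
          (μ i : ℝ) * ((μ i : ℝ) - ((i : ℕ) + 1))) + (m + 1) * ∑ i, d i := by
      rw [Finset.mul_sum, ← Finset.sum_add_distrib, ← Finset.sum_add_distrib]
      exact Finset.sum_congr rfl fun i _ => by rw [hd]; ring
    rw [h7, h5, h6]; ring
  rw [h2] at h4
  have h8 : ∑ i, ∑ j ∈ Iic i, d j = 0 :=
    le_antisymm (by linarith) (Finset.sum_nonneg fun i _ => hD i)
  have h9 := (Finset.sum_eq_zero_iff_of_nonneg fun i _ => hD i).1 h8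
  refine hdom.antisymm fun r => ?_
  have := h9 r (mem_univ r)
  rw [hd, Finset.sum_sub_distrib, sub_eq_zero] at this
  exact_mod_cast this.le

lemma laplaceBeltrami_smul (c : ℝ) (P : MvPolynomial (Fin m) ℝ) (y : Fin m → ℝ) :
    laplaceBeltrami (c • P) y = c * laplaceBeltrami P y := by
  simp only [laplaceBeltrami, Derivation.map_smul, MvPolynomial.smul_eval, mul_add, Finset.mul_sum]
  congr 1
  · exact Finset.sum_congr rfl fun i _ => by ring
  · exact Finset.sum_congr rfl fun i _ => Finset.sum_congr rfl fun j _ => by ring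

lemma laplaceBeltrami_add (P Q : MvPolynomial (Fin m) ℝ) (y : Fin m → ℝ) :
    laplaceBeltrami (P + Q) y = laplaceBeltrami P y + laplaceBeltrami Q y := by
  simp only [laplaceBeltrami, map_add, mul_add, Finset.sum_add_distrib]
  ring

lemma laplaceBeltrami_sum {ι : Type*} (s : Finset ι) (P : ι → MvPolynomial (Fin m) ℝ)
    (y : Fin m → ℝ) : laplaceBeltrami (∑ i ∈ s, P i) y = ∑ i ∈ s, laplaceBeltrami (P i) y := by
  classical
  induction s using Finset.induction_on with
  | empty => simp [laplaceBeltrami]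
  | insert i s hi ih => rw [Finset.sum_insert hi, Finset.sum_insert hi, laplaceBeltrami_add, ih]

lemma eq_zero_of_eval_injective {P : MvPolynomial (Fin m) ℝ}
    (h : ∀ y, Function.Injective y → MvPolynomial.eval y P = 0) : P = 0 := by
  have h1 : diffProd m * P = 0 := MvPolynomial.funext fun y => by
    rw [map_mul, map_zero]
    by_cases hy : Function.Injective y
    · rw [h y hy, mul_zero]
    · rw [not_not.1 (mt eval_diffProd_ne_zero.1 hy), zero_mul]
  refine (mul_eq_zero.1 h1).resolve_left fun h0 => ?_
  have := eval_diffProd_ne_zero.2 (show Function.Injective fun i : Fin m => ((i : ℕ) : ℝ) from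
    fun i j hij => Fin.ext (by simpa using hij))
  rw [h0, map_zero] at this
  exact this rfl

/-- Every zonal family consists of multiples of the spherical polynomials. -/
lemma IsZonalFamily.exists_smul {C : (Fin m → ℕ) → MvPolynomial (Fin m) ℝ}
    (hC : IsZonalFamily m t C) {κ : Fin m → ℕ} (hκ : κ ∈ partitions m t) :
    ∃ s : ℝ, C κ = s • sphericalPoly κ := by
  classical
  obtain ⟨c, hc⟩ := exists_eq_sum_sphericalPoly (hC.symmetric κ hκ) (hC.homogeneous κ hκ)
  have hev : ∀ μ ∈ partitions m t, c μ ≠ 0 → zonalEigenvalue μ = zonalEigenvalue κ := by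
    have h0 : ∑ μ ∈ partitions m t, (c μ * (zonalEigenvalue μ - zonalEigenvalue κ)) •
        sphericalPoly μ = 0 := by
      refine eq_zero_of_eval_injective fun y hy => ?_
      have h1 := hC.eigenfunction κ hκ y hy
      rw [hc, laplaceBeltrami_sum, map_sum, Finset.mul_sum, ← sub_eq_zero,
        ← Finset.sum_sub_distrib] at h1
      rw [map_sum, ← h1]
      refine Finset.sum_congr rfl fun μ hμ => ?_
      rw [laplaceBeltrami_smul, laplaceBeltrami_sphericalPoly (mem_partitions.1 hμ).2 hy,
        MvPolynomial.smul_eval, MvPolynomial.smul_eval]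
      ring
    have h1 := sphericalPoly_coeff_independent (t := t)
      (c := fun μ => c μ * (zonalEigenvalue μ - zonalEigenvalue κ)) (fun μ _ => by
        rw [h0, MvPolynomial.coeff_zero])
    intro μ hμ hne
    exact sub_eq_zero.1 ((mul_eq_zero.1 (h1 μ hμ)).resolve_left hne)
  refine ⟨c κ, ?_⟩
  set S := ((partitions m t).erase κ).filter fun μ => c μ ≠ 0 with hS
  have hsum : C κ = c κ • sphericalPoly κ + ∑ μ ∈ S, c μ • sphericalPoly μ := by
    rw [hS, Finset.sum_filter_of_ne, Finset.add_sum_erase _ (fun μ => c μ • sphericalPoly μ) hκ]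
    · exact hc
    · intro μ _ h0 hc0
      rw [hc0, zero_smul] at h0
      exact h0 rfl
  rcases S.eq_empty_or_nonempty with hemp | hne
  · rw [hsum, hemp, Finset.sum_empty, add_zero]
  · exfalso
    have hmem : ∀ μ ∈ S, μ ∈ partitions m t ∧ μ ≠ κ ∧ c μ ≠ 0 := fun μ hμ => by
      rw [hS, Finset.mem_filter, Finset.mem_erase] at hμ
      exact ⟨hμ.1.2, hμ.1.1, hμ.2⟩
    -- A leftover component would show a monomial y^μ. If μ were not dominated by κ, triangularity
    -- would exclude it from `C κ` and from the spherical polynomial; if it is, equal eigenvalues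
    -- contradict μ ≠ κ.
    obtain ⟨μ, hμ, hcoef⟩ := exists_coeff_sum_sphericalPoly_ne_zero hne
      (fun ν hν => (mem_partitions.1 (hmem ν hν).1).2) (fun ν hν => (hmem ν hν).2.2)
    obtain ⟨hμP, hμκ, hcμ⟩ := hmem μ hμ
    refine hμκ (eq_of_dominated_of_zonalEigenvalue_eq hμP hκ ?_ (hev μ hμP hcμ))
    by_contra hnd
    have h1 : (C κ).coeff (Finsupp.equivFunOnFinite.symm μ) = 0 := by
      by_contra h; exact hnd (hC.triangular κ hκ μ hμP h)
    have h2 : (sphericalPoly κ).coeff (Finsupp.equivFunOnFinite.symm μ) = 0 := by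
      by_contra h; exact hnd (sphericalPoly_domBounded (mem_partitions.1 hκ).2 _ h)
    rw [hsum, MvPolynomial.coeff_add, MvPolynomial.coeff_smul, h2, smul_zero, zero_add] at h1
    exact hcoef h1

lemma isSymmetric_sum_X_pow (t : ℕ) :
    ((∑ i, MvPolynomial.X i : MvPolynomial (Fin m) ℝ) ^ t).IsSymmetric := by
  intro σ
  simp only [map_pow, map_sum, MvPolynomial.rename_X]
  rw [Equiv.sum_comp σ (fun i => (MvPolynomial.X i : MvPolynomial (Fin m) ℝ))]

lemma isHomogeneous_sum_X_pow (t : ℕ) :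
    ((∑ i, MvPolynomial.X i : MvPolynomial (Fin m) ℝ) ^ t).IsHomogeneous t := by
  have := (MvPolynomial.IsHomogeneous.sum univ (fun i => (MvPolynomial.X i :
    MvPolynomial (Fin m) ℝ)) 1 fun i _ => MvPolynomial.isHomogeneous_X _ _).pow t
  simpa using this

lemma exists_isZonalFamily (m t : ℕ) : ∃ C, IsZonalFamily m t C := by
  obtain ⟨s, hs⟩ := exists_eq_sum_sphericalPoly (m := m) (isSymmetric_sum_X_pow t)
    (isHomogeneous_sum_X_pow t)
  refine ⟨fun κ => s κ • sphericalPoly κ, ?_, ?_, ?_, ?_, hs.symm⟩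
  · intro κ hκ
    exact (MvPolynomial.symmetricSubalgebra (Fin m) ℝ).smul_mem
      (sphericalPoly_isSymmetric (mem_partitions.1 hκ).2) _
  · intro κ hκ
    exact isHomogeneous_smul (sphericalPoly_isHomogeneous_of_mem hκ) _
  · intro κ hκ μ _ hne
    rw [MvPolynomial.coeff_smul, smul_eq_mul] at hne
    exact sphericalPoly_domBounded (mem_partitions.1 hκ).2 _ (right_ne_zero_of_mul hne)
  · intro κ hκ y hy
    rw [laplaceBeltrami_smul, laplaceBeltrami_sphericalPoly (mem_partitions.1 hκ).2 hy,
      MvPolynomial.smul_eval]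
    ring

/-- The zonal polynomials are multiples of the spherical polynomials, and they add up to the
powers of the trace. -/
lemma exists_zonalPoly_eq_smul (m : ℕ) : ∃ s : (Fin m → ℕ) → ℝ,
    (∀ κ, Antitone κ → zonalPoly κ = s κ • sphericalPoly κ) ∧
    ∀ t, ∑ κ ∈ partitions m t, s κ • sphericalPoly κ = (∑ i, MvPolynomial.X i) ^ t := by
  have hfam : ∀ t, IsZonalFamily m t (Classical.epsilon (IsZonalFamily m t)) := fun t =>
    Classical.epsilon_spec (exists_isZonalFamily m t)
  have hex : ∀ κ : Fin m → ℕ, ∃ s : ℝ, Antitone κ → zonalPoly κ = s • sphericalPoly κ := by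
    intro κ
    by_cases hκ : Antitone κ
    · obtain ⟨s, hs⟩ := (hfam (∑ i, κ i)).exists_smul (mem_partitions.2 ⟨rfl, hκ⟩)
      exact ⟨s, fun _ => hs⟩
    · exact ⟨0, fun h => absurd h hκ⟩
  choose s hs using hex
  refine ⟨s, hs, fun t => ?_⟩
  rw [← (hfam t).sum_eq]
  refine Finset.sum_congr rfl fun κ hκ => ?_
  obtain ⟨h1, h2⟩ := mem_partitions.1 hκ
  rw [← hs κ h2, zonalPoly, h1]

end KummerPearson

end

/-! ### Moments of traces over orbits and positivity of the zonal coefficients. -/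

noncomputable section

namespace KummerPearson

open Matrix Finset MeasureTheory

variable {m n t : ℕ}

/-- The mean of the power function over the orthogonal orbit of `S`. -/
def sphericalFn (κ : Fin m → ℕ) (S : Matrix (Fin m) (Fin m) ℝ) : ℝ :=
  ∫ H : orthogonalGroup (Fin m) ℝ, powerFn κ ((H : Matrix (Fin m) (Fin m) ℝ) * S *
    (H : Matrix (Fin m) (Fin m) ℝ)ᵀ) ∂haarO m

lemma orbitMean_refl (κ : Fin m → ℕ) (S : Matrix (Fin m) (Fin m) ℝ) :
    orbitMean le_rfl κ S = sphericalFn κ S := rfl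

lemma isHermitian_conj {S : Matrix (Fin n) (Fin n) ℝ} (hS : S.IsHermitian)
    (g : Matrix (Fin m) (Fin n) ℝ) : (g * S * gᵀ).IsHermitian := by
  have := isHermitian_mul_mul_conjTranspose g hS
  rwa [conjTranspose_eq_transpose_of_trivial] at this

lemma continuous_orthogonal_conj (S : Matrix (Fin n) (Fin n) ℝ) :
    Continuous fun Q : orthogonalGroup (Fin n) ℝ =>
      (Q : Matrix (Fin n) (Fin n) ℝ) * S * (Q : Matrix (Fin n) (Fin n) ℝ)ᵀ :=
  (continuous_subtype_val.matrix_mul continuous_const).matrix_mul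
    continuous_subtype_val.matrix_transpose

lemma sum_mul_sphericalFn {s : (Fin m → ℕ) → ℝ}
    (hs : ∑ κ ∈ partitions m t, s κ • sphericalPoly κ = (∑ i, MvPolynomial.X i) ^ t)
    {S : Matrix (Fin m) (Fin m) ℝ} (hS : S.IsHermitian) :
    ∑ κ ∈ partitions m t, s κ * sphericalFn κ S = S.trace ^ t := by
  have h := congrArg (MvPolynomial.eval hS.eigenvalues) hs
  simp only [map_sum, map_pow, MvPolynomial.smul_eval, MvPolynomial.eval_X] at h
  rw [hS.trace_eq_sum_eigenvalues]
  refine Eq.trans (Finset.sum_congr rfl fun κ hκ => ?_) h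
  rw [sphericalFn, integral_powerFn_conj_hermitian (mem_partitions.1 hκ).2 hS]

/-- After exchanging the two orthogonal means, the product formula applies to `H g` for each fixed
`H`. -/
lemma integral_sphericalFn_conj (h : m ≤ n) (κ : Fin m → ℕ) (g : Matrix (Fin m) (Fin n) ℝ)
    (Λ : Matrix (Fin n) (Fin n) ℝ) :
    ∫ Q : orthogonalGroup (Fin n) ℝ, sphericalFn κ (g * ((Q : Matrix (Fin n) (Fin n) ℝ) * Λ *
      (Q : Matrix (Fin n) (Fin n) ℝ)ᵀ) * gᵀ) ∂haarO n =
      sphericalFn κ (g * gᵀ) * orbitMean h κ Λ := by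
  unfold sphericalFn
  rw [integral_integral_swap_of_hasCompactSupport, ← integral_mul_const]
  · refine integral_congr_ae (Filter.Eventually.of_forall fun H => ?_)
    simp only
    have h1 := integral_powerFn_conj h κ ((H : Matrix (Fin m) (Fin m) ℝ) * g) Λ
    simpa only [transpose_mul, Matrix.mul_assoc] using h1
  · refine continuous_powerFn κ ?_
    refine Continuous.matrix_mul (Continuous.matrix_mul ?_ (Continuous.matrix_mul
      (continuous_const.matrix_mul ?_) continuous_const)) (Continuous.matrix_transpose ?_)
    · exact continuous_subtype_val.comp continuous_snd
    · exact (continuous_orthogonal_conj Λ).comp continuous_fst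
    · exact continuous_subtype_val.comp continuous_snd
  · exact HasCompactSupport.of_compactSpace _

lemma continuous_sphericalFn {α : Type*} [TopologicalSpace α] [FirstCountableTopology α]
    [LocallyCompactSpace α] (κ : Fin m → ℕ)
    {S : α → Matrix (Fin m) (Fin m) ℝ} (hS : Continuous S) :
    Continuous fun x => sphericalFn κ (S x) := by
  unfold sphericalFn
  refine continuous_parametric_integral_of_continuous (μ := haarO m)
    (f := fun x (H : orthogonalGroup (Fin m) ℝ) => powerFn κ ((H : Matrix (Fin m) (Fin m) ℝ) *
      S x * (H : Matrix (Fin m) (Fin m) ℝ)ᵀ)) ?_ isCompact_univ |>.congr fun x => by simp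
  refine continuous_powerFn κ ?_
  exact ((continuous_subtype_val.comp continuous_snd).matrix_mul
    (hS.comp continuous_fst)).matrix_mul
      (continuous_subtype_val.comp continuous_snd).matrix_transpose

instance : SecondCountableTopology (orthogonalGroup (Fin n) ℝ) :=
  haveI : SecondCountableTopology (Matrix (Fin n) (Fin n) ℝ) :=
    inferInstanceAs (SecondCountableTopology (Fin n → Fin n → ℝ))
  inferInstanceAs (SecondCountableTopology
    ((orthogonalGroup (Fin n) ℝ : Set (Matrix (Fin n) (Fin n) ℝ)) : Type _))

/-- The mean of the powers of a trace over an orthogonal orbit. -/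
lemma integral_trace_pow {s : (Fin m → ℕ) → ℝ}
    (hs : ∑ κ ∈ partitions m t, s κ • sphericalPoly κ = (∑ i, MvPolynomial.X i) ^ t)
    (h : m ≤ n) (g : Matrix (Fin m) (Fin n) ℝ)
    {Λ : Matrix (Fin n) (Fin n) ℝ} (hΛ : Λ.IsHermitian) :
    ∫ Q : orthogonalGroup (Fin n) ℝ, (g * ((Q : Matrix (Fin n) (Fin n) ℝ) * Λ *
      (Q : Matrix (Fin n) (Fin n) ℝ)ᵀ) * gᵀ).trace ^ t ∂haarO n =
      ∑ κ ∈ partitions m t, s κ * (sphericalFn κ (g * gᵀ) * orbitMean h κ Λ) := by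
  have h1 : ∀ Q : orthogonalGroup (Fin n) ℝ, (g * ((Q : Matrix (Fin n) (Fin n) ℝ) * Λ *
      (Q : Matrix (Fin n) (Fin n) ℝ)ᵀ) * gᵀ).trace ^ t = ∑ κ ∈ partitions m t, s κ *
        sphericalFn κ (g * ((Q : Matrix (Fin n) (Fin n) ℝ) * Λ *
      (Q : Matrix (Fin n) (Fin n) ℝ)ᵀ) * gᵀ) := fun Q =>
    (sum_mul_sphericalFn hs (isHermitian_conj (isHermitian_conj hΛ _) g)).symm
  simp_rw [h1]
  rw [integral_finsetSum]
  · refine Finset.sum_congr rfl fun κ _ => ?_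
    rw [integral_const_mul, integral_sphericalFn_conj h]
  · intro κ _
    refine Integrable.const_mul (integrable_haarO (continuous_sphericalFn κ ?_)) _
    exact (continuous_const.matrix_mul (continuous_orthogonal_conj Λ)).matrix_mul continuous_const

lemma trace_mul_pow_eq_sum {A B : Matrix (Fin m) (Fin m) ℝ} (hB : B.IsHermitian) :
    (A * B).trace ^ t = ∑ I : Fin t → Fin m × Fin m,
      (∏ i, A (I i).1 (I i).2) * ∏ i, B (I i).1 (I i).2 := by
  have h1 : (A * B).trace = ∑ p : Fin m × Fin m, A p.1 p.2 * B p.1 p.2 := by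
    rw [Fintype.sum_prod_type, trace]
    refine Finset.sum_congr rfl fun i _ => ?_
    rw [diag_apply, mul_apply]
    refine Finset.sum_congr rfl fun j _ => ?_
    rw [← hB.apply i j, star_trivial]
  rw [h1, Fintype.sum_pow]
  simp only [Finset.prod_mul_distrib]

/-- Invariance permits replacing A by P A Pᵀ and then averaging over P as well. Expanding the power
into entries separates A from B, leaving an inner product of their averaged moment tensors. -/
lemma integral_trace_conj_pow (A B : Matrix (Fin m) (Fin m) ℝ) (hB : B.IsHermitian) :
    ∫ Q : orthogonalGroup (Fin m) ℝ, (A * ((Q : Matrix (Fin m) (Fin m) ℝ) * B *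
      (Q : Matrix (Fin m) (Fin m) ℝ)ᵀ)).trace ^ t ∂haarO m =
    ∑ I : Fin t → Fin m × Fin m,
      (∫ Q : orthogonalGroup (Fin m) ℝ, ∏ i, ((Q : Matrix (Fin m) (Fin m) ℝ) * A *
        (Q : Matrix (Fin m) (Fin m) ℝ)ᵀ) (I i).1 (I i).2 ∂haarO m) *
      ∫ Q : orthogonalGroup (Fin m) ℝ, ∏ i, ((Q : Matrix (Fin m) (Fin m) ℝ) * B *
        (Q : Matrix (Fin m) (Fin m) ℝ)ᵀ) (I i).1 (I i).2 ∂haarO m := by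
  have hInt : ∀ (S : Matrix (Fin m) (Fin m) ℝ) (I : Fin t → Fin m × Fin m),
      Integrable (fun Q : orthogonalGroup (Fin m) ℝ => ∏ i, ((Q : Matrix (Fin m) (Fin m) ℝ) * S *
        (Q : Matrix (Fin m) (Fin m) ℝ)ᵀ) (I i).1 (I i).2) (haarO m) := fun S I =>
    integrable_haarO (continuous_finsetProd _ fun i _ =>
      (continuous_orthogonal_conj S).matrix_elem _ _)
  have key : ∀ P : orthogonalGroup (Fin m) ℝ,
      ∫ Q : orthogonalGroup (Fin m) ℝ, (A * ((Q : Matrix (Fin m) (Fin m) ℝ) * B *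
        (Q : Matrix (Fin m) (Fin m) ℝ)ᵀ)).trace ^ t ∂haarO m =
      ∑ I : Fin t → Fin m × Fin m, (∏ i, ((P : Matrix (Fin m) (Fin m) ℝ) * A *
        (P : Matrix (Fin m) (Fin m) ℝ)ᵀ) (I i).1 (I i).2) *
      ∫ Q : orthogonalGroup (Fin m) ℝ, ∏ i, ((Q : Matrix (Fin m) (Fin m) ℝ) * B *
        (Q : Matrix (Fin m) (Fin m) ℝ)ᵀ) (I i).1 (I i).2 ∂haarO m := by
    intro P
    have h1 : ∀ Q : orthogonalGroup (Fin m) ℝ, (A * ((Q : Matrix (Fin m) (Fin m) ℝ) * B *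
        (Q : Matrix (Fin m) (Fin m) ℝ)ᵀ)).trace =
        (((P : Matrix (Fin m) (Fin m) ℝ) * A * (P : Matrix (Fin m) (Fin m) ℝ)ᵀ) *
          (((P * Q : orthogonalGroup (Fin m) ℝ) : Matrix (Fin m) (Fin m) ℝ) * B *
          ((P * Q : orthogonalGroup (Fin m) ℝ) : Matrix (Fin m) (Fin m) ℝ)ᵀ)).trace := by
      intro Q
      rw [Submonoid.coe_mul, transpose_mul]
      have : ∀ Z : Matrix (Fin m) (Fin m) ℝ, (P : Matrix (Fin m) (Fin m) ℝ)ᵀ *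
          ((P : Matrix (Fin m) (Fin m) ℝ) * Z) = Z := fun Z => by
        rw [← Matrix.mul_assoc, coe_transpose_mul, Matrix.one_mul]
      simp only [Matrix.mul_assoc, this]
      rw [trace_mul_comm (P : Matrix (Fin m) (Fin m) ℝ)]
      simp only [Matrix.mul_assoc, coe_transpose_mul, Matrix.mul_one]
    simp_rw [h1]
    rw [integral_mul_left_eq_self (μ := haarO m) (fun Q : orthogonalGroup (Fin m) ℝ =>
      (((P : Matrix (Fin m) (Fin m) ℝ) * A * (P : Matrix (Fin m) (Fin m) ℝ)ᵀ) *
          ((Q : Matrix (Fin m) (Fin m) ℝ) * B *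
          (Q : Matrix (Fin m) (Fin m) ℝ)ᵀ)).trace ^ t) P]
    have h2 := fun Q : orthogonalGroup (Fin m) ℝ => trace_mul_pow_eq_sum (t := t)
      (A := (P : Matrix (Fin m) (Fin m) ℝ) * A * (P : Matrix (Fin m) (Fin m) ℝ)ᵀ)
      (isHermitian_conj hB (Q : Matrix (Fin m) (Fin m) ℝ))
    simp_rw [h2]
    rw [integral_finsetSum _ fun I _ => (hInt B I).const_mul _]
    simp_rw [integral_const_mul]
  have h3 := integral_congr_ae (μ := haarO m) (Filter.Eventually.of_forall key)
  rw [integral_const, probReal_univ, one_smul] at h3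
  rw [h3, integral_finsetSum _ fun I _ => (hInt A I).mul_const _]
  simp_rw [integral_mul_const]

/-- The kernel is a Gram matrix of moment tensors, so its quadratic form is a sum of squares. -/
lemma sum_mul_integral_trace_nonneg {ι : Type*} (T : Finset ι) (u : ι → ℝ)
    {A : ι → Matrix (Fin m) (Fin m) ℝ} (hA : ∀ i, (A i).IsHermitian) :
    0 ≤ ∑ i ∈ T, ∑ j ∈ T, u i * u j *
      ∫ Q : orthogonalGroup (Fin m) ℝ, (A i * ((Q : Matrix (Fin m) (Fin m) ℝ) * A j *
        (Q : Matrix (Fin m) (Fin m) ℝ)ᵀ)).trace ^ t ∂haarO m := by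
  simp_rw [integral_trace_conj_pow _ _ (hA _), Finset.mul_sum]
  rw [Finset.sum_congr rfl fun i _ => Finset.sum_comm, Finset.sum_comm]
  refine Finset.sum_nonneg fun I _ => ?_
  set w : ι → ℝ := fun i => u i * ∫ Q : orthogonalGroup (Fin m) ℝ,
    ∏ k, ((Q : Matrix (Fin m) (Fin m) ℝ) * A i *
        (Q : Matrix (Fin m) (Fin m) ℝ)ᵀ) (I k).1 (I k).2 ∂haarO m with hw
  have : (∑ i ∈ T, w i) * (∑ j ∈ T, w j) = _ := Finset.sum_mul_sum _ _ _ _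
  refine le_of_le_of_eq (mul_self_nonneg (∑ i ∈ T, w i)) (this.trans ?_)
  refine Finset.sum_congr rfl fun i _ => Finset.sum_congr rfl fun j _ => ?_
  rw [hw]
  ring

lemma eval_sphericalPoly_eq_sphericalFn {κ : Fin m → ℕ} (hκ : Antitone κ) (y : Fin m → ℝ) :
    MvPolynomial.eval y (sphericalPoly κ) = sphericalFn κ (diagonal y) :=
  eval_sphericalPoly hκ y

/-- Finitely many nonnegative points separate a spherical polynomial from the others. -/
lemma exists_weights_eval_sphericalPoly {κ₀ : Fin m → ℕ} (h₀ : κ₀ ∈ partitions m t) :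
    ∃ u : {y : Fin m → ℝ // ∀ i, 0 ≤ y i} →₀ ℝ, ∀ κ ∈ partitions m t,
      ∑ y ∈ u.support, u y * MvPolynomial.eval y.1 (sphericalPoly κ) =
        open Classical in if κ = κ₀ then 1 else 0 := by
  classical
  let v : {y : Fin m → ℝ // ∀ i, 0 ≤ y i} → (partitions m t → ℝ) := fun y κ =>
    MvPolynomial.eval y.1 (sphericalPoly κ.1)
  have hmem : (Pi.single ⟨κ₀, h₀⟩ 1 : partitions m t → ℝ) ∈ Submodule.span ℝ (Set.range v) := by
    -- Otherwise a nonzero functional kills all evaluation vectors, which is a linear relation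
    -- between spherical polynomials on the nonnegative orthant.
    by_contra hn
    obtain ⟨f, hf0, hf⟩ := Submodule.exists_le_ker_of_notMem hn
    let c : (Fin m → ℕ) → ℝ := fun ν =>
      if h : ν ∈ partitions m t then f (Pi.single ⟨ν, h⟩ 1) else 0
    have hfc : ∀ x, f x = ∑ ν, x ν * f (Pi.single ν 1) := fun x => by
      rw [LinearMap.pi_apply_eq_sum_univ f x]
      refine Finset.sum_congr rfl fun ν _ => ?_
      rw [smul_eq_mul]
      congr 2
      funext j
      simp [Pi.single_apply, eq_comm]
    have hz : ∑ ν ∈ partitions m t, c ν • sphericalPoly ν = 0 := by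
      refine MvPolynomial.funext_set (fun _ => Set.Ici (0 : ℝ)) (fun _ => Set.Ici_infinite _)
        fun y hy => ?_
      have h1 := hf (Submodule.subset_span ⟨⟨y, fun i => hy i (Set.mem_univ i)⟩, rfl⟩)
      rw [LinearMap.mem_ker, hfc] at h1
      rw [map_zero, ← h1, map_sum, ← Finset.sum_coe_sort]
      refine Finset.sum_congr rfl fun ν _ => ?_
      simp [c, v, MvPolynomial.smul_eval, mul_comm]
    have h2 := sphericalPoly_coeff_independent (t := t) (c := c) (fun μ _ => by
      rw [hz, MvPolynomial.coeff_zero]) κ₀ h₀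
    exact hf0 (by simpa [c, h₀] using h2)
  obtain ⟨u, hu⟩ := Finsupp.mem_span_range_iff_exists_finsupp.1 hmem
  refine ⟨u, fun κ hκ => ?_⟩
  have h3 := congrFun hu ⟨κ, hκ⟩
  rw [Finsupp.sum, Finset.sum_apply] at h3
  simpa [v, Pi.single_apply] using h3

/-- The coefficients of the powers of the trace are nonnegative. -/
lemma coeff_trace_pow_nonneg {s : (Fin m → ℕ) → ℝ}
    (hs : ∑ κ ∈ partitions m t, s κ • sphericalPoly κ = (∑ i, MvPolynomial.X i) ^ t)
    {κ₀ : Fin m → ℕ} (h₀ : κ₀ ∈ partitions m t) : 0 ≤ s κ₀ := by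
  classical
  obtain ⟨u, hu⟩ := exists_weights_eval_sphericalPoly h₀
  have h1 := sum_mul_integral_trace_nonneg (t := t) u.support u
    (A := fun y => diagonal y.1) (fun y => isHermitian_diagonal y.1)
  have h2 : ∀ y z : {y : Fin m → ℝ // ∀ i, 0 ≤ y i},
      ∫ Q : orthogonalGroup (Fin m) ℝ, (diagonal y.1 * ((Q : Matrix (Fin m) (Fin m) ℝ) *
        diagonal z.1 * (Q : Matrix (Fin m) (Fin m) ℝ)ᵀ)).trace ^ t ∂haarO m =
      ∑ κ ∈ partitions m t, s κ * (MvPolynomial.eval y.1 (sphericalPoly κ) *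
        MvPolynomial.eval z.1 (sphericalPoly κ)) := by
    intro y z
    set g : Matrix (Fin m) (Fin m) ℝ := diagonal fun i => Real.sqrt (y.1 i) with hg
    have hgg : g * gᵀ = diagonal y.1 := by
      rw [hg, diagonal_transpose, diagonal_mul_diagonal]
      congr 1
      funext i
      exact Real.mul_self_sqrt (y.2 i)
    have h3 := integral_trace_pow hs le_rfl g (isHermitian_diagonal z.1)
    rw [hgg] at h3
    refine Eq.trans ?_ (h3.trans (Finset.sum_congr rfl fun κ hκ => ?_))
    · refine integral_congr_ae (Filter.Eventually.of_forall fun Q => ?_)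
      simp only
      rw [← hgg, trace_mul_comm (g * _) gᵀ, ← Matrix.mul_assoc gᵀ g, hg, diagonal_transpose]
    · rw [orbitMean_refl, eval_sphericalPoly_eq_sphericalFn (mem_partitions.1 hκ).2,
        eval_sphericalPoly_eq_sphericalFn (mem_partitions.1 hκ).2]
  -- In terms of spherical polynomials the kernel is diagonal with entries `s κ`, and the weights
  -- `u` isolate the entry at `κ₀`.
  have h4 : ∑ i ∈ u.support, ∑ j ∈ u.support, u i * u j *
      ∑ κ ∈ partitions m t, s κ * (MvPolynomial.eval i.1 (sphericalPoly κ) *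
        MvPolynomial.eval j.1 (sphericalPoly κ)) = ∑ κ ∈ partitions m t, s κ *
          ((∑ i ∈ u.support, u i * MvPolynomial.eval i.1 (sphericalPoly κ)) *
          (∑ i ∈ u.support, u i * MvPolynomial.eval i.1 (sphericalPoly κ))) := by
    simp_rw [Finset.sum_mul_sum, Finset.mul_sum]
    rw [Finset.sum_congr rfl fun i _ => Finset.sum_comm, Finset.sum_comm]
    refine Finset.sum_congr rfl fun i _ => Finset.sum_congr rfl fun j _ =>
      Finset.sum_congr rfl fun κ _ => ?_
    ring
  simp_rw [h2] at h1
  rw [h4, Finset.sum_congr rfl fun κ hκ => by rw [hu κ hκ]] at h1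
  simpa [h₀] using h1

end KummerPearson

end

/-! ### Gaussian moments and Stein's identity. -/

noncomputable section

namespace KummerPearson

open Matrix Finset MeasureTheory ProbabilityTheory

variable {m n t : ℕ}

lemma integrable_gaussianPDFReal_mul_pow (k : ℕ) :
    Integrable fun x => gaussianPDFReal 0 1 x * x ^ k := by
  have h := integrable_rpow_mul_exp_neg_mul_sq (b := 1 / 2) (by norm_num) (s := k)
    (by have : (0 : ℝ) ≤ k := Nat.cast_nonneg k
        linarith)
  have h2 := h.const_mul (Real.sqrt (2 * Real.pi * (1 : NNReal)))⁻¹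
  refine h2.congr (Filter.Eventually.of_forall fun x => ?_)
  simp only [gaussianPDFReal, Real.rpow_natCast, NNReal.coe_one]
  rw [show -(x - 0) ^ 2 / (2 * 1) = -(1 / 2) * x ^ 2 by ring]
  ring

lemma hasDerivAt_gaussianPDFReal (x : ℝ) :
    HasDerivAt (gaussianPDFReal 0 1) (-(x * gaussianPDFReal 0 1 x)) x := by
  have h1 : gaussianPDFReal 0 1 = fun x : ℝ =>
      (Real.sqrt (2 * Real.pi * (1 : NNReal)))⁻¹ * Real.exp (-(1 / 2) * x ^ 2) := by
    funext x
    simp only [gaussianPDFReal, NNReal.coe_one]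
    rw [show -(x - 0) ^ 2 / (2 * 1) = -(1 / 2) * x ^ 2 by ring]
  have h2 : HasDerivAt (fun x : ℝ => -(1 / 2) * x ^ 2) (-x) x := by
    refine ((hasDerivAt_pow 2 x).const_mul (-(1 / 2) : ℝ)).congr_deriv ?_
    norm_num
    ring
  have h3 := (h2.exp).const_mul (Real.sqrt (2 * Real.pi * (1 : NNReal)))⁻¹
  rw [h1]
  exact h3.congr_deriv (by ring)

lemma integrable_pow_gaussianReal (k : ℕ) :
    Integrable (fun x => x ^ k) (gaussianReal 0 1) := by
  have h := (memLp_id_gaussianReal (μ := 0) (v := 1) (k : NNReal)).integrable_norm_pow'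
  refine h.mono' (by fun_prop) (Filter.Eventually.of_forall fun x => ?_)
  rw [norm_pow]
  rfl

/-- Integration by parts for Gaussian moments. -/
lemma integral_pow_succ_gaussianReal (k : ℕ) :
    ∫ x, x ^ (k + 1) ∂gaussianReal 0 1 = k * ∫ x, x ^ (k - 1) ∂gaussianReal 0 1 := by
  -- For `k = 0` the truncated exponent `k - 1` is harmless, since the factor `k` is zero.
  rw [integral_gaussianReal_eq_integral_smul one_ne_zero,
    integral_gaussianReal_eq_integral_smul one_ne_zero]
  have h := integral_mul_deriv_eq_deriv_mul_of_integrable (u := fun x : ℝ => x ^ k)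
    (v := gaussianPDFReal 0 1) (u' := fun x => k * x ^ (k - 1))
    (v' := fun x => -(x * gaussianPDFReal 0 1 x)) (fun x _ => hasDerivAt_pow k x)
    (fun x _ => hasDerivAt_gaussianPDFReal x) ?_ ?_ ?_
  · have h1 : ∫ x : ℝ, gaussianPDFReal 0 1 x • x ^ (k + 1) =
        -∫ x : ℝ, x ^ k * -(x * gaussianPDFReal 0 1 x) := by
      rw [← integral_neg]
      congr 1; funext x
      rw [smul_eq_mul]; ring
    rw [h1, h, neg_neg, ← integral_const_mul]
    congr 1; funext x
    rw [smul_eq_mul]; ring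
  · refine ((integrable_gaussianPDFReal_mul_pow (k + 1)).neg).congr
      (Filter.Eventually.of_forall fun x => ?_)
    simp only [Pi.neg_apply, Pi.mul_apply]; ring
  · refine ((integrable_gaussianPDFReal_mul_pow (k - 1)).const_mul (k : ℝ)).congr
      (Filter.Eventually.of_forall fun x => ?_)
    simp only [Pi.mul_apply]; ring
  · refine (integrable_gaussianPDFReal_mul_pow k).congr
      (Filter.Eventually.of_forall fun x => ?_)
    simp only [Pi.mul_apply]; ring

/-- The standard Gaussian measure on `ℝⁿ`. -/
def gaussianRow (n : ℕ) : Measure (Fin n → ℝ) := Measure.pi fun _ => gaussianReal 0 1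

instance : IsProbabilityMeasure (gaussianRow n) :=
  inferInstanceAs (IsProbabilityMeasure (Measure.pi _))

lemma eval_monomial_eq (s : Fin n →₀ ℕ) (a : ℝ) (x : Fin n → ℝ) :
    MvPolynomial.eval x (MvPolynomial.monomial s a) = a * ∏ i, x i ^ s i := by
  rw [MvPolynomial.eval_monomial, Finsupp.prod_fintype _ _ (by simp)]

lemma integrable_prod_pow_gaussianRow (s : Fin n →₀ ℕ) :
    Integrable (fun x : Fin n → ℝ => ∏ i, x i ^ s i) (gaussianRow n) :=
  Integrable.fintype_prod (f := fun i (x : ℝ) => x ^ s i)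
    fun i => integrable_pow_gaussianReal (s i)

lemma integrable_eval_gaussianRow (P : MvPolynomial (Fin n) ℝ) :
    Integrable (fun x => MvPolynomial.eval x P) (gaussianRow n) := by
  induction P using MvPolynomial.induction_on' with
  | monomial s a =>
    simp only [eval_monomial_eq]
    exact (integrable_prod_pow_gaussianRow s).const_mul a
  | add P Q hP hQ =>
    simp only [map_add]
    exact hP.add hQ

/-- The Gaussian mean as a linear functional on polynomials. -/
def gaussianMean (n : ℕ) : MvPolynomial (Fin n) ℝ →ₗ[ℝ] ℝ where
  toFun P := ∫ x, MvPolynomial.eval x P ∂gaussianRow n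
  map_add' P Q := by
    simp only [map_add]
    exact integral_add (integrable_eval_gaussianRow P) (integrable_eval_gaussianRow Q)
  map_smul' c P := by
    simp only [MvPolynomial.smul_eval, integral_const_mul, RingHom.id_apply, smul_eq_mul]

lemma gaussianMean_monomial (s : Fin n →₀ ℕ) (a : ℝ) :
    gaussianMean n (MvPolynomial.monomial s a) =
      a * ∏ i, ∫ x, x ^ s i ∂gaussianReal 0 1 := by
  change ∫ x, MvPolynomial.eval x (MvPolynomial.monomial s a) ∂gaussianRow n = _
  simp only [eval_monomial_eq, integral_const_mul]
  rw [gaussianRow, integral_fintype_prod_eq_prod (𝕜 := ℝ) (fun i (x : ℝ) => x ^ s i)]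

/-- Stein's identity for polynomials. -/
lemma gaussianMean_X_mul (i : Fin n) (P : MvPolynomial (Fin n) ℝ) :
    gaussianMean n (MvPolynomial.X i * P) = gaussianMean n (MvPolynomial.pderiv i P) := by
  classical
  induction P using MvPolynomial.induction_on' with
  | monomial s a =>
    set p : Fin n →₀ ℕ := Finsupp.single i 1 + s with hp
    set q : Fin n →₀ ℕ := s - Finsupp.single i 1 with hq
    have hX : MvPolynomial.X i * MvPolynomial.monomial s a = MvPolynomial.monomial p a := by
      rw [MvPolynomial.X, MvPolynomial.monomial_mul, one_mul]
    rw [hX, MvPolynomial.pderiv_monomial, ← hq, gaussianMean_monomial, gaussianMean_monomial,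
      ← Finset.mul_prod_erase univ (fun j => ∫ x, x ^ p j ∂gaussianReal 0 1) (mem_univ i),
      ← Finset.mul_prod_erase univ (fun j => ∫ x, x ^ q j ∂gaussianReal 0 1) (mem_univ i)]
    have h1 : ∏ j ∈ univ.erase i, ∫ x, x ^ p j ∂gaussianReal 0 1 =
        ∏ j ∈ univ.erase i, ∫ x, x ^ q j ∂gaussianReal 0 1 := by
      refine Finset.prod_congr rfl fun j hj => ?_
      have hij : i ≠ j := (Finset.ne_of_mem_erase hj).symm
      simp [hp, hq, Finsupp.single_eq_of_ne' hij]
    have h2 : p i = s i + 1 := by simp [hp, add_comm]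
    have h3 : q i = s i - 1 := by simp [hq]
    rw [h1, h2, h3, integral_pow_succ_gaussianReal]
    ring
  | add P Q hP hQ => simp only [mul_add, map_add, hP, hQ]

/-- The linear form with coefficients in the `i`-th row of `R`. -/
def rowForm (R : Matrix (Fin n) (Fin n) ℝ) (i : Fin n) : MvPolynomial (Fin n) ℝ :=
  ∑ j, MvPolynomial.C (R i j) * MvPolynomial.X j

/-- The quadratic form of `R`. -/
def quadForm (R : Matrix (Fin n) (Fin n) ℝ) : MvPolynomial (Fin n) ℝ :=
  ∑ i, MvPolynomial.X i * rowForm R i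

lemma eval_rowForm (R : Matrix (Fin n) (Fin n) ℝ) (i : Fin n) (x : Fin n → ℝ) :
    MvPolynomial.eval x (rowForm R i) = (R *ᵥ x) i := by
  simp [rowForm, mulVec, dotProduct]

lemma eval_quadForm (R : Matrix (Fin n) (Fin n) ℝ) (x : Fin n → ℝ) :
    MvPolynomial.eval x (quadForm R) = x ⬝ᵥ R *ᵥ x := by
  simp [quadForm, eval_rowForm, dotProduct]

lemma pderiv_rowForm (R : Matrix (Fin n) (Fin n) ℝ) (i k : Fin n) :
    MvPolynomial.pderiv k (rowForm R i) = MvPolynomial.C (R i k) := by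
  classical
  simp [rowForm, MvPolynomial.pderiv_X, Pi.single_apply]

lemma pderiv_quadForm {R : Matrix (Fin n) (Fin n) ℝ} (hR : Rᵀ = R) (k : Fin n) :
    MvPolynomial.pderiv k (quadForm R) = 2 * rowForm R k := by
  classical
  have h1 : ∑ i, MvPolynomial.X i * MvPolynomial.C (R i k) = rowForm R k := by
    refine Finset.sum_congr rfl fun i _ => ?_
    rw [mul_comm]
    conv_lhs => rw [← hR, transpose_apply]
  simp only [quadForm, map_sum, Derivation.leibniz, pderiv_rowForm, smul_eq_mul,
    Finset.sum_add_distrib, h1, MvPolynomial.pderiv_X, Pi.single_apply, mul_ite, mul_one, mul_zero,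
    Finset.sum_ite_eq', mem_univ, if_true]
  ring

lemma dotProduct_mulVec_eq {R : Matrix (Fin n) (Fin n) ℝ} (hR : Rᵀ = R) (hR2 : R * R = R)
    (x : Fin n → ℝ) : x ⬝ᵥ R *ᵥ x = (R *ᵥ x) ⬝ᵥ (R *ᵥ x) := by
  rw [dotProduct_mulVec (R *ᵥ x), vecMul_mulVec, hR, hR2, dotProduct_mulVec]

lemma sum_rowForm_mul_rowForm {R : Matrix (Fin n) (Fin n) ℝ} (hR : Rᵀ = R) (hR2 : R * R = R) :
    ∑ i, rowForm R i * rowForm R i = quadForm R := by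
  refine MvPolynomial.funext fun x => ?_
  rw [eval_quadForm]
  simp only [map_sum, map_mul, eval_rowForm]
  exact (dotProduct_mulVec_eq hR hR2 x).symm

/-- The moments of the quadratic form of a projection. -/
lemma gaussianMean_quadForm_pow {R : Matrix (Fin n) (Fin n) ℝ} (hR : Rᵀ = R) (hR2 : R * R = R)
    (k : ℕ) : gaussianMean n (quadForm R ^ k) = ∏ j ∈ range k, (R.trace + 2 * j) := by
  induction k with
  | zero =>
    rw [pow_zero, range_zero, prod_empty]
    change ∫ x, MvPolynomial.eval x 1 ∂gaussianRow n = 1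
    simp
  | succ k ih =>
    rw [prod_range_succ, ← ih, pow_succ']
    have h0 : quadForm R * quadForm R ^ k =
        ∑ i, MvPolynomial.X i * (rowForm R i * quadForm R ^ k) := by
      simp only [← mul_assoc, ← Finset.sum_mul]
      rfl
    rw [h0, map_sum, Finset.sum_congr rfl fun i _ => gaussianMean_X_mul i _, ← map_sum]
    -- Differentiating the linear forms gives the trace; differentiating the power gives 2k |Rx|²
    -- times a lower power, and |Rx|² is the quadratic form again because `R` is a projection.
    have h : ∑ i, MvPolynomial.pderiv i (rowForm R i * quadForm R ^ k) =
        (R.trace + 2 * k) • quadForm R ^ k := by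
      have h1 : ∀ i, MvPolynomial.pderiv i (rowForm R i * quadForm R ^ k) =
          MvPolynomial.C (R i i) * quadForm R ^ k +
          2 * (k : MvPolynomial (Fin n) ℝ) * quadForm R ^ (k - 1) *
            (rowForm R i * rowForm R i) := fun i => by
        rw [Derivation.leibniz, Derivation.leibniz_pow, pderiv_rowForm, pderiv_quadForm hR]
        simp only [smul_eq_mul, nsmul_eq_mul]
        ring
      simp_rw [h1]
      rw [Finset.sum_add_distrib, ← Finset.sum_mul, ← Finset.mul_sum,
        sum_rowForm_mul_rowForm hR hR2, ← map_sum, MvPolynomial.smul_eq_C_mul, map_add, map_mul,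
        map_natCast, add_mul]
      congr 1
      rcases k with _ | k
      · simp
      · rw [Nat.add_sub_cancel, pow_succ, show (MvPolynomial.C (2 : ℝ) :
          MvPolynomial (Fin n) ℝ) = 2 from map_ofNat _ 2]
        ring
    rw [h, map_smul, smul_eq_mul, mul_comm]

lemma dotProduct_mulVec_nonneg {R : Matrix (Fin n) (Fin n) ℝ} (hR : Rᵀ = R) (hR2 : R * R = R)
    (x : Fin n → ℝ) : 0 ≤ x ⬝ᵥ R *ᵥ x := by
  rw [dotProduct_mulVec_eq hR hR2]
  exact Finset.sum_nonneg fun i _ => mul_self_nonneg _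

lemma lintegral_quadForm_pow {R : Matrix (Fin n) (Fin n) ℝ} (hR : Rᵀ = R) (hR2 : R * R = R)
    (k : ℕ) : ∫⁻ x, ENNReal.ofReal ((x ⬝ᵥ R *ᵥ x) ^ k) ∂gaussianRow n =
      ENNReal.ofReal (∏ j ∈ range k, (R.trace + 2 * j)) := by
  rw [← gaussianMean_quadForm_pow hR hR2]
  change _ = ENNReal.ofReal (∫ x, MvPolynomial.eval x (quadForm R ^ k) ∂gaussianRow n)
  rw [ofReal_integral_eq_lintegral_ofReal (integrable_eval_gaussianRow _)]
  · simp only [map_pow, eval_quadForm]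
  · refine Filter.Eventually.of_forall fun x => ?_
    simp only [map_pow, eval_quadForm]
    exact pow_nonneg (dotProduct_mulVec_nonneg hR hR2 x) k

end KummerPearson

end

/-! ### Gaussian Gram determinants, one row at a time. -/

noncomputable section

namespace KummerPearson

open Matrix Finset MeasureTheory ProbabilityTheory

variable {m n t : ℕ}

/-- The matrix `A` with the row `x` appended. -/
def appendRow (A : Matrix (Fin m) (Fin n) ℝ) (x : Fin n → ℝ) :
    Matrix (Fin (m + 1)) (Fin n) ℝ :=
  of fun i j => Fin.snoc (α := fun _ => ℝ) (fun i => A i j) (x j) i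

lemma appendRow_submatrix (A : Matrix (Fin m) (Fin n) ℝ) (x : Fin n → ℝ) :
    (appendRow A x).submatrix finSumFinEquiv id = fromRows A (of fun _ : Fin 1 => x) := by
  ext i j
  rcases i with i | i
  · have : finSumFinEquiv (Sum.inl i : Fin m ⊕ Fin 1) = Fin.castSucc i := rfl
    simp [appendRow, this]
  · have : finSumFinEquiv (Sum.inr i : Fin m ⊕ Fin 1) = Fin.last m := by
      ext; simp
    simp [appendRow, this]

/-- The Schur complement isolates the new row, which then enters only through a quadratic form. -/
lemma det_appendRow {R : Matrix (Fin n) (Fin n) ℝ}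
    (A : Matrix (Fin m) (Fin n) ℝ) (x : Fin n → ℝ) (hA : (A * R * Aᵀ).det ≠ 0) :
    (appendRow A x * R * (appendRow A x)ᵀ).det = (A * R * Aᵀ).det *
      (x ⬝ᵥ (R - R * Aᵀ * (A * R * Aᵀ)⁻¹ * (A * R)) *ᵥ x) := by
  set X : Matrix (Fin 1) (Fin n) ℝ := of fun _ => x with hX
  have h1 : (appendRow A x * R * (appendRow A x)ᵀ).submatrix finSumFinEquiv finSumFinEquiv =
      fromBlocks (A * R * Aᵀ) (A * R * Xᵀ) (X * R * Aᵀ) (X * R * Xᵀ) := by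
    rw [show (appendRow A x * R * (appendRow A x)ᵀ).submatrix finSumFinEquiv finSumFinEquiv =
      (appendRow A x).submatrix finSumFinEquiv id * R *
        ((appendRow A x).submatrix finSumFinEquiv id)ᵀ from rfl, appendRow_submatrix,
      fromRows_mul, transpose_fromRows, fromRows_mul_fromCols]
  have : Invertible (A * R * Aᵀ) := invertibleOfIsUnitDet _ (isUnit_iff_ne_zero.2 hA)
  rw [← det_submatrix_equiv_self finSumFinEquiv, h1, det_fromBlocks₁₁, invOf_eq_nonsing_inv]
  congr 1
  have h2 : X * R * Xᵀ - X * R * Aᵀ * (A * R * Aᵀ)⁻¹ * (A * R * Xᵀ) =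
      X * (R - R * Aᵀ * (A * R * Aᵀ)⁻¹ * (A * R)) * Xᵀ := by
    simp only [Matrix.mul_sub, Matrix.sub_mul, Matrix.mul_assoc]
  rw [h2, det_unique, mul_apply, dotProduct_mulVec, dotProduct]
  rfl

/-- A null vector v of the Gram matrix satisfies |v A R|² = 0, so v extended by zero is still a null
vector. -/
lemma det_appendRow_eq_zero {R : Matrix (Fin n) (Fin n) ℝ} (hR : Rᵀ = R) (hR2 : R * R = R)
    (A : Matrix (Fin m) (Fin n) ℝ) (x : Fin n → ℝ) (hA : (A * R * Aᵀ).det = 0) :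
    (appendRow A x * R * (appendRow A x)ᵀ).det = 0 := by
  obtain ⟨v, hv, hv0⟩ := exists_vecMul_eq_zero_iff.2 hA
  have h1 : v ᵥ* (A * R) = 0 := by
    have h2 : (v ᵥ* (A * R)) ⬝ᵥ (v ᵥ* (A * R)) = 0 := by
      have h3 : (A * R) * (A * R)ᵀ = A * R * Aᵀ := by
        rw [transpose_mul, hR, Matrix.mul_assoc, ← Matrix.mul_assoc R R, hR2, Matrix.mul_assoc]
      rw [← mulVec_transpose (A * R) v, dotProduct_mulVec, mulVec_transpose, vecMul_vecMul, h3,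
        hv0, zero_dotProduct]
    exact dotProduct_self_eq_zero.1 h2
  refine exists_vecMul_eq_zero_iff.1 ⟨Fin.snoc (α := fun _ => ℝ) v 0, ?_, ?_⟩
  · intro h0
    apply hv
    funext i
    have := congrFun h0 (Fin.castSucc i)
    simpa using this
  · have h4 : Fin.snoc (α := fun _ => ℝ) v 0 ᵥ* appendRow A x = v ᵥ* A := by
      funext j
      simp [vecMul, dotProduct, Fin.sum_univ_castSucc, appendRow]
    rw [← vecMul_vecMul, ← vecMul_vecMul, h4, vecMul_vecMul v A R, h1, zero_vecMul]

/-- The subtracted matrix projects onto the row space of A R, which lies in the range of R and has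
dimension m. -/
lemma projection_sub {R : Matrix (Fin n) (Fin n) ℝ} (hR : Rᵀ = R) (hR2 : R * R = R)
    (A : Matrix (Fin m) (Fin n) ℝ) (hA : (A * R * Aᵀ).det ≠ 0) :
    let P := R - R * Aᵀ * (A * R * Aᵀ)⁻¹ * (A * R)
    Pᵀ = P ∧ P * P = P ∧ P.trace = R.trace - m := by
  intro P
  set B := A * R with hB
  set W := (A * R * Aᵀ)⁻¹ with hW
  have hBt : R * Aᵀ = Bᵀ := by rw [hB, transpose_mul, hR]
  have hBB : B * Bᵀ = A * R * Aᵀ := by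
    rw [← hBt, hB, Matrix.mul_assoc, ← Matrix.mul_assoc R R, hR2, Matrix.mul_assoc]
  have hWB : W * (B * Bᵀ) = 1 := by
    rw [hBB]
    exact nonsing_inv_mul _ (isUnit_iff_ne_zero.2 hA)
  have hWt : Wᵀ = W := by
    rw [hW, transpose_nonsing_inv, ← hBB, transpose_mul, transpose_transpose]
  have hBR : B * R = B := by rw [hB, Matrix.mul_assoc, hR2]
  have hRB : R * Bᵀ = Bᵀ := by
    rw [← hBt, ← Matrix.mul_assoc, hR2]
  have hP : P = R - Bᵀ * W * B := by rw [← hBt]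
  have hE : (Bᵀ * W * B) * (Bᵀ * W * B) = Bᵀ * W * B := by
    calc (Bᵀ * W * B) * (Bᵀ * W * B) = Bᵀ * (W * (B * Bᵀ)) * W * B := by
          simp only [Matrix.mul_assoc]
      _ = _ := by rw [hWB, Matrix.mul_one]
  have hRE : R * (Bᵀ * W * B) = Bᵀ * W * B := by
    rw [← Matrix.mul_assoc R (Bᵀ * W) B, ← Matrix.mul_assoc R Bᵀ W, hRB]
  have hER : Bᵀ * W * B * R = Bᵀ * W * B := by rw [Matrix.mul_assoc, hBR]
  refine ⟨?_, ?_, ?_⟩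
  · rw [hP, transpose_sub, hR]
    simp only [transpose_mul, transpose_transpose, hWt, Matrix.mul_assoc]
  · rw [hP, Matrix.sub_mul, Matrix.mul_sub, Matrix.mul_sub, hR2, hRE, hER, hE]
    simp
  · rw [hP, trace_sub, Matrix.mul_assoc, trace_mul_comm, Matrix.mul_assoc, hWB, trace_one,
      Fintype.card_fin]

/-- The Gaussian mean over the last row of a power of the Gram determinant. -/
lemma lintegral_det_appendRow_pow {R : Matrix (Fin n) (Fin n) ℝ} (hR : Rᵀ = R)
    (hR2 : R * R = R) (A : Matrix (Fin m) (Fin n) ℝ) (hA0 : 0 ≤ (A * R * Aᵀ).det) (k : ℕ) :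
    ∫⁻ x, ENNReal.ofReal ((appendRow A x * R * (appendRow A x)ᵀ).det ^ k) ∂gaussianRow n =
      ENNReal.ofReal ((A * R * Aᵀ).det ^ k) *
        ENNReal.ofReal (∏ j ∈ range k, (R.trace - m + 2 * j)) := by
  by_cases hA : (A * R * Aᵀ).det = 0
  · simp_rw [det_appendRow_eq_zero hR hR2 A _ hA, hA]
    rcases k with _ | k
    · simp
    · simp
  · obtain ⟨h1, h2, h3⟩ := projection_sub hR hR2 A hA
    simp_rw [det_appendRow A _ hA, mul_pow, ENNReal.ofReal_mul (pow_nonneg hA0 k)]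
    rw [lintegral_const_mul', lintegral_quadForm_pow h1 h2, h3]
    exact ENNReal.ofReal_ne_top

/-- A product of powers of leading minors with the determinant carrying a free exponent. -/
def minorPower (e : ℕ → ℕ) (S : Matrix (Fin m) (Fin m) ℝ) : ℝ :=
  (∏ i : Fin m, leadMinor S i ^ (e i - e (i + 1))) * S.det ^ e m

lemma powerFn_eq_minorPower (κ : Fin m → ℕ) (S : Matrix (Fin m) (Fin m) ℝ) :
    powerFn κ S = minorPower (extendZero κ) S := by
  rw [minorPower, show extendZero κ m = 0 by simp [extendZero], pow_zero, mul_one]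
  rfl

lemma leadMinor_nonneg {S : Matrix (Fin m) (Fin m) ℝ} (hS : S.PosSemidef) (i : Fin m) :
    0 ≤ leadMinor S i := (hS.submatrix _).det_nonneg

/-- The smaller minors do not see the new row, and the two exponents of the full determinant combine
to `e m`; this is what keeps the induction on rows going. -/
lemma minorPower_appendRow {e : ℕ → ℕ} (he : Antitone e) (R : Matrix (Fin n) (Fin n) ℝ)
    (A : Matrix (Fin m) (Fin n) ℝ) (x : Fin n → ℝ) :
    minorPower e (appendRow A x * R * (appendRow A x)ᵀ) =
      (∏ i : Fin m, leadMinor (A * R * Aᵀ) i ^ (e i - e (i + 1))) *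
        (appendRow A x * R * (appendRow A x)ᵀ).det ^ e m := by
  have h1 : ∀ i : Fin m, leadMinor (appendRow A x * R * (appendRow A x)ᵀ) i.castSucc =
      leadMinor (A * R * Aᵀ) i := fun i => by
    have h2 : (appendRow A x).submatrix Fin.castSucc id = A := by
      ext i j; simp [appendRow]
    have h3 : A * R * Aᵀ = (appendRow A x * R * (appendRow A x)ᵀ).submatrix
        Fin.castSucc Fin.castSucc := by
      conv_lhs => rw [← h2]
      rfl
    rw [h3]; rfl
  have h4 : leadMinor (appendRow A x * R * (appendRow A x)ᵀ) (Fin.last m) =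
      (appendRow A x * R * (appendRow A x)ᵀ).det := rfl
  rw [minorPower, Fin.prod_univ_castSucc, h4, mul_assoc, ← pow_add]
  simp only [h1, Fin.val_castSucc, Fin.val_last]
  rw [Nat.sub_add_cancel (he (Nat.le_succ m))]

lemma posSemidef_conj_projection {R : Matrix (Fin n) (Fin n) ℝ} (hR : Rᵀ = R) (hR2 : R * R = R)
    (A : Matrix (Fin m) (Fin n) ℝ) : (A * R * Aᵀ).PosSemidef := by
  have h := posSemidef_self_mul_conjTranspose (A * R)
  rwa [conjTranspose_eq_transpose_of_trivial, transpose_mul, hR, Matrix.mul_assoc,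
    ← Matrix.mul_assoc R R, hR2, ← Matrix.mul_assoc] at h

/-- The standard Gaussian measure on `m × n` matrices, given by their rows. -/
def gaussianRows (m n : ℕ) : Measure (Fin m → Fin n → ℝ) := Measure.pi fun _ => gaussianRow n

instance : IsProbabilityMeasure (gaussianRows m n) :=
  inferInstanceAs (IsProbabilityMeasure (Measure.pi _))

lemma continuous_minorPower (e : ℕ → ℕ) {α : Type*} [TopologicalSpace α]
    {S : α → Matrix (Fin m) (Fin m) ℝ} (hS : Continuous S) :
    Continuous fun x => minorPower e (S x) :=
  (continuous_finsetProd _ fun i _ => (continuous_leadMinor hS i).pow _).mul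
    (hS.matrix_det.pow _)

lemma continuous_of_conj (R : Matrix (Fin n) (Fin n) ℝ) :
    Continuous fun G : Fin m → Fin n → ℝ => of G * R * (of G)ᵀ :=
  Continuous.matrix_mul (Continuous.matrix_mul continuous_id continuous_const)
    (Continuous.matrix_transpose continuous_id)

/-- Gaussian means of products of leading minors of a Gram matrix for a projection. -/
lemma lintegral_minorPower {R : Matrix (Fin n) (Fin n) ℝ} (hR : Rᵀ = R)
    (hR2 : R * R = R) {e : ℕ → ℕ} (he : Antitone e) (hm : (m : ℝ) ≤ R.trace) :
    ∫⁻ G : Fin m → Fin n → ℝ, ENNReal.ofReal (minorPower e (of G * R * (of G)ᵀ))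
      ∂gaussianRows m n =
      ENNReal.ofReal (∏ i ∈ range m, ∏ j ∈ range (e i), (R.trace - i + 2 * j)) := by
  induction m with
  | zero => simp [minorPower]
  | succ m ih =>
    have hm' : (m : ℝ) ≤ R.trace := by push_cast at hm; linarith
    -- The last row is integrated first: conditionally on the others it contributes the moment of a
    -- projection of trace `R.trace - m`.
    have hmp := (measurePreserving_piFinSuccAbove (fun _ : Fin (m + 1) => gaussianRow n)
      (Fin.last m)).symm
    rw [gaussianRows, ← hmp.lintegral_comp_emb (MeasurableEquiv.measurableEmbedding _)]
    have hmeas : Measurable fun z : (Fin n → ℝ) × (Fin m → Fin n → ℝ) =>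
        ENNReal.ofReal (minorPower e (of ((MeasurableEquiv.piFinSuccAbove
          (fun _ => Fin n → ℝ) (Fin.last m)).symm z) * R *
          (of ((MeasurableEquiv.piFinSuccAbove (fun _ => Fin n → ℝ) (Fin.last m)).symm z))ᵀ)) :=
      ((continuous_minorPower e (continuous_of_conj R)).measurable.comp
        (MeasurableEquiv.measurable _)).ennreal_ofReal
    rw [lintegral_prod_symm _ hmeas.aemeasurable]
    have h1 : ∀ (A : Fin m → Fin n → ℝ) (x : Fin n → ℝ),
        of ((MeasurableEquiv.piFinSuccAbove (fun _ => Fin n → ℝ) (Fin.last m)).symm (x, A)) =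
          appendRow (of A) x := fun A x => by
      ext i j
      refine Fin.lastCases ?_ (fun i => ?_) i
      · simp [MeasurableEquiv.piFinSuccAbove, appendRow]
      · simp [MeasurableEquiv.piFinSuccAbove, appendRow]
    have hpsd := fun A : Fin m → Fin n → ℝ => posSemidef_conj_projection hR hR2 (of A)
    have h2 : ∀ A : Fin m → Fin n → ℝ, 0 ≤
        ∏ i : Fin m, leadMinor (of A * R * (of A)ᵀ) i ^ (e i - e (i + 1)) := fun A =>
      Finset.prod_nonneg fun i _ => pow_nonneg (leadMinor_nonneg (hpsd A) i) _
    have h3 : ∀ A : Fin m → Fin n → ℝ, ∫⁻ x, ENNReal.ofReal (minorPower e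
        (appendRow (of A) x * R * (appendRow (of A) x)ᵀ)) ∂gaussianRow n =
        ENNReal.ofReal (minorPower e (of A * R * (of A)ᵀ)) *
          ENNReal.ofReal (∏ j ∈ range (e m), (R.trace - m + 2 * j)) := fun A => by
      simp_rw [minorPower_appendRow he, ENNReal.ofReal_mul (h2 A)]
      rw [lintegral_const_mul' _ _ ENNReal.ofReal_ne_top,
        lintegral_det_appendRow_pow hR hR2 (of A) (hpsd A).det_nonneg, minorPower,
        ENNReal.ofReal_mul (h2 A), mul_assoc]
    simp_rw [h1, h3]
    rw [lintegral_mul_const' _ _ ENNReal.ofReal_ne_top, prod_range_succ, ENNReal.ofReal_mul]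
    · congr 1
      exact ih hm'
    · refine Finset.prod_nonneg fun i hi => Finset.prod_nonneg fun j _ => ?_
      have : (i : ℝ) ≤ m := by exact_mod_cast (Finset.mem_range.1 hi).le
      have : (0 : ℝ) ≤ j := Nat.cast_nonneg j
      linarith

end KummerPearson

end

/-! ### Means over Grassmannians and Kummer's relation at half integers. -/

noncomputable section

namespace KummerPearson

open Matrix Finset MeasureTheory ProbabilityTheory

variable {m n t : ℕ}

/-- The Gaussian mean of the power function of a Gram matrix for a projection of rank `r`. -/
def wishartMoment (κ : Fin m → ℕ) (r : ℝ) : ℝ :=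
  ∏ i : Fin m, ∏ j ∈ range (κ i), (r - (i : ℕ) + 2 * j)

lemma wishartMoment_pos (κ : Fin m → ℕ) {r : ℝ} (hr : (m : ℝ) ≤ r) : 0 < wishartMoment κ r := by
  refine Finset.prod_pos fun i _ => Finset.prod_pos fun j _ => ?_
  have h1 : ((i : ℕ) : ℝ) < m := by exact_mod_cast i.isLt
  have h2 : (0 : ℝ) ≤ j := Nat.cast_nonneg j
  linarith

lemma lintegral_powerFn_gaussianRows {R : Matrix (Fin n) (Fin n) ℝ} (hR : Rᵀ = R)
    (hR2 : R * R = R) {κ : Fin m → ℕ} (hκ : Antitone κ) (hm : (m : ℝ) ≤ R.trace) :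
    ∫⁻ G : Fin m → Fin n → ℝ, ENNReal.ofReal (powerFn κ (of G * R * (of G)ᵀ))
      ∂gaussianRows m n = ENNReal.ofReal (wishartMoment κ R.trace) := by
  simp_rw [powerFn_eq_minorPower]
  rw [lintegral_minorPower hR hR2 (extendZero_antitone hκ) hm, wishartMoment,
    ← Fin.prod_univ_eq_prod_range
      (fun i => ∏ j ∈ range (extendZero κ i), (R.trace - (i : ℝ) + 2 * j)) m]
  simp only [extendZero_val]

lemma projection_conj {Λ : Matrix (Fin n) (Fin n) ℝ} (hΛ : Λᵀ = Λ) (hΛ2 : Λ * Λ = Λ)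
    (Q : orthogonalGroup (Fin n) ℝ) :
    let R := (Q : Matrix (Fin n) (Fin n) ℝ) * Λ * (Q : Matrix (Fin n) (Fin n) ℝ)ᵀ
    Rᵀ = R ∧ R * R = R ∧ R.trace = Λ.trace := by
  have h : ∀ Z : Matrix (Fin n) (Fin n) ℝ, (Q : Matrix (Fin n) (Fin n) ℝ)ᵀ *
      ((Q : Matrix (Fin n) (Fin n) ℝ) * Z) = Z := fun Z => by
    rw [← Matrix.mul_assoc, coe_transpose_mul, Matrix.one_mul]
  have h' : ∀ Z : Matrix (Fin n) (Fin n) ℝ, Λ * (Λ * Z) = Λ * Z := fun Z => by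
    rw [← Matrix.mul_assoc, hΛ2]
  refine ⟨?_, ?_, ?_⟩
  · simp only [transpose_mul, transpose_transpose, hΛ, Matrix.mul_assoc]
  · simp only [Matrix.mul_assoc, h, h']
  · rw [trace_mul_comm, h]

lemma posSemidef_projection {Λ : Matrix (Fin n) (Fin n) ℝ} (hΛ : Λᵀ = Λ) (hΛ2 : Λ * Λ = Λ) :
    Λ.PosSemidef := by
  simpa using posSemidef_conj_projection hΛ hΛ2 (1 : Matrix (Fin n) (Fin n) ℝ)

lemma lintegral_powerFn_conj (h : m ≤ n) {Λ : Matrix (Fin n) (Fin n) ℝ} (hΛ : Λᵀ = Λ)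
    (hΛ2 : Λ * Λ = Λ) (κ : Fin m → ℕ) (g : Matrix (Fin m) (Fin n) ℝ) :
    ∫⁻ Q : orthogonalGroup (Fin n) ℝ,
      ENNReal.ofReal (powerFn κ (g * ((Q : Matrix (Fin n) (Fin n) ℝ) * Λ *
        (Q : Matrix (Fin n) (Fin n) ℝ)ᵀ) * gᵀ)) ∂haarO n =
      ENNReal.ofReal (powerFn κ (g * (1 : Matrix (Fin n) (Fin n) ℝ) * gᵀ)) *
        ENNReal.ofReal (orbitMean h κ Λ) := by
  rw [Matrix.mul_one, ← ENNReal.ofReal_mul, ← integral_powerFn_conj h κ g Λ,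
    ofReal_integral_eq_lintegral_ofReal]
  · exact integrable_haarO (continuous_powerFn κ ((continuous_const.matrix_mul
      (continuous_orthogonal_conj Λ)).matrix_mul continuous_const))
  · refine Filter.Eventually.of_forall fun Q => powerFn_nonneg κ ?_
    obtain ⟨e1, e2, -⟩ := projection_conj hΛ hΛ2 Q
    exact posSemidef_conj_projection e1 e2 _
  · refine powerFn_nonneg κ ?_
    simpa using posSemidef_self_mul_conjTranspose g

/-- The mean of the power function over a Grassmannian. -/
lemma orbitMean_projection (h : m ≤ n) {Λ : Matrix (Fin n) (Fin n) ℝ} (hΛ : Λᵀ = Λ)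
    (hΛ2 : Λ * Λ = Λ) {κ : Fin m → ℕ} (hκ : Antitone κ) (hm : (m : ℝ) ≤ Λ.trace) :
    orbitMean h κ Λ = wishartMoment κ Λ.trace / wishartMoment κ n := by
  have hn : (m : ℝ) ≤ n := by exact_mod_cast h
  have hnonneg : 0 ≤ orbitMean h κ Λ := by
    refine integral_nonneg fun Q => powerFn_nonneg κ ?_
    exact posSemidef_conj_projection hΛ hΛ2 _
  -- A double mean over Haar `Q` and Gaussian `G`. Integrating `G` first gives a constant depending
  -- only on the trace; integrating `Q` first gives the orbit mean times the Gaussian moment of the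
  -- full Gram matrix.
  have h1 : ∫⁻ Q : orthogonalGroup (Fin n) ℝ, ∫⁻ G : Fin m → Fin n → ℝ,
      ENNReal.ofReal (powerFn κ (of G * ((Q : Matrix (Fin n) (Fin n) ℝ) * Λ *
        (Q : Matrix (Fin n) (Fin n) ℝ)ᵀ) * (of G)ᵀ)) ∂gaussianRows m n ∂haarO n =
      ENNReal.ofReal (wishartMoment κ Λ.trace) := by
    have h2 : ∀ Q : orthogonalGroup (Fin n) ℝ, ∫⁻ G : Fin m → Fin n → ℝ,
      ENNReal.ofReal (powerFn κ (of G * ((Q : Matrix (Fin n) (Fin n) ℝ) * Λ *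
        (Q : Matrix (Fin n) (Fin n) ℝ)ᵀ) * (of G)ᵀ)) ∂gaussianRows m n =
        ENNReal.ofReal (wishartMoment κ Λ.trace) := fun Q => by
      obtain ⟨e1, e2, e3⟩ := projection_conj hΛ hΛ2 Q
      rw [lintegral_powerFn_gaussianRows e1 e2 hκ (e3 ▸ hm), e3]
    simp_rw [h2]
    simp
  have hcont : Continuous (Function.uncurry fun (Q : orthogonalGroup (Fin n) ℝ)
      (G : Fin m → Fin n → ℝ) => powerFn κ (of G * ((Q : Matrix (Fin n) (Fin n) ℝ) * Λ *
        (Q : Matrix (Fin n) (Fin n) ℝ)ᵀ) * (of G)ᵀ)) := by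
    refine continuous_powerFn κ ?_
    have hG : Continuous fun z : orthogonalGroup (Fin n) ℝ × (Fin m → Fin n → ℝ) =>
        (of z.2 : Matrix (Fin m) (Fin n) ℝ) := continuous_snd
    exact (hG.matrix_mul ((continuous_orthogonal_conj Λ).comp continuous_fst)).matrix_mul
      hG.matrix_transpose
  rw [lintegral_lintegral_swap hcont.measurable.ennreal_ofReal.aemeasurable] at h1
  simp_rw [lintegral_powerFn_conj h hΛ hΛ2 κ] at h1
  rw [lintegral_mul_const' _ _ ENNReal.ofReal_ne_top,
    lintegral_powerFn_gaussianRows transpose_one (Matrix.mul_one 1) hκ (by simpa using hn),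
    trace_one, Fintype.card_fin, ← ENNReal.ofReal_mul (wishartMoment_pos κ hn).le,
    ENNReal.ofReal_eq_ofReal_iff (mul_nonneg (wishartMoment_pos κ hn).le hnonneg)
      (wishartMoment_pos κ hm).le] at h1
  rw [eq_div_iff (wishartMoment_pos κ hn).ne', mul_comm, h1]

lemma exists_mul_transpose_eq (h : m ≤ n) {X : Matrix (Fin m) (Fin m) ℝ} (hX : X.PosSemidef) :
    ∃ g : Matrix (Fin m) (Fin n) ℝ, g * gᵀ = X := by
  obtain ⟨B, hB⟩ : ∃ B : Matrix (Fin m) (Fin m) ℝ, B * Bᵀ = X := by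
    obtain ⟨U, hU⟩ := exists_orthogonal_diagonalization hX.isHermitian
    refine ⟨(U : Matrix (Fin m) (Fin m) ℝ) *
      diagonal fun i => Real.sqrt (hX.isHermitian.eigenvalues i), ?_⟩
    conv_rhs => rw [hU]
    rw [transpose_mul, diagonal_transpose, Matrix.mul_assoc, ← Matrix.mul_assoc (diagonal _),
      diagonal_mul_diagonal, Matrix.mul_assoc]
    simp only [Real.mul_self_sqrt (hX.eigenvalues_nonneg _)]
  refine ⟨B * topRows h (1 : orthogonalGroup (Fin n) ℝ), ?_⟩
  rw [transpose_mul, Matrix.mul_assoc, ← Matrix.mul_assoc (topRows h _), topRows_mul_transpose,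
    Matrix.one_mul, hB]

/-- Kummer's relation at half integers. -/
lemma sum_wishartMoment_eq {s : (Fin m → ℕ) → ℝ}
    (hs : ∀ t, ∑ κ ∈ partitions m t, s κ • sphericalPoly κ = (∑ i, MvPolynomial.X i) ^ t)
    {X : Matrix (Fin m) (Fin m) ℝ} (hX : X.PosSemidef) {p q : ℕ} (hp : m ≤ p) (hq : m ≤ q)
    (t : ℕ) :
    ∑ κ ∈ partitions m t, s κ * sphericalFn κ X *
      (wishartMoment κ p / wishartMoment κ (p + q)) =
    ∑ k ∈ range (t + 1), (t.choose k : ℝ) * X.trace ^ (t - k) * (-1) ^ k *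
      ∑ κ ∈ partitions m k, s κ * sphericalFn κ X *
        (wishartMoment κ q / wishartMoment κ (p + q)) := by
  have hn : m ≤ p + q := by omega
  obtain ⟨g, hg⟩ := exists_mul_transpose_eq hn hX
  set Λ : Matrix (Fin (p + q)) (Fin (p + q)) ℝ :=
    diagonal fun i => if (i : ℕ) < p then 1 else 0 with hΛdef
  have hΛ : Λᵀ = Λ := diagonal_transpose _
  have hΛ2 : Λ * Λ = Λ := by
    rw [hΛdef, diagonal_mul_diagonal]
    congr 1; funext i
    split_ifs <;> simp
  have htr : Λ.trace = p := by
    rw [hΛdef, trace_diagonal, Fin.sum_univ_add]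
    simp
  have hΓ : (1 - Λ)ᵀ = 1 - Λ := by rw [transpose_sub, transpose_one, hΛ]
  have hΓ2 : (1 - Λ) * (1 - Λ) = 1 - Λ := by
    rw [Matrix.sub_mul, Matrix.mul_sub, Matrix.mul_sub, hΛ2]
    simp
  have htrΓ : (1 - Λ).trace = q := by
    rw [trace_sub, htr, trace_one, Fintype.card_fin]
    push_cast; ring
  have hval : ∀ {Z : Matrix (Fin (p + q)) (Fin (p + q)) ℝ} {r : ℕ} (_ : Zᵀ = Z) (_ : Z * Z = Z)
      (_ : Z.trace = r) (_ : m ≤ r) (k : ℕ),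
      ∫ Q : orthogonalGroup (Fin (p + q)) ℝ,
        (g * ((Q : Matrix (Fin (p + q)) (Fin (p + q)) ℝ) * Z *
        (Q : Matrix (Fin (p + q)) (Fin (p + q)) ℝ)ᵀ) * gᵀ).trace ^ k ∂haarO (p + q) =
      ∑ κ ∈ partitions m k, s κ * sphericalFn κ X *
        (wishartMoment κ r / wishartMoment κ (p + q)) := by
    intro Z r hZ hZ2 hZr hr k
    rw [integral_trace_pow (hs k) hn g (posSemidef_projection hZ hZ2).isHermitian, hg]
    refine Finset.sum_congr rfl fun κ hκ => ?_
    rw [orbitMean_projection hn hZ hZ2 (mem_partitions.1 hκ).2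
      (by rw [hZr]; exact_mod_cast hr), hZr, mul_assoc]
    push_cast
    rfl
  rw [← hval hΛ hΛ2 htr hp]
  simp_rw [← hval hΓ hΓ2 htrΓ hq]
  -- The random projection and its complement add up to 1, so their traces against g gᵀ add up to tr
  -- X; the relation is the binomial theorem under the integral.
  have hsub : ∀ Q : orthogonalGroup (Fin (p + q)) ℝ,
      (g * ((Q : Matrix (Fin (p + q)) (Fin (p + q)) ℝ) * Λ *
        (Q : Matrix (Fin (p + q)) (Fin (p + q)) ℝ)ᵀ) * gᵀ).trace ^ t =
      ∑ k ∈ range (t + 1), (t.choose k : ℝ) * X.trace ^ (t - k) * (-1) ^ k *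
        (g * ((Q : Matrix (Fin (p + q)) (Fin (p + q)) ℝ) * (1 - Λ) *
        (Q : Matrix (Fin (p + q)) (Fin (p + q)) ℝ)ᵀ) * gᵀ).trace ^ k := by
    intro Q
    have h1 : (g * ((Q : Matrix (Fin (p + q)) (Fin (p + q)) ℝ) * Λ *
        (Q : Matrix (Fin (p + q)) (Fin (p + q)) ℝ)ᵀ) * gᵀ).trace =
        -(g * ((Q : Matrix (Fin (p + q)) (Fin (p + q)) ℝ) * (1 - Λ) *
        (Q : Matrix (Fin (p + q)) (Fin (p + q)) ℝ)ᵀ) * gᵀ).trace + X.trace := by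
      rw [Matrix.mul_sub, Matrix.sub_mul, Matrix.mul_one, coe_mul_transpose, Matrix.mul_sub,
        Matrix.sub_mul, Matrix.mul_one, hg, trace_sub]
      ring
    rw [h1, add_pow]
    refine Finset.sum_congr rfl fun k _ => ?_
    rw [neg_pow]
    ring
  simp_rw [hsub]
  rw [integral_finsetSum]
  · simp_rw [integral_const_mul]
  · intro k _
    refine (integrable_haarO (Continuous.pow (Continuous.matrix_trace ?_) k)).const_mul _
    exact (continuous_const.matrix_mul (continuous_orthogonal_conj _)).matrix_mul continuous_const

end KummerPearson

end

/-! ### Continuation from half integers to complex parameters. -/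

noncomputable section

namespace KummerPearson

open Matrix Finset

variable {m n t : ℕ}

/-- Functions given by a complex polynomial. -/
def IsPolynomialFn (f : ℂ → ℂ) : Prop := ∃ P : Polynomial ℂ, ∀ z, f z = P.eval z

namespace IsPolynomialFn

variable {f g : ℂ → ℂ}

lemma const (c : ℂ) : IsPolynomialFn fun _ => c := ⟨Polynomial.C c, fun z => by simp⟩

lemma id' : IsPolynomialFn fun z => z := ⟨Polynomial.X, fun z => by simp⟩

lemma add (hf : IsPolynomialFn f) (hg : IsPolynomialFn g) : IsPolynomialFn fun z => f z + g z := by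
  obtain ⟨P, hP⟩ := hf
  obtain ⟨Q, hQ⟩ := hg
  exact ⟨P + Q, fun z => by simp [hP, hQ]⟩

lemma mul (hf : IsPolynomialFn f) (hg : IsPolynomialFn g) : IsPolynomialFn fun z => f z * g z := by
  obtain ⟨P, hP⟩ := hf
  obtain ⟨Q, hQ⟩ := hg
  exact ⟨P * Q, fun z => by simp [hP, hQ]⟩

lemma sub (hf : IsPolynomialFn f) (hg : IsPolynomialFn g) : IsPolynomialFn fun z => f z - g z := by
  obtain ⟨P, hP⟩ := hf
  obtain ⟨Q, hQ⟩ := hg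
  exact ⟨P - Q, fun z => by simp [hP, hQ]⟩

lemma sum {ι : Type*} (s : Finset ι) {F : ι → ℂ → ℂ} (hF : ∀ i ∈ s, IsPolynomialFn (F i)) :
    IsPolynomialFn fun z => ∑ i ∈ s, F i z := by
  classical
  induction s using Finset.induction_on with
  | empty => simpa using const 0
  | insert i s hi ih =>
    simp only [Finset.sum_insert hi]
    exact (hF i (mem_insert_self i s)).add (ih fun j hj => hF j (mem_insert_of_mem hj))

lemma prod {ι : Type*} (s : Finset ι) {F : ι → ℂ → ℂ} (hF : ∀ i ∈ s, IsPolynomialFn (F i)) :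
    IsPolynomialFn fun z => ∏ i ∈ s, F i z := by
  classical
  induction s using Finset.induction_on with
  | empty => simpa using const 1
  | insert i s hi ih =>
    simp only [Finset.prod_insert hi]
    exact (hF i (mem_insert_self i s)).mul (ih fun j hj => hF j (mem_insert_of_mem hj))

/-- A polynomial function that vanishes at all large half integers is zero. -/
lemma eq_zero (hf : IsPolynomialFn f) (N : ℕ) (h : ∀ p : ℕ, N ≤ p → f ((p : ℂ) / 2) = 0) (z : ℂ) :
    f z = 0 := by
  obtain ⟨P, hP⟩ := hf
  have hP0 : P = 0 := by
    refine Polynomial.eq_zero_of_infinite_isRoot P ?_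
    have hinj : Function.Injective fun p : ℕ => ((p + N : ℕ) : ℂ) / 2 := fun p q hpq => by
      have : ((p + N : ℕ) : ℂ) = ((q + N : ℕ) : ℂ) := by
        simpa using hpq
      have := Nat.cast_injective this
      omega
    refine (Set.infinite_range_of_injective hinj).mono ?_
    rintro _ ⟨p, rfl⟩
    rw [Set.mem_ofPred_eq, Polynomial.IsRoot, ← hP]
    exact h _ (Nat.le_add_left N p)
  rw [hP, hP0, Polynomial.eval_zero]

lemma pochPartition (hf : IsPolynomialFn f) (κ : Fin m → ℕ) :
    IsPolynomialFn fun z => KummerPearson.pochPartition (f z) κ :=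
  prod _ fun _ _ => prod _ fun _ _ => (hf.sub (const _)).add (const _)

end IsPolynomialFn

/-- The product that completes `(c)_κ` to `(c)_(t, …, t)`. -/
def pochComplement (t : ℕ) (c : ℂ) (κ : Fin m → ℕ) : ℂ :=
  ∏ i : Fin m, ∏ j ∈ Ico (κ i) t, (c - ((i : ℕ) : ℂ) / 2 + j)

lemma IsPolynomialFn.pochComplement {f : ℂ → ℂ} (hf : IsPolynomialFn f) (t : ℕ) (κ : Fin m → ℕ) :
    IsPolynomialFn fun z => KummerPearson.pochComplement t (f z) κ :=
  prod _ fun _ _ => prod _ fun _ _ => (hf.sub (const _)).add (const _)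

lemma pochPartition_mul_pochComplement (c : ℂ) {κ : Fin m → ℕ} (hκ : ∀ i, κ i ≤ t) :
    pochPartition c κ * pochComplement t c κ = pochPartition c fun _ : Fin m => t := by
  rw [pochPartition, pochComplement, pochPartition, ← Finset.prod_mul_distrib]
  exact Finset.prod_congr rfl fun i _ => Finset.prod_range_mul_prod_Ico _ (hκ i)

lemma le_of_mem_partitions {κ : Fin m → ℕ} (hκ : κ ∈ partitions m t) (i : Fin m) : κ i ≤ t := by
  rw [← (mem_partitions.1 hκ).1]
  exact Finset.single_le_sum (fun _ _ => Nat.zero_le _) (mem_univ i)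

lemma pochPartition_ne_zero {c : ℂ} (hc : ((m : ℝ) - 1) / 2 < c.re) (κ : Fin m → ℕ) :
    pochPartition c κ ≠ 0 := by
  refine Finset.prod_ne_zero_iff.2 fun i _ => Finset.prod_ne_zero_iff.2 fun j _ h0 => ?_
  have h1 := congrArg Complex.re h0
  have h2 : ((i : ℕ) : ℝ) + 1 ≤ m := by exact_mod_cast i.isLt
  have h3 : (0 : ℝ) ≤ j := Nat.cast_nonneg j
  have h4 : (((i : ℕ) : ℂ) / 2).re = ((i : ℕ) : ℝ) / 2 := by simp
  simp only [Complex.add_re, Complex.sub_re, Complex.natCast_re, Complex.zero_re, h4] at h1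
  linarith

/-- The sum `∑_κ (a)_κ / (c)_κ z_κ` over the partitions of `t`. -/
def pochSum (z : (Fin m → ℕ) → ℂ) (a c : ℂ) (t : ℕ) : ℂ :=
  ∑ κ ∈ partitions m t, pochPartition a κ / pochPartition c κ * z κ

/-- The denominators are cleared by one common factor, the same for all k ≤ t, so that only
polynomials in the parameters remain. -/
lemma sum_pochComplement (z : (Fin m → ℕ) → ℂ) (a : ℂ) {c : ℂ} {k : ℕ} (hk : k ≤ t)
    (hc : ∀ κ : Fin m → ℕ, pochPartition c κ ≠ 0) :
    ∑ κ ∈ partitions m k, pochPartition a κ * pochComplement t c κ * z κ =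
      pochPartition c (fun _ : Fin m => t) * pochSum z a c k := by
  rw [pochSum, Finset.mul_sum]
  refine Finset.sum_congr rfl fun κ hκ => ?_
  rw [← pochPartition_mul_pochComplement c fun i => (le_of_mem_partitions hκ i).trans hk]
  have := hc κ
  field_simp

/-- Kummer's relation for sums over partitions extends from half integers to all parameters. -/
lemma pochSum_eq_of_half_integers {z : (Fin m → ℕ) → ℂ} {T : ℂ}
    (h : ∀ p q : ℕ, m ≤ p → m ≤ q → ∀ t, pochSum z ((p : ℂ) / 2) ((p : ℂ) / 2 + (q : ℂ) / 2) t =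
      ∑ k ∈ range (t + 1), (t.choose k : ℂ) * T ^ (t - k) * (-1) ^ k *
        pochSum z ((q : ℂ) / 2) ((p : ℂ) / 2 + (q : ℂ) / 2) k)
    {a c : ℂ} (hc : ((m : ℝ) - 1) / 2 < c.re) (t : ℕ) :
    pochSum z a c t = ∑ k ∈ range (t + 1), (t.choose k : ℂ) * T ^ (t - k) * (-1) ^ k *
      pochSum z (c - a) c k := by
  -- The cleared difference of the two sides, with c = α + δ. It is polynomial in each variable
  -- separately; it vanishes first for all α at half integral δ, then for all δ.
  let D : ℂ → ℂ → ℂ := fun α δ =>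
    ∑ κ ∈ partitions m t, pochPartition α κ * pochComplement t (α + δ) κ * z κ -
    ∑ k ∈ range (t + 1), (t.choose k : ℂ) * T ^ (t - k) * (-1) ^ k *
      ∑ κ ∈ partitions m k, pochPartition δ κ * pochComplement t (α + δ) κ * z κ
  have hD : ∀ α δ, (∀ κ : Fin m → ℕ, pochPartition (α + δ) κ ≠ 0) →
      D α δ = pochPartition (α + δ) (fun _ : Fin m => t) * (pochSum z α (α + δ) t -
        ∑ k ∈ range (t + 1), (t.choose k : ℂ) * T ^ (t - k) * (-1) ^ k *
          pochSum z δ (α + δ) k) := by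
    intro α δ hne
    simp only [D]
    rw [sum_pochComplement z α le_rfl hne, mul_sub, Finset.mul_sum (range (t + 1))]
    congr 1
    refine Finset.sum_congr rfl fun k hk => ?_
    rw [sum_pochComplement z δ (Nat.lt_succ_iff.1 (Finset.mem_range.1 hk)) hne]
    ring
  have hpq : ∀ p q : ℕ, m ≤ p → m ≤ q → D ((p : ℂ) / 2) ((q : ℂ) / 2) = 0 := by
    intro p q hp hq
    rw [hD, h p q hp hq t, sub_self, mul_zero]
    intro κ
    refine pochPartition_ne_zero ?_ κ
    have h1 : (m : ℝ) ≤ p := by exact_mod_cast hp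
    have h2 : (m : ℝ) ≤ q := by exact_mod_cast hq
    have h3 : (0 : ℝ) ≤ m := Nat.cast_nonneg m
    have h4 : ((p : ℂ) / 2 + (q : ℂ) / 2).re = (p : ℝ) / 2 + (q : ℝ) / 2 := by simp
    rw [h4]
    linarith
  have hα : ∀ q : ℕ, m ≤ q → ∀ α, D α ((q : ℂ) / 2) = 0 := fun q hq α => by
    refine IsPolynomialFn.eq_zero (f := fun α => D α ((q : ℂ) / 2)) ?_ m
      (fun p hp => hpq p q hp hq) α
    have hadd := IsPolynomialFn.id'.add (.const ((q : ℂ) / 2))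
    exact (IsPolynomialFn.sum _ fun κ _ => ((IsPolynomialFn.id'.pochPartition κ).mul
      (hadd.pochComplement t κ)).mul (.const _)).sub
      (IsPolynomialFn.sum _ fun k _ => (IsPolynomialFn.const _).mul (IsPolynomialFn.sum _
        fun κ _ => ((IsPolynomialFn.const _).mul (hadd.pochComplement t κ)).mul (.const _)))
  have hδ : ∀ α δ, D α δ = 0 := fun α δ => by
    refine IsPolynomialFn.eq_zero (f := fun δ => D α δ) ?_ m (fun q hq => hα q hq α) δ
    have hadd := (IsPolynomialFn.const α).add IsPolynomialFn.id'
    exact (IsPolynomialFn.sum _ fun κ _ => ((IsPolynomialFn.const _).mul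
      (hadd.pochComplement t κ)).mul (.const _)).sub
      (IsPolynomialFn.sum _ fun k _ => (IsPolynomialFn.const _).mul (IsPolynomialFn.sum _
        fun κ _ => ((IsPolynomialFn.id'.pochPartition κ).mul
          (hadd.pochComplement t κ)).mul (.const _)))
  have hac := hD a (c - a)
  rw [hδ, add_sub_cancel] at hac
  have h0 := hac fun κ => pochPartition_ne_zero hc κ
  exact sub_eq_zero.1 ((mul_eq_zero.1 h0.symm).resolve_left (pochPartition_ne_zero hc _))

/-- Each factor is r - i + 2j = 2 (r/2 - i/2 + j); the powers of 2 cancel in quotients. -/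
lemma wishartMoment_eq (κ : Fin m → ℕ) (r : ℝ) :
    (wishartMoment κ r : ℂ) = 2 ^ (∑ i, κ i) * pochPartition ((r : ℂ) / 2) κ := by
  rw [wishartMoment, pochPartition, ← Finset.prod_pow_eq_pow_sum, ← Finset.prod_mul_distrib]
  push_cast
  refine Finset.prod_congr rfl fun i _ => ?_
  rw [poch, ← Finset.card_range (κ i), ← Finset.prod_const, Finset.card_range,
    ← Finset.prod_mul_distrib]
  refine Finset.prod_congr rfl fun j _ => ?_
  ring

lemma wishartMoment_div (κ : Fin m → ℕ) (r s : ℝ) :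
    ((wishartMoment κ r / wishartMoment κ s : ℝ) : ℂ) =
      pochPartition ((r : ℂ) / 2) κ / pochPartition ((s : ℂ) / 2) κ := by
  rw [Complex.ofReal_div, wishartMoment_eq, wishartMoment_eq,
    mul_div_mul_left _ _ (pow_ne_zero _ two_ne_zero)]

lemma zonal_eq_mul_sphericalFn {s : (Fin m → ℕ) → ℝ}
    (hs : ∀ κ, Antitone κ → zonalPoly κ = s κ • sphericalPoly κ) {κ : Fin m → ℕ}
    (hκ : Antitone κ) {X : Matrix (Fin m) (Fin m) ℝ} (hX : X.IsHermitian) :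
    zonal κ X hX = s κ * sphericalFn κ X := by
  rw [zonal, hs κ hκ, MvPolynomial.smul_eval, sphericalFn, integral_powerFn_conj_hermitian hκ hX]

lemma zonal_nonneg {X : Matrix (Fin m) (Fin m) ℝ} (hX : X.PosSemidef) {κ : Fin m → ℕ}
    (hκ : Antitone κ) : 0 ≤ zonal κ X hX.isHermitian := by
  obtain ⟨s, hs, hsum⟩ := exists_zonalPoly_eq_smul m
  rw [zonal, hs κ hκ, MvPolynomial.smul_eval]
  exact mul_nonneg (coeff_trace_pow_nonneg (hsum _) (mem_partitions.2 ⟨rfl, hκ⟩))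
    (eval_sphericalPoly_nonneg hκ hX.eigenvalues_nonneg)

lemma sum_zonal {X : Matrix (Fin m) (Fin m) ℝ} (hX : X.IsHermitian) (t : ℕ) :
    ∑ κ ∈ partitions m t, zonal κ X hX = X.trace ^ t := by
  obtain ⟨s, hs, hsum⟩ := exists_zonalPoly_eq_smul m
  rw [← sum_mul_sphericalFn (hsum t) hX]
  exact Finset.sum_congr rfl fun κ hκ =>
    zonal_eq_mul_sphericalFn hs (mem_partitions.1 hκ).2 hX

lemma zonal_neg {X : Matrix (Fin m) (Fin m) ℝ} (hX : X.IsHermitian) {κ : Fin m → ℕ}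
    (hκ : κ ∈ partitions m t) : zonal κ (-X) hX.neg = (-1) ^ t * zonal κ X hX := by
  obtain ⟨s, hs, -⟩ := exists_zonalPoly_eq_smul m
  obtain ⟨h1, h2⟩ := mem_partitions.1 hκ
  rw [zonal_eq_mul_sphericalFn hs h2, zonal_eq_mul_sphericalFn hs h2]
  have h3 : sphericalFn κ (-X) = (-1) ^ t * sphericalFn κ X := by
    rw [sphericalFn, sphericalFn, ← MeasureTheory.integral_const_mul]
    congr 1
    funext H
    rw [← h1, ← powerFn_smul h2]
    simp
  rw [h3]
  ring

/-- Kummer's relation for sums of zonal polynomials of a fixed degree. -/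
lemma pochSum_zonal_kummer {X : Matrix (Fin m) (Fin m) ℝ} (hX : X.PosSemidef) {a c : ℂ}
    (hc : ((m : ℝ) - 1) / 2 < c.re) (t : ℕ) :
    pochSum (fun κ => (zonal κ X hX.isHermitian : ℂ)) a c t =
      ∑ k ∈ range (t + 1), (t.choose k : ℂ) * (X.trace : ℂ) ^ (t - k) * (-1) ^ k *
        pochSum (fun κ => (zonal κ X hX.isHermitian : ℂ)) (c - a) c k := by
  obtain ⟨s, hs, hsum⟩ := exists_zonalPoly_eq_smul m
  refine pochSum_eq_of_half_integers (fun p q hp hq t => ?_) hc t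
  have hreal : ∀ r k : ℕ, pochSum (fun κ => (zonal κ X hX.isHermitian : ℂ)) ((r : ℂ) / 2)
      ((p : ℂ) / 2 + (q : ℂ) / 2) k = ((∑ κ ∈ partitions m k, s κ * sphericalFn κ X *
        (wishartMoment κ r / wishartMoment κ (p + q)) : ℝ) : ℂ) := by
    intro r k
    rw [pochSum, Complex.ofReal_sum]
    refine Finset.sum_congr rfl fun κ hκ => ?_
    rw [Complex.ofReal_mul, wishartMoment_div,
      zonal_eq_mul_sphericalFn hs (mem_partitions.1 hκ).2, mul_comm]
    push_cast
    rw [add_div]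
  simp_rw [hreal]
  rw [sum_wishartMoment_eq hsum hX hp hq t]
  push_cast
  rfl

end KummerPearson

end

/-! ### Growth estimates, rearrangement of series and the terminating case. -/

noncomputable section

namespace KummerPearson

open Matrix Finset

variable {m n t : ℕ}

lemma exists_prod_range_le {x : ℕ → ℝ} (hx : ∀ j, 0 ≤ x j) {N : ℕ} (hN : ∀ j, N ≤ j → x j ≤ 1) :
    ∃ M, ∀ k, ∏ j ∈ range k, x j ≤ M := by
  have hpos : ∀ k, 0 ≤ ∏ j ∈ range k, x j := fun k => Finset.prod_nonneg fun j _ => hx j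
  refine ⟨∑ k ∈ range (N + 1), ∏ j ∈ range k, x j, fun k => ?_⟩
  have hle : ∀ k ≤ N, ∏ j ∈ range k, x j ≤ ∑ k ∈ range (N + 1), ∏ j ∈ range k, x j :=
    fun k hk => Finset.single_le_sum (f := fun k => ∏ j ∈ range k, x j) (fun k _ => hpos k)
      (Finset.mem_range.2 (Nat.lt_succ_of_le hk))
  rcases le_total k N with hk | hk
  · exact hle k hk
  · induction k, hk using Nat.le_induction with
    | base => exact hle N le_rfl
    | succ k hk ih =>
      rw [prod_range_succ]
      exact (mul_le_of_le_one_right (hpos k) (hN k hk)).trans ih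

/-- The difference |v+j|² - |u+j|² grows like 2j Re(v-u), so all but finitely many factors of the
quotient are at most 1 in norm. -/
lemma exists_norm_poch_div_le {u v : ℂ} (hv : 0 < v.re) (huv : 0 < (v - u).re) :
    ∃ M, ∀ k, ‖poch u k / poch v k‖ ≤ M := by
  -- The exact threshold in j for |u+j| ≤ |v+j|.
  obtain ⟨N, hN⟩ := exists_nat_ge ((Complex.normSq u - Complex.normSq v) / (2 * (v - u).re))
  have hvj : ∀ j : ℕ, 0 < ‖v + j‖ := fun j => norm_pos_iff.2 fun h0 => by
    have h1 := congrArg Complex.re h0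
    simp only [Complex.add_re, Complex.natCast_re, Complex.zero_re] at h1
    have h2 : (0 : ℝ) ≤ j := Nat.cast_nonneg j
    linarith
  obtain ⟨M, hM⟩ := exists_prod_range_le (x := fun j : ℕ => ‖u + j‖ / ‖v + j‖)
    (fun j => by positivity) (N := N) (fun j hj => by
      rw [div_le_one (hvj j)]
      refine le_of_sq_le_sq ?_ (norm_nonneg _)
      have h1 : (Complex.normSq u - Complex.normSq v) / (2 * (v - u).re) ≤ j :=
        hN.trans (by exact_mod_cast hj)
      rw [div_le_iff₀ (by linarith)] at h1
      rw [← Complex.normSq_eq_norm_sq, ← Complex.normSq_eq_norm_sq]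
      simp only [Complex.normSq_apply, Complex.add_re, Complex.add_im, Complex.natCast_re,
        Complex.natCast_im, Complex.sub_re] at h1 ⊢
      nlinarith)
  refine ⟨M, fun k => ?_⟩
  rw [poch, poch, ← Finset.prod_div_distrib, norm_prod]
  simpa only [norm_div] using hM k

lemma exists_norm_pochPartition_div_le {a c : ℂ} (hc : ((m : ℝ) - 1) / 2 < c.re)
    (hca : ((m : ℝ) - 1) / 2 < (c - a).re) :
    ∃ M, ∀ κ : Fin m → ℕ, ‖pochPartition a κ / pochPartition c κ‖ ≤ M := by
  have h : ∀ i : Fin m, ∃ M, ∀ k, ‖poch (a - ((i : ℕ) : ℂ) / 2) k /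
      poch (c - ((i : ℕ) : ℂ) / 2) k‖ ≤ M := fun i => by
    have h1 : ((i : ℕ) : ℝ) + 1 ≤ m := by exact_mod_cast i.isLt
    have h2 : (0 : ℝ) ≤ ((i : ℕ) : ℝ) := Nat.cast_nonneg _
    have h4 : (((i : ℕ) : ℂ) / 2).re = ((i : ℕ) : ℝ) / 2 := by simp
    refine exists_norm_poch_div_le ?_ ?_
    · rw [Complex.sub_re, h4]
      linarith
    · rw [sub_sub_sub_cancel_right]
      linarith
  choose M hM using h
  refine ⟨∏ i, M i, fun κ => ?_⟩
  rw [pochPartition, pochPartition, ← Finset.prod_div_distrib, norm_prod]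
  exact Finset.prod_le_prod (fun i _ => norm_nonneg _) fun i _ => hM i _

/-- The sums of zonal polynomials of a fixed degree grow like the powers of the trace. -/
lemma exists_norm_pochSum_zonal_le {X : Matrix (Fin m) (Fin m) ℝ} (hX : X.PosSemidef) {a c : ℂ}
    (hc : ((m : ℝ) - 1) / 2 < c.re) (hca : ((m : ℝ) - 1) / 2 < (c - a).re) :
    ∃ M, ∀ t, ‖pochSum (fun κ => (zonal κ X hX.isHermitian : ℂ)) a c t‖ ≤ M * X.trace ^ t := by
  obtain ⟨M, hM⟩ := exists_norm_pochPartition_div_le hc hca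
  refine ⟨M, fun t => (norm_sum_le _ _).trans ?_⟩
  rw [← sum_zonal hX.isHermitian, Finset.mul_sum]
  refine Finset.sum_le_sum fun κ hκ => ?_
  have h0 := zonal_nonneg hX (mem_partitions.1 hκ).2
  rw [norm_mul, Complex.norm_real, Real.norm_of_nonneg h0]
  exact mul_le_mul_of_nonneg_right (hM κ) h0

lemma poch_div_factorial (β : ℂ) (j : ℕ) :
    poch β j / (j.factorial : ℂ) = Ring.choose (β + j - 1) j := by
  have h1 : poch β j = (ascPochhammer ℂ j).eval β := by
    rw [poch]
    induction j with
    | zero => simp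
    | succ j ih => rw [prod_range_succ, ih, ascPochhammer_succ_eval]
  have h2 := Ring.factorial_nsmul_multichoose_eq_ascPochhammer β j
  rw [Polynomial.ascPochhammer_smeval_eq_eval, ← h1, nsmul_eq_mul] at h2
  rw [Ring.choose, show β + j - 1 - j + 1 = β by ring, ← h2,
    mul_div_cancel_left₀ _ (Nat.cast_ne_zero.2 (Nat.factorial_ne_zero j))]

lemma hasSum_poch_mul_pow (β : ℂ) {x : ℂ} (hx : ‖x‖ < 1) :
    HasSum (fun j => poch β j / (j.factorial : ℂ) * x ^ j) ((1 - x) ^ (-β)) := by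
  have h := (Complex.one_div_one_sub_cpow_hasFPowerSeriesOnBall_zero β).hasSum (y := x)
    (by rwa [Metric.mem_eball, edist_eq_enorm_sub, sub_zero, ← ofReal_norm, ENNReal.ofReal_lt_one])
  simp only [FormalMultilinearSeries.ofScalars_apply_eq, smul_eq_mul, zero_add] at h
  rw [Complex.cpow_neg, ← one_div]
  simpa only [poch_div_factorial] using h

lemma summable_norm_poch_mul_pow (β : ℂ) {r : ℝ} (hr0 : 0 ≤ r) (hr : r < 1) :
    Summable fun j => ‖poch β j / (j.factorial : ℂ)‖ * r ^ j := by
  have h := (hasSum_poch_mul_pow β (x := r) (by rwa [Complex.norm_real,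
    Real.norm_of_nonneg hr0])).summable.norm
  refine h.congr fun j => ?_
  rw [norm_mul, norm_pow, Complex.norm_real, Real.norm_of_nonneg hr0]

lemma poch_add (β : ℂ) (k j : ℕ) : poch β (k + j) = poch β k * poch (β + k) j := by
  rw [poch, poch, poch, prod_range_add]
  congr 1
  refine Finset.prod_congr rfl fun i _ => ?_
  push_cast
  ring

lemma summable_poch_mul {F : ℕ → ℂ} {T M : ℝ} (hT : 0 ≤ T) (hF : ∀ t, ‖F t‖ ≤ M * T ^ t)
    (b : ℂ) {x : ℂ} (hx : ‖x‖ * T < 1) :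
    Summable fun t => poch b t / (t.factorial : ℂ) * x ^ t * F t := by
  refine Summable.of_norm_bounded
    ((summable_norm_poch_mul_pow b (mul_nonneg (norm_nonneg x) hT) hx).mul_left M) fun t => ?_
  rw [norm_mul, norm_mul, norm_pow]
  calc _ ≤ ‖poch b t / (t.factorial : ℂ)‖ * ‖x‖ ^ t * (M * T ^ t) :=
        mul_le_mul_of_nonneg_left (hF t) (by positivity)
    _ = _ := by rw [mul_pow]; ring

/-- Rearrangement of the double series that arises from a binomial transform. -/
lemma tsum_poch_binomial_transform {F G : ℕ → ℂ} {T M : ℝ} (hT : 0 ≤ T)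
    (hG : ∀ t, ‖G t‖ ≤ M * T ^ t)
    (hFG : ∀ t, F t = ∑ k ∈ range (t + 1), (t.choose k : ℂ) * (T : ℂ) ^ (t - k) * (-1) ^ k * G k)
    (b : ℂ) {x : ℂ} (hx : ‖x‖ * (2 * T) < 1) :
    ∑' t, poch b t / (t.factorial : ℂ) * x ^ t * F t = (1 - x * T) ^ (-b) *
      ∑' k, poch b k / (k.factorial : ℂ) * (-x / (1 - x * T)) ^ k * G k := by
  have hxT : ‖x * (T : ℂ)‖ < 1 := by
    rw [norm_mul, Complex.norm_real, Real.norm_of_nonneg hT]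
    nlinarith [mul_nonneg (norm_nonneg x) hT]
  have hne : (1 : ℂ) - x * T ≠ 0 := fun h0 => by
    rw [← sub_eq_zero.1 h0] at hxT
    simp at hxT
  let f : ℕ × ℕ → ℂ := fun p => poch b (p.1 + p.2) / ((p.1 + p.2).factorial : ℂ) *
    x ^ (p.1 + p.2) * (((p.1 + p.2).choose p.1 : ℂ) * (T : ℂ) ^ p.2 * (-1) ^ p.1 * G p.1)
  -- A majorant whose sum over the antidiagonal of t contains (T + T)^t; this is where 2T in the
  -- convergence condition comes from.
  let B : ℕ × ℕ → ℝ := fun p => ‖poch b (p.1 + p.2) / ((p.1 + p.2).factorial : ℂ)‖ *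
    ‖x‖ ^ (p.1 + p.2) * (((p.1 + p.2).choose p.1 : ℝ) * T ^ p.2 * (M * T ^ p.1))
  have hM : 0 ≤ M := by simpa using (norm_nonneg _).trans (hG 0)
  have hB : Summable B := by
    rw [← Finset.HasAntidiagonal.sigmaAntidiagonalEquivProd.summable_iff,
      summable_sigma_of_nonneg fun p => by
        simp only [Function.comp_apply, B]
        positivity]
    refine ⟨fun t => Summable.of_finite, ?_⟩
    refine ((summable_norm_poch_mul_pow b (r := ‖x‖ * (2 * T)) (by positivity) hx).mul_left
      M).congr fun t => ?_
    rw [tsum_fintype, Finset.univ_eq_attach]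
    change _ = ∑ p ∈ (antidiagonal t).attach, B p.1
    rw [Finset.sum_attach (antidiagonal t) (fun p => B p), mul_pow, two_mul,
      (Commute.all T T).add_pow',
      Finset.mul_sum, Finset.mul_sum, Finset.mul_sum]
    refine Finset.sum_congr rfl fun p hp => ?_
    rw [Finset.HasAntidiagonal.mem_antidiagonal] at hp
    simp only [B, hp, nsmul_eq_mul]
    ring
  have hf : Summable f := by
    refine Summable.of_norm_bounded hB fun p => ?_
    simp only [f, B, norm_mul, norm_pow, norm_neg, norm_one, one_pow, mul_one,
      Complex.norm_natCast, Complex.norm_real, Real.norm_of_nonneg hT]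
    gcongr
    exact hG _
  have h1 : HasSum (fun t => poch b t / (t.factorial : ℂ) * x ^ t * F t) (∑' p, f p) := by
    have h2 := (Finset.HasAntidiagonal.sigmaAntidiagonalEquivProd (A := ℕ)).hasSum_iff.2 hf.hasSum
    refine h2.sigma fun t => ?_
    have h3 : poch b t / (t.factorial : ℂ) * x ^ t * F t =
        ∑ p : antidiagonal t, f p.1 := by
      rw [Finset.univ_eq_attach, Finset.sum_attach (antidiagonal t) (fun p => f p), hFG,
        Finset.Nat.sum_antidiagonal_eq_sum_range_succ_mk, Finset.mul_sum]
      refine Finset.sum_congr rfl fun k hk => ?_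
      have hk' : k + (t - k) = t := by
        have := Finset.mem_range.1 hk
        omega
      simp only [f, hk']
    rw [h3]
    exact hasSum_fintype _
  -- For fixed k the sum over j is the binomial series of (1 - xT)^(-(b+k)).
  have h4 : HasSum (fun k => (1 - x * T) ^ (-b) * (poch b k / (k.factorial : ℂ) *
      (-x / (1 - x * T)) ^ k * G k)) (∑' p, f p) := by
    refine hf.hasSum.prod_fiberwise fun k => ?_
    have h5 := (hasSum_poch_mul_pow (b + k) hxT).mul_left
      (poch b k / (k.factorial : ℂ) * x ^ k * (-1) ^ k * G k)
    have h6 : poch b k / (k.factorial : ℂ) * x ^ k * (-1) ^ k * G k * (1 - x * T) ^ (-(b + k)) =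
        (1 - x * T) ^ (-b) * (poch b k / (k.factorial : ℂ) * (-x / (1 - x * T)) ^ k * G k) := by
      rw [neg_add', Complex.cpow_sub _ _ hne, Complex.cpow_natCast, div_pow, neg_pow x]
      ring
    rw [h6] at h5
    refine h5.congr_fun fun j => ?_
    have h7 : ((k + j).choose k : ℂ) = ((k + j).factorial : ℂ) /
        ((k.factorial : ℂ) * (j.factorial : ℂ)) := by
      rw [eq_div_iff (mul_ne_zero (Nat.cast_ne_zero.2 (Nat.factorial_ne_zero k))
        (Nat.cast_ne_zero.2 (Nat.factorial_ne_zero j)))]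
      have := Nat.choose_mul_factorial_mul_factorial (Nat.le_add_right k j)
      rw [Nat.add_sub_cancel_left] at this
      rw [← mul_assoc]
      exact_mod_cast this
    have h8 : ((k + j).factorial : ℂ) ≠ 0 := Nat.cast_ne_zero.2 (Nat.factorial_ne_zero _)
    simp only [f]
    rw [h7, poch_add, mul_pow, pow_add]
    field_simp
  rw [h1.tsum_eq, ← tsum_mul_left, h4.tsum_eq]

lemma poch_neg_natCast_div_factorial (n t : ℕ) :
    poch (-(n : ℂ)) t / (t.factorial : ℂ) = (-1) ^ t * (n.choose t : ℂ) := by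
  have h1 : poch (-(n : ℂ)) t = (-1) ^ t * (n.descFactorial t : ℂ) := by
    rw [poch]
    induction t with
    | zero => simp
    | succ t ih =>
      rw [prod_range_succ, ih, Nat.descFactorial_succ, pow_succ]
      rcases le_total t n with h | h
      · push_cast [Nat.cast_sub h]
        ring
      · rcases h.eq_or_lt with h | h
        · subst h
          simp
        · rw [Nat.descFactorial_of_lt h]
          simp
  rw [h1, Nat.descFactorial_eq_factorial_mul_choose, div_eq_iff
    (Nat.cast_ne_zero.2 (Nat.factorial_ne_zero t))]
  push_cast
  ring

/-- After exchanging the sums, binom(n,t) binom(t,k) = binom(n,k) binom(n-k,t-k) reduces the inner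
sum to the expansion of (D - T)^(n-k). -/
lemma sum_choose_binomial_transform {F G : ℕ → ℂ} {T : ℂ}
    (hFG : ∀ t, F t = ∑ k ∈ range (t + 1), (t.choose k : ℂ) * T ^ (t - k) * (-1) ^ k * G k)
    (n : ℕ) (D : ℂ) :
    ∑ t ∈ range (n + 1), (-1) ^ t * (n.choose t : ℂ) * D ^ (n - t) * F t =
      ∑ k ∈ range (n + 1), (n.choose k : ℂ) * (D - T) ^ (n - k) * G k := by
  simp_rw [hFG, Finset.mul_sum]
  rw [Finset.sum_comm' (t' := range (n + 1)) (s' := fun k => Ico k (n + 1)) (by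
    intro t k
    simp only [Finset.mem_range, Finset.mem_Ico]
    omega)]
  refine Finset.sum_congr rfl fun k hk => ?_
  have hk' : k ≤ n := Nat.lt_succ_iff.1 (Finset.mem_range.1 hk)
  rw [Finset.sum_Ico_eq_sum_range, sub_eq_neg_add, add_pow, Finset.mul_sum, Finset.sum_mul,
    Nat.sub_add_comm hk']
  refine Finset.sum_congr rfl fun j _ => ?_
  have h1 : (n.choose (k + j) : ℂ) * ((k + j).choose k : ℂ) =
      (n.choose k : ℂ) * ((n - k).choose j : ℂ) := by
    have := Nat.choose_mul (n := n) (Nat.le_add_right k j)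
    rw [Nat.add_sub_cancel_left] at this
    exact_mod_cast this
  have h2 : ((-1 : ℂ)) ^ (k + j) * (-1) ^ k = (-1) ^ j := by
    rw [pow_add, mul_right_comm, ← mul_pow]
    simp
  rw [Nat.add_sub_cancel_left, neg_pow T, Nat.sub_sub, ← h2]
  linear_combination ((-1) ^ (k + j) * (-1) ^ k * D ^ (n - (k + j)) * T ^ j * G k) * h1

/-- A positive factor does not change the argument, so the principal branch is multiplicative here,
even for negative z. -/
lemma ofReal_mul_cpow {r : ℝ} (hr : 0 < r) {z : ℂ} (hz : z ≠ 0) (w : ℂ) :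
    ((r : ℂ) * z) ^ w = (r : ℂ) ^ w * z ^ w := by
  have hr' : (r : ℂ) ≠ 0 := Complex.ofReal_ne_zero.2 hr.ne'
  rw [Complex.cpow_def_of_ne_zero (mul_ne_zero hr' hz), Complex.cpow_def_of_ne_zero hr',
    Complex.cpow_def_of_ne_zero hz, Complex.log_ofReal_mul hr hz, ← Complex.exp_add,
    Complex.ofReal_log hr.le, add_mul]

lemma onePoneTerm_eq (f : ℕ → ℂ) (a c : ℂ) {X : Matrix (Fin m) (Fin m) ℝ} (hX : X.IsHermitian)
    (t : ℕ) : onePoneTerm f a c X hX t =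
      f t / (t.factorial : ℂ) * pochSum (fun κ => (zonal κ X hX : ℂ)) a c t := rfl

lemma onePoneTerm_neg (f : ℕ → ℂ) (a c : ℂ) {X : Matrix (Fin m) (Fin m) ℝ} (hX : X.IsHermitian)
    (t : ℕ) : onePoneTerm f a c (-X) hX.neg t = f t / (t.factorial : ℂ) *
      ((-1) ^ t * pochSum (fun κ => (zonal κ X hX : ℂ)) a c t) := by
  rw [onePoneTerm, pochSum, Finset.mul_sum (partitions m t) _ ((-1) ^ t)]
  refine congrArg (f t / (t.factorial : ℂ) * ·) (Finset.sum_congr rfl fun κ hκ => ?_)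
  rw [zonal_neg hX hκ]
  push_cast
  ring

/-- The relation of the two series outside the common disk of convergence. -/
lemma kummer_series {X : Matrix (Fin m) (Fin m) ℝ} (hX : X.IsHermitian) {a c : ℂ} {T : ℝ}
    (hT : 0 ≤ T)
    (hFG : ∀ t, pochSum (fun κ => (zonal κ X hX : ℂ)) a c t = ∑ k ∈ range (t + 1),
      (t.choose k : ℂ) * (T : ℂ) ^ (t - k) * (-1) ^ k *
        pochSum (fun κ => (zonal κ X hX : ℂ)) (c - a) c k)
    (hGF : ∀ t, pochSum (fun κ => (zonal κ X hX : ℂ)) (c - a) c t = ∑ k ∈ range (t + 1),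
      (t.choose k : ℂ) * (T : ℂ) ^ (t - k) * (-1) ^ k *
        pochSum (fun κ => (zonal κ X hX : ℂ)) a c k)
    (hF : ∃ M, ∀ t, ‖pochSum (fun κ => (zonal κ X hX : ℂ)) a c t‖ ≤ M * T ^ t)
    (hG : ∃ M, ∀ t, ‖pochSum (fun κ => (zonal κ X hX : ℂ)) (c - a) c t‖ ≤ M * T ^ t)
    (b : ℂ) {d : ℝ} (h1 : T < |d|) (h2 : T < |d - T|) :
    Summable (onePoneTerm (fun t => poch b t * (d : ℂ) ^ (-b - (t : ℂ))) a c X hX) ∧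
    Summable (onePoneTerm (fun t => poch b t * ((d - T : ℝ) : ℂ) ^ (-(t : ℂ)))
      (c - a) c (-X) hX.neg) ∧
    onePone (fun t => poch b t * (d : ℂ) ^ (-b - (t : ℂ))) a c X hX =
      ((d - T : ℝ) : ℂ) ^ (-b) *
        onePone (fun t => poch b t * ((d - T : ℝ) : ℂ) ^ (-(t : ℂ))) (c - a) c (-X) hX.neg := by
  obtain ⟨M, hM⟩ := hF
  obtain ⟨N, hN⟩ := hG
  set F := pochSum (fun κ => (zonal κ X hX : ℂ)) a c with hFdef
  set G := pochSum (fun κ => (zonal κ X hX : ℂ)) (c - a) c with hGdef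
  have hd0 : d ≠ 0 := abs_pos.1 (hT.trans_lt h1)
  have hd : (d : ℂ) ≠ 0 := Complex.ofReal_ne_zero.2 hd0
  have he0 : d - T ≠ 0 := abs_pos.1 (hT.trans_lt h2)
  have he : ((d - T : ℝ) : ℂ) ≠ 0 := Complex.ofReal_ne_zero.2 he0
  have hterm1 : ∀ t, onePoneTerm (fun t => poch b t * (d : ℂ) ^ (-b - (t : ℂ))) a c X hX t =
      (d : ℂ) ^ (-b) * (poch b t / (t.factorial : ℂ) * ((d : ℂ)⁻¹) ^ t * F t) := fun t => by
    rw [onePoneTerm_eq, Complex.cpow_sub _ _ hd, Complex.cpow_natCast, inv_pow]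
    ring
  have hterm2 : ∀ t, onePoneTerm (fun t => poch b t * ((d - T : ℝ) : ℂ) ^ (-(t : ℂ)))
      (c - a) c (-X) hX.neg t =
      poch b t / (t.factorial : ℂ) * (-((d - T : ℝ) : ℂ)⁻¹) ^ t * G t := fun t => by
    rw [onePoneTerm_neg _ _ _ hX, Complex.cpow_neg, Complex.cpow_natCast,
      neg_pow ((d - T : ℝ) : ℂ)⁻¹, inv_pow]
    ring
  have hn1 : ‖(d : ℂ)⁻¹‖ * T < 1 := by
    rw [norm_inv, Complex.norm_real, Real.norm_eq_abs, inv_mul_lt_one₀ (hT.trans_lt h1)]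
    exact h1
  have hn2 : ‖-((d - T : ℝ) : ℂ)⁻¹‖ * T < 1 := by
    rw [norm_neg, norm_inv, Complex.norm_real, Real.norm_eq_abs,
      inv_mul_lt_one₀ (hT.trans_lt h2)]
    exact h2
  have hs1 : Summable fun t => (d : ℂ) ^ (-b) *
      (poch b t / (t.factorial : ℂ) * ((d : ℂ)⁻¹) ^ t * F t) :=
    (summable_poch_mul hT hM b hn1).mul_left _
  have hs2 := summable_poch_mul hT hN b hn2
  refine ⟨hs1.congr fun t => (hterm1 t).symm, hs2.congr fun t => (hterm2 t).symm, ?_⟩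
  rw [onePone, onePone, tsum_congr hterm1, tsum_congr hterm2, tsum_mul_left]
  have hde : ((d - T : ℝ) : ℂ) = d - T := by push_cast; rfl
  rcases lt_or_gt_of_ne hd0 with hneg | hpos
  -- Here |d - T| = T - d > 2T, so the transform is used from the right-hand series to the left,
  -- with x = -1/(d - T).
  · rw [abs_of_neg hneg] at h1
    have hx : ‖-((d - T : ℝ) : ℂ)⁻¹‖ * (2 * T) < 1 := by
      rw [norm_neg, norm_inv, Complex.norm_real, Real.norm_eq_abs,
        inv_mul_lt_one₀ (hT.trans_lt h2), abs_of_neg (by linarith)]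
      linarith
    rw [tsum_poch_binomial_transform hT hM hGF b hx]
    have e1 : (1 : ℂ) - -((d - T : ℝ) : ℂ)⁻¹ * T = ((d / (d - T) : ℝ) : ℂ) := by
      rw [Complex.ofReal_div]
      field_simp
      rw [hde]; ring
    have e2 : - -((d - T : ℝ) : ℂ)⁻¹ / ((d / (d - T) : ℝ) : ℂ) = (d : ℂ)⁻¹ := by
      rw [Complex.ofReal_div]
      field_simp
    have hr : 0 < d / (d - T) := div_pos_of_neg_of_neg hneg (by linarith)
    have e3 : (d : ℂ) = ((d / (d - T) : ℝ) : ℂ) * ((d - T : ℝ) : ℂ) := by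
      rw [← Complex.ofReal_mul, div_mul_cancel₀ _ he0]
    rw [e1, e2, ← mul_assoc]
    congr 1
    conv_lhs => rw [e3]
    rw [ofReal_mul_cpow hr he, mul_comm]
  -- Here d > T, so d - T is positive and the second condition says d > 2T; the transform is used
  -- with x = 1/d.
  · rw [abs_of_pos hpos] at h1
    rw [abs_of_pos (by linarith)] at h2
    have hx : ‖(d : ℂ)⁻¹‖ * (2 * T) < 1 := by
      rw [norm_inv, Complex.norm_real, Real.norm_eq_abs, abs_of_pos hpos, inv_mul_lt_one₀ hpos]
      linarith
    rw [tsum_poch_binomial_transform hT hN hFG b hx]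
    have e1 : (1 : ℂ) - (d : ℂ)⁻¹ * T = (((d - T) / d : ℝ) : ℂ) := by
      rw [Complex.ofReal_div, hde]
      field_simp
    have e2 : -(d : ℂ)⁻¹ / (((d - T) / d : ℝ) : ℂ) = -((d - T : ℝ) : ℂ)⁻¹ := by
      rw [Complex.ofReal_div]
      field_simp
    have hr : 0 < (d - T) / d := div_pos (by linarith) hpos
    have e3 : ((d - T : ℝ) : ℂ) = (((d - T) / d : ℝ) : ℂ) * (d : ℂ) := by
      rw [← Complex.ofReal_mul, div_mul_cancel₀ _ hd0]
    rw [e1, e2, ← mul_assoc]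
    congr 1
    conv_rhs => rw [e3]
    rw [ofReal_mul_cpow hr hd, mul_comm]

/-- The relation of the two series when they terminate. -/
lemma kummer_terminating {X : Matrix (Fin m) (Fin m) ℝ} (hX : X.IsHermitian) {a c : ℂ} {T : ℝ}
    (hFG : ∀ t, pochSum (fun κ => (zonal κ X hX : ℂ)) a c t = ∑ k ∈ range (t + 1),
      (t.choose k : ℂ) * (T : ℂ) ^ (t - k) * (-1) ^ k *
        pochSum (fun κ => (zonal κ X hX : ℂ)) (c - a) c k)
    (n : ℕ) {d : ℝ} (hd : d ≠ T) :
    Summable (onePoneTerm (fun t => poch (-(n : ℂ)) t * (d : ℂ) ^ (-(-(n : ℂ)) - (t : ℂ)))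
      a c X hX) ∧
    Summable (onePoneTerm (fun t => poch (-(n : ℂ)) t * ((d - T : ℝ) : ℂ) ^ (-(t : ℂ)))
      (c - a) c (-X) hX.neg) ∧
    onePone (fun t => poch (-(n : ℂ)) t * (d : ℂ) ^ (-(-(n : ℂ)) - (t : ℂ))) a c X hX =
      ((d - T : ℝ) : ℂ) ^ (-(-(n : ℂ))) * onePone (fun t => poch (-(n : ℂ)) t *
        ((d - T : ℝ) : ℂ) ^ (-(t : ℂ))) (c - a) c (-X) hX.neg := by
  have he : ((d - T : ℝ) : ℂ) ≠ 0 := Complex.ofReal_ne_zero.2 (sub_ne_zero.2 hd)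
  have hzero : ∀ t, t ∉ range (n + 1) → poch (-(n : ℂ)) t = 0 := fun t ht => by
    have h1 := poch_neg_natCast_div_factorial n t
    rw [Nat.choose_eq_zero_of_lt (by simpa using ht), Nat.cast_zero, mul_zero, div_eq_zero_iff]
      at h1
    exact h1.resolve_right (Nat.cast_ne_zero.2 (Nat.factorial_ne_zero t))
  have hz1 : ∀ t, t ∉ range (n + 1) → onePoneTerm (fun t => poch (-(n : ℂ)) t *
      (d : ℂ) ^ (-(-(n : ℂ)) - (t : ℂ))) a c X hX t = 0 := fun t ht => by
    simp [onePoneTerm, hzero t ht]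
  have hz2 : ∀ t, t ∉ range (n + 1) → onePoneTerm (fun t => poch (-(n : ℂ)) t *
      ((d - T : ℝ) : ℂ) ^ (-(t : ℂ))) (c - a) c (-X) hX.neg t = 0 := fun t ht => by
    simp [onePoneTerm, hzero t ht]
  refine ⟨summable_of_ne_finset_zero hz1, summable_of_ne_finset_zero hz2, ?_⟩
  rw [onePone, onePone, tsum_eq_sum hz1, tsum_eq_sum hz2, neg_neg, Complex.cpow_natCast,
    Finset.mul_sum]
  have h := sum_choose_binomial_transform hFG n (d : ℂ)
  refine Eq.trans (Finset.sum_congr rfl fun t ht => ?_) (h.trans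
    (Finset.sum_congr rfl fun t ht => ?_))
  -- For t ≤ n the exponent is the natural number n - t, so d = 0 is allowed, with 0^0 = 1.
  · have hle : t ≤ n := Nat.lt_succ_iff.1 (Finset.mem_range.1 ht)
    rw [onePoneTerm_eq, ← poch_neg_natCast_div_factorial, ← Nat.cast_sub hle,
      Complex.cpow_natCast]
    ring
  · have hle : t ≤ n := Nat.lt_succ_iff.1 (Finset.mem_range.1 ht)
    rw [onePoneTerm_neg _ _ _ hX, mul_div_right_comm, poch_neg_natCast_div_factorial,
      Complex.cpow_neg,
      Complex.cpow_natCast, pow_sub₀ _ (by push_cast at he; exact he) hle]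
    have h3 : ((-1 : ℂ)) ^ t * (-1) ^ t = 1 := by
      rw [← mul_pow]; simp
    push_cast
    linear_combination (-((d : ℂ) - T) ^ n * (n.choose t : ℂ) * (((d : ℂ) - T) ^ t)⁻¹ *
      pochSum (fun κ => (zonal κ X hX : ℂ)) (c - a) c t) * h3

end KummerPearson

end

/-! ### The Kummer–Pearson VII relation. -/

theorem mainTheorem1 {m : ℕ} (X : Matrix (Fin m) (Fin m) ℝ) (hX : X.PosDef) (a c : ℂ)
    (ha : ((m : ℝ) - 1) / 2 < a.re) (hc : ((m : ℝ) - 1) / 2 < c.re)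
    (hca : ((m : ℝ) - 1) / 2 < (c - a).re) (b d : ℝ)
    (hbd : (X.trace < |d| ∧ X.trace < |d - X.trace|) ∨
      ((∃ n : ℕ, b = -(n : ℝ)) ∧ d ≠ X.trace)) :
    Summable (KummerPearson.onePoneTerm
      (fun t => KummerPearson.poch b t * (d : ℂ) ^ (-(b : ℂ) - (t : ℂ)))
      a c X hX.isHermitian) ∧
    Summable (KummerPearson.onePoneTerm
      (fun t => KummerPearson.poch b t * ((d - X.trace : ℝ) : ℂ) ^ (-(t : ℂ)))
      (c - a) c (-X) hX.isHermitian.neg) ∧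
    KummerPearson.onePone
      (fun t => KummerPearson.poch b t * (d : ℂ) ^ (-(b : ℂ) - (t : ℂ)))
      a c X hX.isHermitian =
    ((d - X.trace : ℝ) : ℂ) ^ (-(b : ℂ)) *
      KummerPearson.onePone
        (fun t => KummerPearson.poch b t * ((d - X.trace : ℝ) : ℂ) ^ (-(t : ℂ)))
        (c - a) c (-X) hX.isHermitian.neg := by
  have hps := hX.posSemidef
  set F := KummerPearson.pochSum (fun κ => (KummerPearson.zonal κ X hX.isHermitian : ℂ)) a c
  set G := KummerPearson.pochSum (fun κ => (KummerPearson.zonal κ X hX.isHermitian : ℂ)) (c - a) c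
  set T := X.trace
  have hT : 0 ≤ T := hps.trace_nonneg
  have hFG : ∀ t, F t = ∑ k ∈ Finset.range (t + 1), (t.choose k : ℂ) * (T : ℂ) ^ (t - k) *
      (-1) ^ k * G k := KummerPearson.pochSum_zonal_kummer hps hc
  -- The binomial transform is an involution: exchanging a and c - a gives the inverse relation,
  -- needed for negative d.
  have hGF : ∀ t, G t = ∑ k ∈ Finset.range (t + 1), (t.choose k : ℂ) * (T : ℂ) ^ (t - k) *
      (-1) ^ k * F k := fun t => by
    have h := KummerPearson.pochSum_zonal_kummer hps (a := c - a) hc t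
    rwa [sub_sub_cancel] at h
  rcases hbd with ⟨h1, h2⟩ | ⟨⟨n, hb⟩, hd⟩
  · exact KummerPearson.kummer_series hX.isHermitian hT hFG hGF
      (KummerPearson.exists_norm_pochSum_zonal_le hps hc hca)
      (KummerPearson.exists_norm_pochSum_zonal_le hps hc (by rwa [sub_sub_cancel])) b h1 h2
  · have hb' : (b : ℂ) = -(n : ℂ) := by rw [hb]; push_cast; rfl
    rw [hb']
    exact KummerPearson.kummer_terminating hX.isHermitian hFG n hd
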